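/- Let $\Omega\subset\mathbb R^3$ be a bounded domain (non-empty, open, connected) with $C^1$ boundary, let $\nu$ be its outward unit normal and $\upsigma$ the surface measure on $\partial\Omega$. For $a\in\mathbb R^3$ put $\sigma\cdot a:=a_1\sigma_1+a_2\sigma_2+a_3\sigma_3$ with the Pauli matrices $$\sigma_1=\begin{pmatrix}0&1\\1&0\end{pmatrix},\quad \sigma_2=\begin{pmatrix}0&-i\\i&0\end{pmatrix},\quad \sigma_3=\begin{pmatrix}1&0\\0&-1\end{pmatrix},$$ and let $\sigma\cdot\nu$ also denote the operator of pointwise multiplication by $\sigma\cdot\nu$ in $L^2(\partial\Omega)^2:=L^2(\partial\Omega,\upsigma;\mathbb C^2)$. Let $W_m$ be the operator in $L^2(\partial\Omega)^2$ given by $$W_m u(x):=\lim_{\epsilon\downarrow0}\frac{1}{4\pi}\int_{\{y\in\partial\Omega:\,|x-y|>\epsilon\}} i\,\Big(\sigma\cdot\frac{x-y}{|x-y|^3}\Big)u(y)\,d\upsigma(y)\qquad\text{for $\upsigma$-a.e. }x\in\partial\Omega,$$ on its natural domain, namely all $u\in L^2(\partial\Omega)^2$ for which this limit exists for $\upsigma$-a.e.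 $x\in\partial\Omega$ and defines an element of $L^2(\partial\Omega)^2$ (by a classical theorem this is all of $L^2(\partial\Omega)^2$). Set $$P_\pm:=\tfrac12\pm iW_m(\sigma\cdot\nu),$$ and let $\{W_m,\sigma\cdot\nu\}:=W_m(\sigma\cdot\nu)+(\sigma\cdot\nu)W_m$. Then the following are equivalent: (i) $P_+$ and $P_-$ are self-adjoint operators in $L^2(\partial\Omega)^2$; (ii) $P_+$ and $P_-$ are orthogonal projections of $L^2(\partial\Omega)^2$ (each is defined on all of $L^2(\partial\Omega)^2$ and is the orthogonal projection onto a closed subspace); (iii) $\{W_m,\sigma\cdot\nu\}=0$ as operators in $L^2(\partial\Omega)^2$ (defined on all of $L^2(\partial\Omega)^2$); (iv) $\Omega$ is a ball. -/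

import Mathlib

open MeasureTheory Filter Topology

noncomputable section

/-- Euclidean three-space. -/
abbrev E3 : Type := EuclideanSpace ℝ (Fin 3)

/-- The spinor space `ℂ²` with its Hermitian norm. -/
abbrev Spinor : Type := EuclideanSpace ℂ (Fin 2)

/-! ### Domains with `C¹` boundary, outward normal, surface measure -/

/-- `ρ` is a `C¹` defining function of `Ω` near `x`: it is of class `C¹` near `x`, vanishes
at `x`, has non-zero gradient at `x`, and near `x` the set `Ω` is exactly `{ρ < 0}`. By the implicit
function theorem such a `ρ` exists iff near `x` the set `Ω` is, in suitable Cartesian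
coordinates, the strict subgraph of a `C¹` function whose graph passes through `x`. -/
structure IsDefiningFunctionAt (Ω : Set E3) (x : E3) (ρ : E3 → ℝ) : Prop where
  contDiffAt : ContDiffAt ℝ 1 ρ x
  apply_eq_zero : ρ x = 0
  gradient_ne_zero : gradient ρ x ≠ 0
  eventually_mem_iff : ∀ᶠ y in 𝓝 x, y ∈ Ω ↔ ρ y < 0

/-- Bounded domains (non-empty connected open sets) of `ℝ³` with `C¹` boundary. -/
structure IsBoundedC1Domain (Ω : Set E3) : Prop where
  isOpen : IsOpen Ω
  isConnected : IsConnected Ω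
  isBounded : Bornology.IsBounded Ω
  boundary : ∀ x ∈ frontier Ω, ∃ ρ : E3 → ℝ, IsDefiningFunctionAt Ω x ρ

/-- `n` is the unit normal at the boundary point `x` pointing outwards of `Ω`: the normalized
gradient of a local defining function (it does not depend on the defining function). -/
def IsOutwardUnitNormal (Ω : Set E3) (x n : E3) : Prop :=
  ∃ ρ : E3 → ℝ, IsDefiningFunctionAt Ω x ρ ∧ n = ‖gradient ρ x‖⁻¹ • gradient ρ x

open Classical in
/-- The outward unit normal field `ν` on `∂Ω` (set to `0` where there is no such normal, which does
not happen on the boundary of a `C¹` domain). -/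
def outwardNormal (Ω : Set E3) (x : E3) : E3 :=
  if h : ∃ n, IsOutwardUnitNormal Ω x n then h.choose else 0

/-- The surface measure on `∂Ω`: two-dimensional Hausdorff measure, normalized so
that it agrees with Lebesgue measure on planes, restricted to `∂Ω`. -/
def surfaceMeasure (Ω : Set E3) : Measure E3 :=
  (Measure.euclideanHausdorffMeasure 2 : Measure E3).restrict (frontier Ω)

/-- The complex Hilbert space `L²(∂Ω)²`. -/
abbrev BoundaryL2 (Ω : Set E3) : Type := Lp Spinor 2 (surfaceMeasure Ω)

/-! ### Pauli matrices -/

/-- The matrix `σ · a = a₁ σ₁ + a₂ σ₂ + a₃ σ₃`, with `σ₁, σ₂, σ₃` the Pauli matrices. -/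
def sigmaDot (a : E3) : Matrix (Fin 2) (Fin 2) ℂ :=
  (a 0 : ℂ) • !![0, 1; 1, 0] + (a 1 : ℂ) • !![0, -Complex.I; Complex.I, 0]
    + (a 2 : ℂ) • !![1, 0; 0, -1]

/-- The action of `σ · a` on spinors. -/
def sigmaAct (a : E3) : Spinor →L[ℂ] Spinor :=
  Matrix.toEuclideanCLM (n := Fin 2) (𝕜 := ℂ) (sigmaDot a)

/-! ### The singular integral operator `W_m` -/

/-- The kernel `w_m(z) = i σ · z / |z|³`. -/
def kernelW (z : E3) : Spinor →L[ℂ] Spinor :=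
  (Complex.I * ((‖z‖ ^ 3)⁻¹ : ℝ)) • sigmaAct z

/-- `v` is the value at `x` of the principal value integral
`lim_{ε ↓ 0} (1 / 4π) ∫_{y ∈ ∂Ω, |x - y| > ε} w_m(x - y) u(y) dσ(y)`: all truncated integrals
converge absolutely (this is automatic for `u` square integrable when `∂Ω` has finite surface
measure) and the limit exists and equals `v`. -/
def HasPrincipalValue (Ω : Set E3) (u : E3 → Spinor) (x : E3) (v : Spinor) : Prop :=
  (∀ ε : ℝ, 0 < ε →
    IntegrableOn (fun y => kernelW (x - y) (u y)) {y | ε < ‖x - y‖} (surfaceMeasure Ω)) ∧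
  Tendsto (fun ε : ℝ => ((4 * Real.pi)⁻¹ : ℝ) •
      ∫ y in {y | ε < ‖x - y‖}, kernelW (x - y) (u y) ∂(surfaceMeasure Ω))
    (𝓝[>] 0) (𝓝 v)

theorem HasPrincipalValue.congr {Ω : Set E3} {u u' : E3 → Spinor} {x : E3} {v : Spinor}
    (h : HasPrincipalValue Ω u x v) (huu' : u =ᵐ[surfaceMeasure Ω] u') :
    HasPrincipalValue Ω u' x v := by
  have key : ∀ ε : ℝ, (fun y => kernelW (x - y) (u y))
      =ᵐ[(surfaceMeasure Ω).restrict {y | ε < ‖x - y‖}] fun y => kernelW (x - y) (u' y) :=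
    fun ε => (ae_restrict_of_ae huu').mono fun y hy => by simp only [hy]
  refine ⟨fun ε hε => (h.1 ε hε).congr (key ε), h.2.congr fun ε => ?_⟩
  rw [integral_congr_ae (key ε)]

theorem HasPrincipalValue.zero (Ω : Set E3) (x : E3) :
    HasPrincipalValue Ω (fun _ => 0) x 0 := by
  simp [HasPrincipalValue]

theorem HasPrincipalValue.add {Ω : Set E3} {u u' : E3 → Spinor} {x : E3} {v v' : Spinor}
    (h : HasPrincipalValue Ω u x v) (h' : HasPrincipalValue Ω u' x v') :
    HasPrincipalValue Ω (fun y => u y + u' y) x (v + v') := by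
  refine ⟨fun ε hε => ?_, (h.2.add h'.2).congr' ?_⟩
  · simp only [map_add]
    exact Integrable.add (h.1 ε hε) (h'.1 ε hε)
  · filter_upwards [self_mem_nhdsWithin] with ε hε
    simp only [map_add]
    rw [integral_add (h.1 ε hε) (h'.1 ε hε), smul_add]

theorem HasPrincipalValue.smul {Ω : Set E3} {u : E3 → Spinor} {x : E3} {v : Spinor}
    (c : ℂ) (h : HasPrincipalValue Ω u x v) :
    HasPrincipalValue Ω (fun y => c • u y) x (c • v) := by
  refine ⟨fun ε hε => ?_, (h.2.const_smul c).congr fun ε => ?_⟩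
  · simp only [map_smul]
    exact Integrable.smul c (h.1 ε hε)
  · simp only [map_smul]
    rw [integral_smul, smul_comm]

theorem HasPrincipalValue.unique {Ω : Set E3} {u : E3 → Spinor} {x : E3} {v v' : Spinor}
    (h : HasPrincipalValue Ω u x v) (h' : HasPrincipalValue Ω u x v') : v = v' :=
  tendsto_nhds_unique h.2 h'.2

/-- The graph of `W_m`: pairs `(u, v)` in `L²(∂Ω)²` such that the principal value integral of `u` at
`x` exists and equals `v(x)`, for almost every `x ∈ ∂Ω`. -/
def graphW (Ω : Set E3) : Submodule ℂ (BoundaryL2 Ω × BoundaryL2 Ω) where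
  carrier := {p | ∀ᵐ x ∂(surfaceMeasure Ω), HasPrincipalValue Ω p.1 x (p.2 x)}
  zero_mem' := by
    have h0 := Lp.coeFn_zero Spinor 2 (surfaceMeasure Ω)
    filter_upwards [h0] with x hx
    simp only [Prod.fst_zero, Prod.snd_zero, hx]
    exact (HasPrincipalValue.zero Ω x).congr h0.symm
  add_mem' := by
    intro p q hp hq
    filter_upwards [hp, hq, Lp.coeFn_add p.2 q.2] with x hpx hqx hx
    simp only [Prod.fst_add, Prod.snd_add, hx]
    exact (hpx.add hqx).congr (Lp.coeFn_add p.1 q.1).symm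
  smul_mem' := by
    intro c p hp
    filter_upwards [hp, Lp.coeFn_smul c p.2] with x hpx hx
    simp only [Prod.smul_fst, Prod.smul_snd, hx]
    exact (hpx.smul c).congr (Lp.coeFn_smul c p.1).symm

/-- The operator `W_m` in `L²(∂Ω)²`, given by the principal value integral on the
largest possible domain: all `u` in `L²(∂Ω)²` for which the principal value exists almost everywhere
and defines an element of `L²(∂Ω)²`. -/
def opW (Ω : Set E3) : BoundaryL2 Ω →ₗ.[ℂ] BoundaryL2 Ω := (graphW Ω).toLinearPMap

/-- `W_m` is the operator with graph `graphW Ω`. -/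
theorem opW_graph (Ω : Set E3) : (opW Ω).graph = graphW Ω := by
  refine Submodule.toLinearPMap_graph_eq _ ?_
  rintro ⟨u, v⟩ h hu
  have hu : u = 0 := hu
  subst hu
  have h : ∀ᵐ x ∂(surfaceMeasure Ω),
    HasPrincipalValue Ω (0 : BoundaryL2 Ω) x (v x) := h
  have h0 := Lp.coeFn_zero Spinor 2 (surfaceMeasure Ω)
  refine Lp.ext ?_
  filter_upwards [h, h0] with x hx hx0
  rw [hx0]
  exact (hx.congr h0).unique (HasPrincipalValue.zero Ω x)

/-! ### Multiplication by `σ · ν` -/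

/-- The graph of the multiplication by `σ · ν`. -/
def graphSigmaNu (Ω : Set E3) : Submodule ℂ (BoundaryL2 Ω × BoundaryL2 Ω) where
  carrier := {p | ∀ᵐ x ∂(surfaceMeasure Ω), p.2 x = sigmaAct (outwardNormal Ω x) (p.1 x)}
  zero_mem' := by
    filter_upwards [Lp.coeFn_zero Spinor 2 (surfaceMeasure Ω)] with x hx
    simp only [Prod.fst_zero, Prod.snd_zero, hx, Pi.zero_apply, map_zero]
  add_mem' := by
    intro p q hp hq
    filter_upwards [hp, hq, Lp.coeFn_add p.1 q.1, Lp.coeFn_add p.2 q.2] with x hpx hqx h1 h2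
    simp only [Prod.fst_add, Prod.snd_add, h1, h2, Pi.add_apply, hpx, hqx, map_add]
  smul_mem' := by
    intro c p hp
    filter_upwards [hp, Lp.coeFn_smul c p.1, Lp.coeFn_smul c p.2] with x hpx h1 h2
    simp only [Prod.smul_fst, Prod.smul_snd, h1, h2, Pi.smul_apply, hpx, map_smul]

/-- The operator of multiplication by `σ · ν` in `L²(∂Ω)²`. (Its domain is the whole space when `ν`
is measurable, in particular for `C¹` domains.) -/
def opSigmaNu (Ω : Set E3) : BoundaryL2 Ω →ₗ.[ℂ] BoundaryL2 Ω := (graphSigmaNu Ω).toLinearPMap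

/-- `σ · ν` is the operator with graph `graphSigmaNu Ω`. -/
theorem opSigmaNu_graph (Ω : Set E3) : (opSigmaNu Ω).graph = graphSigmaNu Ω := by
  refine Submodule.toLinearPMap_graph_eq _ ?_
  rintro ⟨u, v⟩ h hu
  have hu : u = 0 := hu
  subst hu
  have h : ∀ᵐ x ∂(surfaceMeasure Ω),
    v x = sigmaAct (outwardNormal Ω x) ((0 : BoundaryL2 Ω) x) := h
  have h0 := Lp.coeFn_zero Spinor 2 (surfaceMeasure Ω)
  refine Lp.ext ?_
  filter_upwards [h, h0] with x hx hx0
  rw [hx, hx0]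
  simp

/-! ### Algebra of operators, the projections `P_±` -/

/-- The product `T S` of two operators in a Hilbert space, on its natural domain
`{u ∈ dom S | S u ∈ dom T}`. -/
def opMul {H : Type*} [AddCommGroup H] [Module ℂ H] (T S : H →ₗ.[ℂ] H) : H →ₗ.[ℂ] H :=
  T.comp (S.domRestrict ((T.domain.comap S.toFun).map S.domain.subtype)) (by
    intro x
    obtain ⟨y, hy, hyx⟩ := x.2.1
    exact (LinearPMap.domRestrict_apply (f := S) (x := x) (y := y) hyx.symm) ▸ hy)

/-- The identity operator, defined on the whole space. -/
def opOne (H : Type*) [AddCommGroup H] [Module ℂ H] : H →ₗ.[ℂ] H :=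
  (LinearMap.id : H →ₗ[ℂ] H).toPMap ⊤

/-- `P_+ = 1/2 + i W_m (σ · ν)`. -/
def opPPlus (Ω : Set E3) : BoundaryL2 Ω →ₗ.[ℂ] BoundaryL2 Ω :=
  (1 / 2 : ℂ) • opOne (BoundaryL2 Ω) + Complex.I • opMul (opW Ω) (opSigmaNu Ω)

/-- `P_- = 1/2 - i W_m (σ · ν)`. -/
def opPMinus (Ω : Set E3) : BoundaryL2 Ω →ₗ.[ℂ] BoundaryL2 Ω :=
  (1 / 2 : ℂ) • opOne (BoundaryL2 Ω) - Complex.I • opMul (opW Ω) (opSigmaNu Ω)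

/-- The anticommutator `{T, S} = T S + S T`, on its natural domain. -/
def anticommutator {H : Type*} [AddCommGroup H] [Module ℂ H] (T S : H →ₗ.[ℂ] H) : H →ₗ.[ℂ] H :=
  opMul T S + opMul S T

/-- `T` is an orthogonal projection: it is defined on the whole Hilbert space and it is the
orthogonal projection onto some closed subspace. -/
def IsOrthogonalProjection {H : Type*} [NormedAddCommGroup H] [InnerProductSpace ℂ H]
    (T : H →ₗ.[ℂ] H) : Prop :=
  ∃ (K : Submodule ℂ H) (_ : K.HasOrthogonalProjection),
    T = (K.starProjection : H →ₗ[ℂ] H).toPMap ⊤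

end

/-! Necessity of the ball. Away from the diagonal `W_m` is an ordinary integral operator, so an
operator identity can be localised with cut-offs around two distinct boundary points p and q. Both
the anticommutation relation and the self-adjointness of P_+ then give the pointwise identity σ·ν(p)
w(p-q) + w(p-q) σ·ν(q) = 0 (`kernel_identity_of_anticommutator`, `kernel_identity_of_isSelfAdjoint`,
both through `kernel_identity_of_dense`). By the Clifford relations it says that ν(p) is the mirror
image of ν(q) in the plane orthogonal to p-q; in particular ν(p)-ν(q) is a multiple of p-q
(`sub_eq_smul_of_sigmaAct_mul`). Comparing three non-collinear points shows that the multiple is a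
constant L ≠ 0, so all points q - ν(q)/L coincide and ∂Ω lies on a sphere of radius 1/|L|
(`exists_eq_ball_of_normal_sub`).

Sufficiency of the ball. On a sphere with unit normals X, Y at x, y the kernel of W_m(σ·ν) is a
constant times (1 - σ_X σ_Y)/|x-y|³. Replacing it by (1 - q² σ_X σ_Y)/(ε²+|x-y|²)^(3/2), with 1/q -
q = ε/R, produces a Cauchy kernel with its parameter at the interior point q²X
(`inner_smoothKernel`). Let Π be the projection onto the Hardy space, the closed span of the Cauchy
kernels. The regularised integral kills the orthogonal complement of the Hardy space. By Cauchy's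
theorem σ·ν maps the Hardy space into that complement, and this turns the regularised integral of a
Hardy function into a Poisson integral, with limit 4π/R times the function
(`integral_smoothKernel_of_mem`). The regularised and the truncated integrals differ in the limit by
2π/R times the density (`tendsto_integral_kernel_sub`). Hence the principal value exists almost
everywhere, W_m(σ·ν) = -i(Π - 1/2), and P_+ and P_- are the projections onto the Hardy space and its
complement. The anticommutation on the ball is a pointwise identity of kernels.

No a priori L² bound for W_m is used: on the ball its domain is computed, and under self-adjointness
of P_+ its domain is dense. -/

theorem IsPreconnected.inter_frontier_nonempty {X : Type*} [TopologicalSpace X] {s t : Set X}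
    (hs : IsPreconnected s) (h1 : (s ∩ t).Nonempty) (h2 : (s ∩ tᶜ).Nonempty) :
    (s ∩ frontier t).Nonempty := by
  by_contra hcon
  rw [Set.not_nonempty_iff_eq_empty, ← Set.disjoint_iff_inter_eq_empty] at hcon
  have hmem : ∀ x ∈ s, x ∈ interior t ∨ x ∈ (closure t)ᶜ := fun x hx => by
    by_contra! h
    exact Set.disjoint_left.1 hcon hx ⟨not_not.1 h.2, h.1⟩
  obtain ⟨x, hx, hxt⟩ := h1
  obtain ⟨y, hy, hyt⟩ := h2
  obtain ⟨z, -, hz1, hz2⟩ := hs (interior t) (closure t)ᶜ isOpen_interior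
    isClosed_closure.isOpen_compl hmem
    ⟨x, hx, (hmem x hx).resolve_right fun h => h (subset_closure hxt)⟩
    ⟨y, hy, (hmem y hy).resolve_left fun h => hyt (interior_subset h)⟩
  exact hz2 (interior_subset_closure hz1)

/-! ### Defining functions and the outward normal -/

namespace IsDefiningFunctionAt

variable {Ω : Set E3} {x : E3} {ρ : E3 → ℝ}

/-- A strict sign of ρ persists nearby, so it puts the point into the interior of Ω or of its
complement; only zeros are left for the frontier. -/
theorem eventually_eq_zero (h : IsDefiningFunctionAt Ω x ρ) :
    ∀ᶠ y in 𝓝 x, y ∈ frontier Ω → ρ y = 0 := by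
  have h1 : ∀ᶠ y in 𝓝 x, ContDiffAt ℝ 1 ρ y := h.contDiffAt.eventually (by simp)
  filter_upwards [h1, h.eventually_mem_iff.eventually_nhds] with y hy1 hy2 hy
  rcases lt_trichotomy (ρ y) 0 with hlt | heq | hgt
  · have : ∀ᶠ z in 𝓝 y, z ∈ Ω := by
      filter_upwards [hy2, hy1.continuousAt.eventually (gt_mem_nhds hlt)] with z hz hz'
      exact hz.2 hz'
    exact absurd (mem_interior_iff_mem_nhds.2 this) hy.2
  · exact heq
  · have : ∀ᶠ z in 𝓝 y, z ∈ Ωᶜ := by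
      filter_upwards [hy2, hy1.continuousAt.eventually (lt_mem_nhds hgt)] with z hz hz'
      exact fun hm => absurd (hz.1 hm) (not_lt.2 hz'.le)
    have hc : y ∈ interior Ωᶜ := mem_interior_iff_mem_nhds.2 this
    rw [interior_compl] at hc
    exact absurd hy.1 hc

theorem continuousAt_gradient (h : IsDefiningFunctionAt Ω x ρ) : ContinuousAt (gradient ρ) x :=
  (InnerProductSpace.toDual ℝ E3).symm.continuous.continuousAt.comp
    (h.contDiffAt.continuousAt_fderiv (by simp))

/-- One function serves all nearby boundary points. This makes the outward normal continuous along
∂Ω. -/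
theorem eventually_isDefiningFunctionAt (h : IsDefiningFunctionAt Ω x ρ) :
    ∀ᶠ y in 𝓝 x, y ∈ frontier Ω → IsDefiningFunctionAt Ω y ρ := by
  have h1 : ∀ᶠ y in 𝓝 x, ContDiffAt ℝ 1 ρ y := h.contDiffAt.eventually (by simp)
  filter_upwards [h1, h.eventually_mem_iff.eventually_nhds, h.eventually_eq_zero,
    h.continuousAt_gradient.eventually_ne h.gradient_ne_zero] with y hy1 hy2 hy3 hy4 hy
  exact ⟨hy1, hy3 hy, hy4, hy2⟩

/-- Strict differentiability lets both points vary, which is what bounds all chords near x and not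
only those issuing from x. -/
theorem exists_abs_sub_le (h : IsDefiningFunctionAt Ω x ρ) {ε : ℝ} (hε : 0 < ε) :
    ∃ δ > 0, ∀ y ∈ Metric.ball x δ, ∀ z ∈ Metric.ball x δ,
      |ρ y - ρ z - inner ℝ (gradient ρ x) (y - z)| ≤ ε * ‖y - z‖ := by
  have h1 := (h.contDiffAt.hasStrictFDerivAt (by simp)).isLittleO.def hε
  rw [nhds_prod_eq] at h1
  obtain ⟨δ, hδ, hb⟩ := (Metric.nhds_basis_ball.prod_self).eventually_iff.1 h1
  refine ⟨δ, hδ, fun y hy z hz => ?_⟩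
  have := hb (x := (y, z)) ⟨hy, hz⟩
  rw [← toDual_gradient] at this
  exact this

/-- Near `x`, the defining function is controlled by its linear part in a normalised form. -/
theorem exists_abs_sub_le_norm_gradient (h : IsDefiningFunctionAt Ω x ρ) {ε : ℝ} (hε : 0 < ε) :
    ∃ δ > 0, ∀ y ∈ Metric.ball x δ, ∀ z ∈ Metric.ball x δ,
      |‖gradient ρ x‖⁻¹ * (ρ y - ρ z)
        - inner ℝ (‖gradient ρ x‖⁻¹ • gradient ρ x) (y - z)| ≤ ε * ‖y - z‖ := by
  have hg : 0 < ‖gradient ρ x‖ := norm_pos_iff.2 h.gradient_ne_zero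
  obtain ⟨δ, hδ, hb⟩ := h.exists_abs_sub_le (mul_pos hg hε)
  refine ⟨δ, hδ, fun y hy z hz => ?_⟩
  have := hb y hy z hz
  rw [inner_smul_left, RCLike.conj_to_real, ← mul_sub, abs_mul, abs_of_pos (inv_pos.2 hg)]
  rw [inv_mul_le_iff₀ hg]
  linarith

end IsDefiningFunctionAt

theorem IsOutwardUnitNormal.norm_eq_one {Ω : Set E3} {x n : E3} (h : IsOutwardUnitNormal Ω x n) :
    ‖n‖ = 1 := by
  obtain ⟨ρ, hρ, rfl⟩ := h
  rw [norm_smul, norm_inv, norm_norm, inv_mul_cancel₀ (norm_ne_zero_iff.2 hρ.gradient_ne_zero)]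

theorem IsOutwardUnitNormal.eventually_mem {Ω : Set E3} {x n v : E3}
    (h : IsOutwardUnitNormal Ω x n) (hv : inner ℝ n v < 0) :
    ∀ᶠ t : ℝ in 𝓝[>] 0, x + t • v ∈ Ω := by
  obtain ⟨ρ, hρ, rfl⟩ := h
  have hg : 0 < ‖gradient ρ x‖ := norm_pos_iff.2 hρ.gradient_ne_zero
  set n := ‖gradient ρ x‖⁻¹ • gradient ρ x with hn
  have hv0 : 0 < ‖v‖ := norm_pos_iff.2 (by rintro rfl; simp at hv)
  -- With this ε the error along the ray is at most half of the linear term, so the sign of the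
  -- linear term prevails.
  obtain ⟨δ, hδ, hb⟩ := hρ.exists_abs_sub_le_norm_gradient
    (ε := -inner ℝ n v / (2 * ‖v‖)) (div_pos (by linarith) (by linarith))
  have hc : Tendsto (fun t : ℝ => x + t • v) (𝓝[>] 0) (𝓝 x) := by
    have : Continuous (fun t : ℝ => x + t • v) := by fun_prop
    simpa using (this.tendsto 0).mono_left nhdsWithin_le_nhds
  filter_upwards [hc.eventually hρ.eventually_mem_iff, hc (Metric.ball_mem_nhds x hδ),
    self_mem_nhdsWithin] with t ht1 ht2 ht3
  have ht3 : 0 < t := ht3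
  rw [ht1]
  have := hb _ ht2 x (Metric.mem_ball_self hδ)
  rw [hρ.apply_eq_zero, add_sub_cancel_left, inner_smul_right, norm_smul, Real.norm_eq_abs,
    abs_of_pos ht3, sub_zero] at this
  have h2 := (abs_le.1 this).2
  have h3 : -inner ℝ n v / (2 * ‖v‖) * (t * ‖v‖) = - t * inner ℝ n v / 2 := by
    field_simp
  rw [h3] at h2
  have h4 : ‖gradient ρ x‖⁻¹ * ρ (x + t • v) < 0 := by nlinarith
  by_contra hcon
  exact absurd h4 (not_lt.2 (mul_nonneg (inv_nonneg.2 hg.le) (not_lt.1 hcon)))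

theorem IsOutwardUnitNormal.eventually_notMem {Ω : Set E3} {x n v : E3}
    (h : IsOutwardUnitNormal Ω x n) (hv : 0 < inner ℝ n v) :
    ∀ᶠ t : ℝ in 𝓝[>] 0, x + t • v ∉ Ω := by
  obtain ⟨ρ, hρ, rfl⟩ := h
  have hg : 0 < ‖gradient ρ x‖ := norm_pos_iff.2 hρ.gradient_ne_zero
  set n := ‖gradient ρ x‖⁻¹ • gradient ρ x with hn
  have hv0 : 0 < ‖v‖ := norm_pos_iff.2 (by rintro rfl; simp at hv)
  obtain ⟨δ, hδ, hb⟩ := hρ.exists_abs_sub_le_norm_gradient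
    (ε := inner ℝ n v / (2 * ‖v‖)) (div_pos (by linarith) (by linarith))
  have hc : Tendsto (fun t : ℝ => x + t • v) (𝓝[>] 0) (𝓝 x) := by
    have : Continuous (fun t : ℝ => x + t • v) := by fun_prop
    simpa using (this.tendsto 0).mono_left nhdsWithin_le_nhds
  filter_upwards [hc.eventually hρ.eventually_mem_iff, hc (Metric.ball_mem_nhds x hδ),
    self_mem_nhdsWithin] with t ht1 ht2 ht3
  have ht3 : 0 < t := ht3
  rw [ht1, not_lt]
  have := hb _ ht2 x (Metric.mem_ball_self hδ)
  rw [hρ.apply_eq_zero, add_sub_cancel_left, inner_smul_right, norm_smul, Real.norm_eq_abs,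
    abs_of_pos ht3, sub_zero] at this
  have h2 := (abs_le.1 this).1
  have h3 : inner ℝ n v / (2 * ‖v‖) * (t * ‖v‖) = t * inner ℝ n v / 2 := by
    field_simp
  rw [h3] at h2
  have h4 : 0 < ‖gradient ρ x‖⁻¹ * ρ (x + t • v) := by nlinarith
  exact (pos_of_mul_pos_right h4 (inv_nonneg.2 hg.le)).le

/-- If n ≠ m, the direction m - n enters Ω as judged by n and leaves it as judged by m. -/
theorem IsOutwardUnitNormal.unique {Ω : Set E3} {x n m : E3}
    (hn : IsOutwardUnitNormal Ω x n) (hm : IsOutwardUnitNormal Ω x m) : n = m := by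
  by_contra hne
  have hlt : inner ℝ n m < 1 := by
    have := inner_lt_one_iff_real_of_norm_eq_one hn.norm_eq_one hm.norm_eq_one
    exact this.2 hne
  have h1 : inner ℝ n (m - n) < 0 := by
    rw [inner_sub_right, real_inner_self_eq_norm_sq, hn.norm_eq_one]; linarith
  have h2 : 0 < inner ℝ m (m - n) := by
    rw [inner_sub_right, real_inner_self_eq_norm_sq, hm.norm_eq_one, real_inner_comm]; linarith
  obtain ⟨t, ht1, ht2⟩ := ((hn.eventually_mem h1).and (hm.eventually_notMem h2)).exists
  exact ht2 ht1

theorem IsOutwardUnitNormal.outwardNormal_eq {Ω : Set E3} {x n : E3}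
    (hn : IsOutwardUnitNormal Ω x n) : outwardNormal Ω x = n := by
  have h : ∃ n, IsOutwardUnitNormal Ω x n := ⟨n, hn⟩
  rw [outwardNormal, dif_pos h]
  exact h.choose_spec.unique hn

theorem IsDefiningFunctionAt.outwardNormal_eq {Ω : Set E3} {x : E3} {ρ : E3 → ℝ}
    (h : IsDefiningFunctionAt Ω x ρ) :
    outwardNormal Ω x = ‖gradient ρ x‖⁻¹ • gradient ρ x :=
  IsOutwardUnitNormal.outwardNormal_eq ⟨ρ, h, rfl⟩

namespace IsBoundedC1Domain

variable {Ω : Set E3}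

theorem isOutwardUnitNormal (hΩ : IsBoundedC1Domain Ω) {x : E3} (hx : x ∈ frontier Ω) :
    IsOutwardUnitNormal Ω x (outwardNormal Ω x) := by
  obtain ⟨ρ, hρ⟩ := hΩ.boundary x hx
  exact ⟨ρ, hρ, hρ.outwardNormal_eq⟩

theorem norm_outwardNormal (hΩ : IsBoundedC1Domain Ω) {x : E3} (hx : x ∈ frontier Ω) :
    ‖outwardNormal Ω x‖ = 1 := (hΩ.isOutwardUnitNormal hx).norm_eq_one

theorem continuousOn_outwardNormal (hΩ : IsBoundedC1Domain Ω) :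
    ContinuousOn (outwardNormal Ω) (frontier Ω) := by
  intro x hx
  obtain ⟨ρ, hρ⟩ := hΩ.boundary x hx
  have hc : ContinuousAt (fun y => ‖gradient ρ y‖⁻¹ • gradient ρ y) x :=
    (hρ.continuousAt_gradient.norm.inv₀ (norm_ne_zero_iff.2 hρ.gradient_ne_zero)).smul
      hρ.continuousAt_gradient
  refine hc.continuousWithinAt.congr_of_eventuallyEq ?_ hρ.outwardNormal_eq
  filter_upwards [nhdsWithin_le_nhds hρ.eventually_isDefiningFunctionAt, self_mem_nhdsWithin]
    with y hy hy'
  exact (hy hy').outwardNormal_eq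

theorem isCompact_frontier (hΩ : IsBoundedC1Domain Ω) : IsCompact (frontier Ω) :=
  Metric.isCompact_of_isClosed_isBounded isClosed_frontier
    (hΩ.isBounded.closure.subset frontier_subset_closure)

/-- The defining function vanishes at both ends of a short chord of ∂Ω, leaving only the
linearisation error. -/
theorem exists_flat (hΩ : IsBoundedC1Domain Ω) {x : E3} (hx : x ∈ frontier Ω) {ε : ℝ}
    (hε : 0 < ε) : ∃ δ > 0, ∀ y ∈ frontier Ω ∩ Metric.ball x δ, ∀ z ∈ frontier Ω ∩ Metric.ball x δ,
      |inner ℝ (outwardNormal Ω x) (y - z)| ≤ ε * ‖y - z‖ := by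
  obtain ⟨ρ, hρ⟩ := hΩ.boundary x hx
  obtain ⟨δ, hδ, hb⟩ := hρ.exists_abs_sub_le_norm_gradient hε
  obtain ⟨δ', hδ', hb'⟩ := Metric.nhds_basis_ball.eventually_iff.1 hρ.eventually_eq_zero
  refine ⟨min δ δ', lt_min hδ hδ', fun y hy z hz => ?_⟩
  have := hb y (Metric.ball_subset_ball (min_le_left _ _) hy.2) z
    (Metric.ball_subset_ball (min_le_left _ _) hz.2)
  rw [hb' (Metric.ball_subset_ball (min_le_right _ _) hy.2) hy.1,
    hb' (Metric.ball_subset_ball (min_le_right _ _) hz.2) hz.1, ← hρ.outwardNormal_eq] at this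
  simpa using this

/-- Over every point of the tangent plane close to `x` there is a boundary point nearby. -/
theorem exists_mem_frontier_add (hΩ : IsBoundedC1Domain Ω) {x : E3} (hx : x ∈ frontier Ω) {ε : ℝ}
    (hε : 0 < ε) : ∃ δ > 0, ∀ r ≤ δ, ∀ w : E3,
      inner ℝ (outwardNormal Ω x) w = 0 → ‖w‖ ^ 2 + (ε * r) ^ 2 < r ^ 2 → 0 < r →
      ∃ s : ℝ, x + w + s • outwardNormal Ω x ∈ frontier Ω ∩ Metric.ball x r := by
  obtain ⟨ρ, hρ⟩ := hΩ.boundary x hx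
  obtain ⟨δ, hδ, hb⟩ := hρ.exists_abs_sub_le_norm_gradient hε
  obtain ⟨δ', hδ', hb'⟩ := Metric.nhds_basis_ball.eventually_iff.1 hρ.eventually_mem_iff
  refine ⟨min δ δ', lt_min hδ hδ', fun r hr w hw hlt hr0 => ?_⟩
  have hg : 0 < ‖gradient ρ x‖ := norm_pos_iff.2 hρ.gradient_ne_zero
  rw [← hρ.outwardNormal_eq] at hb
  set n := outwardNormal Ω x with hn
  have hn1 : ‖n‖ = 1 := hΩ.norm_outwardNormal hx
  have hnorm : ∀ s : ℝ, |s| ≤ ε * r → ‖w + s • n‖ < r := by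
    intro s hs
    have : ‖w + s • n‖ ^ 2 = ‖w‖ ^ 2 + s ^ 2 := by
      rw [norm_add_sq_real, inner_smul_right, real_inner_comm, hw, norm_smul, hn1]
      simp
    have h2 : s ^ 2 ≤ (ε * r) ^ 2 := sq_le_sq' (by linarith [(abs_le.1 hs).1]) (abs_le.1 hs).2
    exact lt_of_pow_lt_pow_left₀ 2 hr0.le (by linarith)
  have hball : ∀ s : ℝ, |s| ≤ ε * r → x + w + s • n ∈ Metric.ball x r := by
    intro s hs
    rw [Metric.mem_ball, dist_eq_norm, add_assoc, add_sub_cancel_left]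
    exact hnorm s hs
  have hεr : 0 < ε * r := mul_pos hε hr0
  -- At the two ends s = ±εr of the normal segment above x + w, the normalised ρ differs from s by
  -- less than εr and so has the sign of s. One end lies in Ω and the other does not, hence the
  -- segment meets the frontier.
  have key : ∀ s : ℝ, |s| = ε * r →
      |‖gradient ρ x‖⁻¹ * ρ (x + w + s • n) - s| < ε * r := by
    intro s hs
    have := hb _ (Metric.ball_subset_ball (hr.trans (min_le_left _ _)) (hball s hs.le)) x
      (Metric.mem_ball_self hδ)
    rw [hρ.apply_eq_zero, add_assoc, add_sub_cancel_left, inner_add_right, hw, inner_smul_right,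
      real_inner_self_eq_norm_sq, hn1, sub_zero, ← add_assoc] at this
    calc _ ≤ ε * ‖w + s • n‖ := by simpa using this
      _ < ε * r := mul_lt_mul_of_pos_left (hnorm s hs.le) hε
  have hout : x + w + (ε * r) • n ∉ Ω := by
    rw [hb' (Metric.ball_subset_ball (hr.trans (min_le_right _ _))
      (hball _ (abs_of_pos hεr).le)), not_lt]
    have := (abs_lt.1 (key (ε * r) (abs_of_pos hεr))).1
    have h4 : 0 < ‖gradient ρ x‖⁻¹ * ρ (x + w + (ε * r) • n) := by linarith
    exact (pos_of_mul_pos_right h4 (inv_nonneg.2 hg.le)).le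
  have habs : |-(ε * r)| = ε * r := by rw [abs_neg, abs_of_pos hεr]
  have hin : x + w + (-(ε * r)) • n ∈ Ω := by
    rw [hb' (Metric.ball_subset_ball (hr.trans (min_le_right _ _)) (hball _ habs.le))]
    have := (abs_lt.1 (key (-(ε * r)) habs)).2
    have h4 : ‖gradient ρ x‖⁻¹ * ρ (x + w + (-(ε * r)) • n) < 0 := by linarith
    by_contra hcon
    exact absurd h4 (not_lt.2 (mul_nonneg (inv_nonneg.2 hg.le) (not_lt.1 hcon)))
  have hpre : IsPreconnected ((fun s : ℝ => x + w + s • n) '' Set.Icc (-(ε * r)) (ε * r)) :=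
    isPreconnected_Icc.image _ (by fun_prop)
  obtain ⟨y, ⟨s, hs, rfl⟩, hy⟩ := hpre.inter_frontier_nonempty
    ⟨_, ⟨_, ⟨le_refl _, by linarith⟩, rfl⟩, hin⟩ ⟨_, ⟨_, ⟨by linarith, le_refl _⟩, rfl⟩, hout⟩
  exact ⟨s, hy, hball s (abs_le.2 hs)⟩

end IsBoundedC1Domain

open scoped NNReal ENNReal

/-! ### Surface measure of small balls -/

/-- For r < 0 the ball is empty while πr² is positive, whence the alternative. -/
theorem euclideanHausdorffMeasure_ball_orthogonal {n : E3} (hn : n ≠ 0)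
    (w : (Submodule.span ℝ {n})ᗮ) (r : ℝ) :
    Measure.euclideanHausdorffMeasure 2 (Metric.ball w r) = ENNReal.ofReal (Real.pi * r ^ 2) ∨
      r ≤ 0 := by
  rcases le_or_gt r 0 with hr | hr
  · exact Or.inr hr
  left
  have hfact : Fact (Module.finrank ℝ E3 = 2 + 1) := ⟨by simp⟩
  have hdim : Module.finrank ℝ (Submodule.span ℝ {n})ᗮ = 2 :=
    Submodule.finrank_orthogonal_span_singleton hn
  have h := InnerProductSpace.euclideanHausdorffMeasure_eq_volume (V := (Submodule.span ℝ {n})ᗮ)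
  rw [hdim] at h
  have : Nontrivial (Submodule.span ℝ {n})ᗮ :=
    Module.nontrivial_of_finrank_pos (R := ℝ) (by rw [hdim]; norm_num)
  rw [h, InnerProductSpace.volume_ball_of_dim_even (k := 1) (by rw [hdim]), hdim,
    ← ENNReal.ofReal_pow hr.le, ← ENNReal.ofReal_mul (by positivity)]
  congr 1
  simp [mul_comm]

theorem euclideanHausdorffMeasure_ball_orthogonal_le {n : E3} (hn : n ≠ 0)
    (w : (Submodule.span ℝ {n})ᗮ) (r : ℝ) :
    Measure.euclideanHausdorffMeasure 2 (Metric.ball w r) ≤ ENNReal.ofReal (Real.pi * r ^ 2) := by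
  rcases euclideanHausdorffMeasure_ball_orthogonal hn w r with h | h
  · exact h.le
  · rw [Metric.ball_eq_empty.2 h]; simp

theorem norm_sq_eq_orthogonalProjectionOnto_add {n : E3} (hn : ‖n‖ = 1) (z : E3) :
    ‖z‖ ^ 2 = ‖(Submodule.span ℝ {n})ᗮ.orthogonalProjectionOnto z‖ ^ 2 + (inner ℝ n z) ^ 2 := by
  rw [Submodule.norm_sq_eq_add_norm_sq_projection z (Submodule.span ℝ {n}), add_comm,
    add_right_inj]
  have h := Submodule.starProjection_unit_singleton ℝ hn z
  rw [Submodule.starProjection_apply] at h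
  rw [← Submodule.norm_coe, h, norm_smul, hn, mul_one, Real.norm_eq_abs, sq_abs]

/-- A subset of `ℝ³` which is nearly orthogonal to `n` is hardly larger than its projection. -/
theorem euclideanHausdorffMeasure_le_of_flat {A : Set E3} {n : E3} (hn : ‖n‖ = 1) {ε : ℝ}
    (h0 : 0 ≤ ε) (h1 : ε < 1)
    (hA : ∀ y ∈ A, ∀ z ∈ A, |inner ℝ n (y - z)| ≤ ε * ‖y - z‖) :
    (Measure.euclideanHausdorffMeasure 2 : Measure E3) A ≤ ENNReal.ofReal ((1 - ε ^ 2)⁻¹) *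
      Measure.euclideanHausdorffMeasure 2
        ((Submodule.span ℝ {n})ᗮ.orthogonalProjectionOnto '' A) := by
  have hpos : 0 < 1 - ε ^ 2 := by nlinarith
  set π := (Submodule.span ℝ {n})ᗮ.orthogonalProjectionOnto with hπ
  -- By Pythagoras the projection shortens chords of A at most by the factor √(1-ε²);
  -- two-dimensional measure squares the constant.
  have hanti : AntilipschitzWith (Real.sqrt ((1 - ε ^ 2)⁻¹)).toNNReal (fun y : A => π y) := by
    refine AntilipschitzWith.of_le_mul_dist fun y z => ?_
    rw [Real.coe_toNNReal _ (Real.sqrt_nonneg _), Subtype.dist_eq, dist_eq_norm, dist_eq_norm,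
      ← map_sub]
    have h := norm_sq_eq_orthogonalProjectionOnto_add hn ((y : E3) - z)
    have h2 : (inner ℝ n ((y : E3) - z)) ^ 2 ≤ ε ^ 2 * ‖(y : E3) - z‖ ^ 2 := by
      rw [← mul_pow, ← sq_abs]
      exact pow_le_pow_left₀ (abs_nonneg _) (hA y y.2 z z.2) 2
    rw [← abs_of_nonneg (norm_nonneg ((y : E3) - z)), ← Real.sqrt_sq_eq_abs,
      ← abs_of_nonneg (norm_nonneg (π ((y : E3) - z))), ← Real.sqrt_sq_eq_abs,
      ← Real.sqrt_mul (inv_nonneg.2 hpos.le)]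
    refine Real.sqrt_le_sqrt ?_
    rw [inv_mul_eq_div, le_div_iff₀ hpos]
    linarith
  have key := hanti.le_hausdorffMeasure_image (d := 2) (by norm_num) Set.univ
  rw [← isometry_subtype_coe.hausdorffMeasure_image (Or.inl (by norm_num)),
    Set.image_univ, Subtype.range_coe] at key
  have him : (fun y : A => π y) '' Set.univ = π '' A := by
    ext; simp
  rw [him] at key
  have hconst : ((Real.sqrt ((1 - ε ^ 2)⁻¹)).toNNReal : ℝ≥0∞) ^ (2 : ℝ)
      = ENNReal.ofReal ((1 - ε ^ 2)⁻¹) := by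
    have : ((Real.sqrt ((1 - ε ^ 2)⁻¹)).toNNReal : ℝ≥0∞)
      = ENNReal.ofReal (Real.sqrt ((1 - ε ^ 2)⁻¹)) := rfl
    rw [this, ENNReal.ofReal_rpow_of_nonneg (Real.sqrt_nonneg _) (by norm_num)]
    rw [Real.rpow_two, Real.sq_sqrt (inv_nonneg.2 hpos.le)]
  rw [hconst] at key
  simp only [Measure.euclideanHausdorffMeasure_def, Measure.smul_apply, Nat.cast_ofNat]
  rw [ENNReal.smul_def, ENNReal.smul_def, smul_eq_mul, smul_eq_mul, mul_left_comm]
  gcongr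

namespace IsBoundedC1Domain

variable {Ω : Set E3}

theorem surfaceMeasure_ball_eq (x : E3) (r : ℝ) : surfaceMeasure Ω (Metric.ball x r)
    = Measure.euclideanHausdorffMeasure 2 (frontier Ω ∩ Metric.ball x r) := by
  rw [surfaceMeasure, Measure.restrict_apply Metric.isOpen_ball.measurableSet, Set.inter_comm]

/-- The projection of the flat piece to the tangent plane lies in a disc of radius r, since
projections contract. The centre y is free so that one δ can serve a whole neighbourhood in a
compactness argument. -/
theorem exists_surfaceMeasure_ball_le (hΩ : IsBoundedC1Domain Ω) {x : E3} (hx : x ∈ frontier Ω)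
    {ε : ℝ} (h0 : 0 < ε) (h1 : ε < 1) : ∃ δ > 0, ∀ y r, Metric.ball y r ⊆ Metric.ball x δ →
      surfaceMeasure Ω (Metric.ball y r) ≤ ENNReal.ofReal ((1 - ε ^ 2)⁻¹ * (Real.pi * r ^ 2)) := by
  obtain ⟨δ, hδ, hb⟩ := hΩ.exists_flat hx h0
  have hn := hΩ.norm_outwardNormal hx
  refine ⟨δ, hδ, fun y r hyr => ?_⟩
  have hpos : 0 < 1 - ε ^ 2 := by nlinarith
  rw [surfaceMeasure_ball_eq]
  refine (euclideanHausdorffMeasure_le_of_flat hn h0.le h1 fun a ha b hbb => hb a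
    ⟨ha.1, hyr ha.2⟩ b ⟨hbb.1, hyr hbb.2⟩).trans ?_
  rw [ENNReal.ofReal_mul (inv_nonneg.2 hpos.le)]
  gcongr
  refine le_trans (measure_mono ?_) (euclideanHausdorffMeasure_ball_orthogonal_le
    (n := outwardNormal Ω x) (by rintro h; simp [h] at hn)
    ((Submodule.span ℝ {outwardNormal Ω x})ᗮ.orthogonalProjectionOnto y) r)
  rintro _ ⟨a, ha, rfl⟩
  exact lt_of_le_of_lt ((Submodule.lipschitzWith_orthogonalProjectionOnto _).dist_le_mul a y)
    (by simpa using ha.2)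

/-- Projecting does not increase Hausdorff measure, and the projection covers a disc of radius
√(1-ε²) r because there is a boundary point above each of its points. -/
theorem exists_le_surfaceMeasure_ball (hΩ : IsBoundedC1Domain Ω) {x : E3} (hx : x ∈ frontier Ω)
    {ε : ℝ} (h0 : 0 < ε) (h1 : ε < 1) : ∃ δ > 0, ∀ r ≤ δ, 0 < r →
      ENNReal.ofReal ((1 - ε ^ 2) * (Real.pi * r ^ 2)) ≤ surfaceMeasure Ω (Metric.ball x r) := by
  obtain ⟨δ, hδ, hb⟩ := hΩ.exists_mem_frontier_add hx h0
  have hn := hΩ.norm_outwardNormal hx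
  refine ⟨δ, hδ, fun r hr hr0 => ?_⟩
  have hpos : 0 < 1 - ε ^ 2 := by nlinarith
  have hn0 : outwardNormal Ω x ≠ 0 := by rintro h; simp [h] at hn
  set n := outwardNormal Ω x with hndef
  set π := (Submodule.span ℝ {n})ᗮ.orthogonalProjectionOnto with hπ
  rw [surfaceMeasure_ball_eq]
  have hproj : Measure.euclideanHausdorffMeasure 2 (π '' (frontier Ω ∩ Metric.ball x r)) ≤
      (Measure.euclideanHausdorffMeasure 2 : Measure E3) (frontier Ω ∩ Metric.ball x r) := by
    simp only [Measure.euclideanHausdorffMeasure_def, Measure.smul_apply, Nat.cast_ofNat]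
    rw [ENNReal.smul_def, ENNReal.smul_def, smul_eq_mul, smul_eq_mul]
    gcongr
    exact MeasureTheory.hausdorffMeasure_orthogonalProjectionOnto_le (𝕜 := ℝ) _ 2 _ (by norm_num)
  refine le_trans ?_ hproj
  have hsq : 0 < Real.sqrt (1 - ε ^ 2) * r := mul_pos (Real.sqrt_pos.2 hpos) hr0
  have hball := (euclideanHausdorffMeasure_ball_orthogonal hn0 (π x)
    (Real.sqrt (1 - ε ^ 2) * r)).resolve_right (not_le.2 hsq)
  rw [mul_pow, Real.sq_sqrt hpos.le, mul_left_comm] at hball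
  rw [← hball]
  refine measure_mono fun w hw => ?_
  have hwn : inner ℝ n ((w : E3) - π x) = 0 := by
    have := (w - π x).2
    rw [Submodule.mem_orthogonal_singleton_iff_inner_right] at this
    simpa using this
  have hw' : ‖(w : E3) - π x‖ < Real.sqrt (1 - ε ^ 2) * r := by
    have : ‖w - π x‖ < Real.sqrt (1 - ε ^ 2) * r := by simpa [dist_eq_norm] using hw
    simpa using this
  obtain ⟨s, hs⟩ := hb r hr ((w : E3) - π x) hwn (by
    have := pow_lt_pow_left₀ hw' (norm_nonneg _) two_ne_zero
    rw [mul_pow, Real.sq_sqrt hpos.le] at this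
    nlinarith) hr0
  refine ⟨_, hs, ?_⟩
  have hπn : π n = 0 := Submodule.orthogonalProjectionOnto_orthogonalComplement_singleton_eq_zero n
  have hπw : ∀ v : (Submodule.span ℝ {n})ᗮ, π (v : E3) = v := fun v =>
    Submodule.orthogonalProjectionOnto_mem_subspace_eq_self v
  rw [map_add, map_add, map_smul, hπn, map_sub, hπw, hπw]
  simp

theorem surfaceMeasure_univ : surfaceMeasure Ω Set.univ = surfaceMeasure Ω (frontier Ω) := by
  rw [surfaceMeasure, Measure.restrict_apply_self, Measure.restrict_apply_univ]

theorem ae_mem_frontier (Ω : Set E3) : ∀ᵐ x ∂surfaceMeasure Ω, x ∈ frontier Ω :=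
  ae_restrict_mem isClosed_frontier.measurableSet

theorem isFiniteMeasure_surfaceMeasure (hΩ : IsBoundedC1Domain Ω) :
    IsFiniteMeasure (surfaceMeasure Ω) := by
  refine ⟨?_⟩
  rw [surfaceMeasure_univ]
  refine hΩ.isCompact_frontier.measure_lt_top_of_nhdsWithin fun x hx => ?_
  obtain ⟨δ, hδ, hb⟩ := hΩ.exists_surfaceMeasure_ball_le hx (ε := 1 / 2) (by norm_num) (by norm_num)
  exact ⟨Metric.ball x δ, mem_nhdsWithin_of_mem_nhds (Metric.ball_mem_nhds x hδ),
    (hb x δ le_rfl).trans_lt ENNReal.ofReal_lt_top⟩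

/-- The surface measure has two-dimensional density one at every boundary point. -/
theorem tendsto_surfaceMeasure_ball (hΩ : IsBoundedC1Domain Ω) {x : E3} (hx : x ∈ frontier Ω) :
    Tendsto (fun r => (surfaceMeasure Ω).real (Metric.ball x r) / r ^ 2) (𝓝[>] 0)
      (𝓝 Real.pi) := by
  have := hΩ.isFiniteMeasure_surfaceMeasure
  rw [tendsto_order]
  constructor
  · intro a ha
    have hc : Tendsto (fun ε : ℝ => (1 - ε ^ 2) * Real.pi) (𝓝[>] 0) (𝓝 Real.pi) := by
      have : Continuous (fun ε : ℝ => (1 - ε ^ 2) * Real.pi) := by fun_prop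
      simpa using (this.tendsto 0).mono_left nhdsWithin_le_nhds
    obtain ⟨ε, h1, h2, h3⟩ := ((hc.eventually (lt_mem_nhds ha)).and
      (Ioo_mem_nhdsGT (show (0 : ℝ) < 1 by norm_num))).exists
    obtain ⟨δ, hδ, hb⟩ := hΩ.exists_le_surfaceMeasure_ball hx h2 h3
    filter_upwards [Ioo_mem_nhdsGT hδ] with r hr
    have h := hb r hr.2.le hr.1
    have hr2 : 0 < r ^ 2 := pow_pos hr.1 2
    rw [← ofReal_measureReal, ENNReal.ofReal_le_ofReal_iff measureReal_nonneg] at h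
    rw [lt_div_iff₀ hr2]
    nlinarith
  · intro a ha
    have hc : Tendsto (fun ε : ℝ => (1 - ε ^ 2)⁻¹ * Real.pi) (𝓝[>] 0) (𝓝 Real.pi) := by
      have : ContinuousAt (fun ε : ℝ => (1 - ε ^ 2)⁻¹ * Real.pi) 0 := by
        refine ContinuousAt.mul (ContinuousAt.inv₀ (by fun_prop) (by norm_num)) continuousAt_const
      simpa [ContinuousAt] using this.mono_left nhdsWithin_le_nhds
    obtain ⟨ε, h1, h2, h3⟩ := ((hc.eventually (gt_mem_nhds ha)).and
      (Ioo_mem_nhdsGT (show (0 : ℝ) < 1 by norm_num))).exists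
    obtain ⟨δ, hδ, hb⟩ := hΩ.exists_surfaceMeasure_ball_le hx h2 h3
    filter_upwards [Ioo_mem_nhdsGT hδ] with r hr
    have h := hb x r (Metric.ball_subset_ball hr.2.le)
    have hr2 : 0 < r ^ 2 := pow_pos hr.1 2
    have hpos : 0 < 1 - ε ^ 2 := by nlinarith
    rw [← ofReal_measureReal, ENNReal.ofReal_le_ofReal_iff (by positivity)] at h
    rw [div_lt_iff₀ hr2]
    nlinarith

theorem surfaceMeasure_ball_pos (hΩ : IsBoundedC1Domain Ω) {x : E3} (hx : x ∈ frontier Ω)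
    {r : ℝ} (hr : 0 < r) : 0 < surfaceMeasure Ω (Metric.ball x r) := by
  obtain ⟨δ, hδ, hb⟩ := hΩ.exists_le_surfaceMeasure_ball hx (ε := 1 / 2) (by norm_num) (by norm_num)
  refine lt_of_lt_of_le ?_ ((hb (min δ r) (min_le_left _ _) (lt_min hδ hr)).trans
    (measure_mono (Metric.ball_subset_ball (min_le_right _ _))))
  have := lt_min hδ hr
  rw [ENNReal.ofReal_pos]
  have := Real.pi_pos
  positivity

/-- Below a Lebesgue number of a finite-scale cover the local estimate applies; above it the total
mass does. A ball with another centre that meets ∂Ω lies in a ball of twice the radius about a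
boundary point, whence the factor 4. -/
theorem exists_forall_surfaceMeasure_ball_le (hΩ : IsBoundedC1Domain Ω) :
    ∃ C : ℝ, 0 < C ∧ ∀ x r, 0 ≤ r → (surfaceMeasure Ω).real (Metric.ball x r) ≤ C * r ^ 2 := by
  have := hΩ.isFiniteMeasure_surfaceMeasure
  choose! δ hδ hb using fun x hx => hΩ.exists_surfaceMeasure_ball_le (x := x) hx (ε := 1 / 2)
    (by norm_num) (by norm_num)
  obtain ⟨d, hd, hcov⟩ := lebesgue_number_lemma_of_metric (s := frontier Ω)
    (c := fun i : frontier Ω => Metric.ball (i : E3) (δ i)) hΩ.isCompact_frontier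
    (fun i => Metric.isOpen_ball) (fun x hx => Set.mem_iUnion.2
      ⟨⟨x, hx⟩, Metric.mem_ball_self (hδ x hx)⟩)
  set M := (surfaceMeasure Ω).real Set.univ
  have hM : 0 ≤ M := measureReal_nonneg
  have hpi := Real.pi_pos
  set C := 2 * Real.pi + M / d ^ 2 with hC
  have hC0 : 0 < C := by positivity
  have h1 : ∀ x ∈ frontier Ω, ∀ r, 0 ≤ r →
      (surfaceMeasure Ω).real (Metric.ball x r) ≤ C * r ^ 2 := by
    intro x hx r hr
    rcases le_or_gt r d with hrd | hrd
    · obtain ⟨i, hi⟩ := hcov x hx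
      have h := hb i i.2 x r ((Metric.ball_subset_ball hrd).trans hi)
      rw [← ofReal_measureReal, ENNReal.ofReal_le_ofReal_iff (by positivity)] at h
      refine h.trans ?_
      have : 0 ≤ M / d ^ 2 * r ^ 2 := by positivity
      nlinarith [mul_nonneg hpi.le (sq_nonneg r)]
    · refine (measureReal_mono (Set.subset_univ _)).trans ?_
      have h2 : M ≤ M / d ^ 2 * r ^ 2 := by
        rw [div_mul_eq_mul_div, le_div_iff₀ (by positivity)]
        gcongr
      have : 0 ≤ 2 * Real.pi * r ^ 2 := by positivity
      change M ≤ _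
      rw [hC, add_mul]; linarith
  refine ⟨4 * C, by positivity, fun x r hr => ?_⟩
  by_cases hne : (frontier Ω ∩ Metric.ball x r).Nonempty
  · obtain ⟨y, hy, hyr⟩ := hne
    refine (measureReal_mono (Metric.ball_subset_ball' (y := y) (ε₂ := 2 * r) ?_)).trans
      ((h1 y hy (2 * r) (by linarith)).trans (by linarith))
    rw [dist_comm]; linarith [Metric.mem_ball.1 hyr]
  · rw [Measure.real, surfaceMeasure_ball_eq, Set.not_nonempty_iff_eq_empty.1 hne]
    simp only [measure_empty, ENNReal.toReal_zero]
    positivity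

end IsBoundedC1Domain

/-! ### Radial kernels -/

/-- Layer-cake formula, by Tonelli on {d(y) < τ}: a radial kernel is written as the tail integral of
a weight, and its integral then depends only on the measures of balls. -/
theorem lintegral_lintegral_Ioi {X : Type*} [MeasurableSpace X] {μ : Measure X} [SFinite μ]
    {d : X → ℝ} (hd : Measurable d) {w : ℝ → ℝ≥0∞} (hw : Measurable w) :
    ∫⁻ y, (∫⁻ τ in Set.Ioi (d y), w τ) ∂μ = ∫⁻ τ, w τ * μ {y | d y < τ} := by
  have h1 : ∀ y, ∫⁻ τ in Set.Ioi (d y), w τ = ∫⁻ τ, {p : X × ℝ | d p.1 < p.2}.indicator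
      (fun p => w p.2) (y, τ) := by
    intro y
    rw [← lintegral_indicator measurableSet_Ioi]
    rfl
  have hs : MeasurableSet {p : X × ℝ | d p.1 < p.2} :=
    measurableSet_lt (hd.comp measurable_fst) measurable_snd
  simp_rw [h1]
  rw [lintegral_lintegral_swap
    (f := fun y τ => {p : X × ℝ | d p.1 < p.2}.indicator (fun p => w p.2) (y, τ))
    ((hw.comp measurable_snd).indicator hs).aemeasurable]
  refine lintegral_congr fun τ => ?_
  have h2 : ∀ y, {p : X × ℝ | d p.1 < p.2}.indicator (fun p => w p.2) (y, τ)
      = {y | d y < τ}.indicator (fun _ => w τ) y := fun y => rfl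
  simp_rw [h2]
  rw [lintegral_indicator_const (measurableSet_lt hd measurable_const)]

theorem lintegral_Ioi_of_hasDerivAt {g g' : ℝ → ℝ} {a l : ℝ}
    (hcont : ContinuousWithinAt g (Set.Ici a) a)
    (hderiv : ∀ x ∈ Set.Ioi a, HasDerivAt g (g' x) x) (hpos : ∀ x ∈ Set.Ioi a, 0 ≤ g' x)
    (hlim : Tendsto g atTop (𝓝 l)) :
    ∫⁻ τ in Set.Ioi a, ENNReal.ofReal (g' τ) = ENNReal.ofReal (l - g a) := by
  rw [← integral_Ioi_of_hasDerivAt_of_nonneg hcont hderiv hpos hlim,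
    ofReal_integral_eq_lintegral_ofReal (integrableOn_Ioi_deriv_of_nonneg hcont hderiv hpos hlim)]
  exact (ae_restrict_mem measurableSet_Ioi).mono hpos

theorem lintegral_Ioi_inv_sq {a : ℝ} (ha : 0 < a) :
    ∫⁻ τ in Set.Ioi a, ENNReal.ofReal ((τ ^ 2)⁻¹) = ENNReal.ofReal a⁻¹ := by
  have hder : ∀ x ∈ Set.Ici a, HasDerivAt (fun τ : ℝ => -τ⁻¹) ((x ^ 2)⁻¹) x := fun x hx => by
    exact (hasDerivAt_inv (ne_of_gt (ha.trans_le hx))).fun_neg.congr_deriv (neg_neg _)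
  rw [lintegral_Ioi_of_hasDerivAt (g := fun τ => -τ⁻¹) (l := 0)
    (hder a Set.self_mem_Ici).continuousAt.continuousWithinAt
    (fun x hx => hder x (Set.Ioi_subset_Ici_self hx)) (fun x hx => by positivity)]
  · simp
  · simpa using (tendsto_inv_atTop_zero (𝕜 := ℝ)).neg

/-- Write 1/d as the integral of τ⁻² over τ > d. Layers with τ ≤ 1 contribute at most C by quadratic
growth, the others at most the total mass. At y = x the kernel is 0 by the convention for inverses.
-/
theorem lintegral_inv_norm_sub_le {μ : Measure E3} [IsFiniteMeasure μ] {C : ℝ} (hC : 0 ≤ C)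
    {x : E3} (h : ∀ r, 0 ≤ r → μ.real (Metric.ball x r) ≤ C * r ^ 2) :
    ∫⁻ y, ENNReal.ofReal ‖x - y‖⁻¹ ∂μ ≤ ENNReal.ofReal (C + μ.real Set.univ) := by
  have hmeas : Measurable fun y : E3 => ‖x - y‖ := by fun_prop
  calc ∫⁻ y, ENNReal.ofReal ‖x - y‖⁻¹ ∂μ
      ≤ ∫⁻ y, (∫⁻ τ in Set.Ioi ‖x - y‖, ENNReal.ofReal ((τ ^ 2)⁻¹)) ∂μ := by
        refine lintegral_mono fun y => ?_
        rcases (norm_nonneg (x - y)).eq_or_lt' with h0 | h0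
        · simp [h0]
        · exact (lintegral_Ioi_inv_sq h0).ge
    _ = ∫⁻ τ, ENNReal.ofReal ((τ ^ 2)⁻¹) * μ {y | ‖x - y‖ < τ} :=
        lintegral_lintegral_Ioi hmeas (by fun_prop)
    _ ≤ ∫⁻ τ, (Set.Ioc (0 : ℝ) 1).indicator (fun _ => ENNReal.ofReal C) τ +
          (Set.Ioi (1 : ℝ)).indicator
            (fun τ => ENNReal.ofReal ((τ ^ 2)⁻¹) * ENNReal.ofReal (μ.real Set.univ)) τ := by
        refine lintegral_mono fun τ => ?_
        have hball : {y | ‖x - y‖ < τ} = Metric.ball x τ := by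
          ext y; rw [Metric.mem_ball, dist_comm, dist_eq_norm]; rfl
        rw [hball]
        rcases le_or_gt τ 0 with h0 | h0
        · simp [Metric.ball_eq_empty.2 h0]
        rcases le_or_gt τ 1 with h1 | h1
        · rw [Set.indicator_of_mem (Set.mem_Ioc.2 ⟨h0, h1⟩), Set.indicator_of_notMem
            (by simpa using h1), add_zero, ← ofReal_measureReal,
            ← ENNReal.ofReal_mul (by positivity)]
          refine ENNReal.ofReal_le_ofReal ?_
          rw [inv_mul_le_iff₀ (by positivity), mul_comm]
          exact h τ h0.le
        · rw [Set.indicator_of_notMem (by simp [h1]), Set.indicator_of_mem (Set.mem_Ioi.2 h1),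
            zero_add, ofReal_measureReal]
          gcongr
          exact Set.subset_univ _
    _ = ENNReal.ofReal (C + μ.real Set.univ) := by
        rw [lintegral_add_left (measurable_const.indicator measurableSet_Ioc),
          lintegral_indicator_const measurableSet_Ioc, lintegral_indicator measurableSet_Ioi,
          lintegral_mul_const _ (by fun_prop), lintegral_Ioi_inv_sq one_pos,
          ENNReal.ofReal_add hC measureReal_nonneg]
        simp

/-- The (unnormalised) planar Poisson kernel `ε (ε² + d²)^(-3/2)`. -/
noncomputable def poissonProfile (ε d : ℝ) : ℝ := ε / Real.sqrt (ε ^ 2 + d ^ 2) ^ 3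

theorem poissonProfile_nonneg {ε : ℝ} (hε : 0 ≤ ε) (d : ℝ) : 0 ≤ poissonProfile ε d := by
  unfold poissonProfile; positivity

theorem continuous_poissonProfile {ε : ℝ} (hε : 0 < ε) : Continuous (poissonProfile ε) := by
  unfold poissonProfile
  refine continuous_const.div (by fun_prop) fun d => ?_
  positivity

theorem hasDerivAt_sqrt_sq_add {ε : ℝ} (hε : 0 < ε) (τ : ℝ) :
    HasDerivAt (fun τ => Real.sqrt (ε ^ 2 + τ ^ 2)) (τ / Real.sqrt (ε ^ 2 + τ ^ 2)) τ := by
  have h1 : HasDerivAt (fun τ : ℝ => ε ^ 2 + τ ^ 2) (2 * τ) τ := by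
    simpa using (hasDerivAt_pow 2 τ).const_add (ε ^ 2)
  have := h1.sqrt (by positivity)
  convert this using 1
  field_simp

theorem tendsto_sqrt_sq_add_atTop (ε : ℝ) :
    Tendsto (fun τ => Real.sqrt (ε ^ 2 + τ ^ 2)) atTop atTop := by
  refine tendsto_atTop_mono (fun τ => ?_) tendsto_id
  exact Real.le_sqrt_of_sq_le (by simp only [id]; nlinarith [sq_nonneg ε])

/-- The weight is minus the derivative of the profile, which vanishes at infinity. -/
theorem lintegral_Ioi_poissonProfile {ε : ℝ} (hε : 0 < ε) {d : ℝ} (hd : 0 ≤ d) :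
    ∫⁻ τ in Set.Ioi d, ENNReal.ofReal (3 * ε * τ / Real.sqrt (ε ^ 2 + τ ^ 2) ^ 5)
      = ENNReal.ofReal (poissonProfile ε d) := by
  have hder : ∀ x, HasDerivAt (fun τ : ℝ => -poissonProfile ε τ)
      (3 * ε * x / Real.sqrt (ε ^ 2 + x ^ 2) ^ 5) x := fun x => by
    have hs : 0 < Real.sqrt (ε ^ 2 + x ^ 2) := by positivity
    have := (((hasDerivAt_sqrt_sq_add hε x).fun_pow 3).fun_inv (pow_ne_zero 3 hs.ne')).const_mul
      (-ε)
    simp only [poissonProfile, div_eq_mul_inv, ← neg_mul] at this ⊢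
    refine this.congr_deriv ?_
    push_cast
    field_simp
  rw [lintegral_Ioi_of_hasDerivAt (g := fun τ => -poissonProfile ε τ) (l := 0)
    (hder d).continuousAt.continuousWithinAt
    (fun x _ => hder x) (fun x hx => div_nonneg (by have : 0 < x := hd.trans_lt hx; positivity)
      (by positivity)) (by
    rw [← neg_zero]
    refine Tendsto.neg ?_
    exact tendsto_const_nhds.div_atTop
      ((tendsto_pow_atTop three_ne_zero).comp (tendsto_sqrt_sq_add_atTop ε)))]
  simp

/-- An antiderivative of the rescaled weight times s². It increases from -2 at s = 0 to 0 at
infinity, so the weight sees a measure of density ℓ with total 2ℓ. -/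
theorem hasDerivAt_inv_cube_sub {s : ℝ} :
    HasDerivAt (fun s : ℝ => (Real.sqrt (1 ^ 2 + s ^ 2) ^ 3)⁻¹ - 3 * (Real.sqrt (1 ^ 2 + s ^ 2))⁻¹)
      (3 * s / Real.sqrt (1 ^ 2 + s ^ 2) ^ 5 * s ^ 2) s := by
  have hs : 0 < Real.sqrt (1 ^ 2 + s ^ 2) := by positivity
  have h := hasDerivAt_sqrt_sq_add one_pos s
  have := ((h.fun_pow 3).fun_inv (pow_ne_zero 3 hs.ne')).fun_sub
    ((h.fun_inv hs.ne').const_mul 3)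
  refine this.congr_deriv ?_
  have h2 : s ^ 2 = Real.sqrt (1 ^ 2 + s ^ 2) ^ 2 - 1 := by
    rw [Real.sq_sqrt (by positivity)]; ring
  push_cast
  set q := Real.sqrt (1 ^ 2 + s ^ 2)
  rw [h2]
  field_simp
  ring

theorem tendsto_inv_cube_sub_atTop :
    Tendsto (fun s : ℝ => (Real.sqrt (1 ^ 2 + s ^ 2) ^ 3)⁻¹ - 3 * (Real.sqrt (1 ^ 2 + s ^ 2))⁻¹)
      atTop (𝓝 0) := by
  have h := tendsto_sqrt_sq_add_atTop 1
  have h1 := tendsto_inv_atTop_zero.comp ((tendsto_pow_atTop three_ne_zero).comp h)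
  have h2 := (tendsto_inv_atTop_zero.comp h).const_mul 3
  simpa using h1.sub h2

theorem integrableOn_Ioi_cube_div : IntegrableOn
    (fun s : ℝ => 3 * s / Real.sqrt (1 ^ 2 + s ^ 2) ^ 5 * s ^ 2) (Set.Ioi 0) := by
  refine integrableOn_Ioi_deriv_of_nonneg hasDerivAt_inv_cube_sub.continuousAt.continuousWithinAt
    (fun s _ => hasDerivAt_inv_cube_sub) (fun s hs => ?_) tendsto_inv_cube_sub_atTop
  have : (0 : ℝ) < s := hs
  positivity

theorem integral_Ioi_cube_div :
    ∫ s in Set.Ioi (0 : ℝ), 3 * s / Real.sqrt (1 ^ 2 + s ^ 2) ^ 5 * s ^ 2 = 2 := by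
  rw [integral_Ioi_of_hasDerivAt_of_nonneg hasDerivAt_inv_cube_sub.continuousAt.continuousWithinAt
    (fun s _ => hasDerivAt_inv_cube_sub) (fun s hs => ?_) tendsto_inv_cube_sub_atTop]
  · norm_num
  · have : (0 : ℝ) < s := hs
    positivity

theorem measurable_measureReal_ball (μ : Measure E3) [IsFiniteMeasure μ] (x : E3) :
    Measurable fun τ => μ.real (Metric.ball x τ) := by
  refine Monotone.measurable fun a b hab => ?_
  exact measureReal_mono (Metric.ball_subset_ball hab)

/-- Layer cake followed by τ = εs. All dependence on ε now sits in a quotient governed by the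
density of μ at x. -/
theorem integral_poissonProfile {μ : Measure E3} [IsFiniteMeasure μ] (x : E3) {ε : ℝ}
    (hε : 0 < ε) : ∫ y, poissonProfile ε ‖x - y‖ ∂μ =
      ∫ s in Set.Ioi (0 : ℝ), 3 * s / Real.sqrt (1 ^ 2 + s ^ 2) ^ 5 *
        (μ.real (Metric.ball x (ε * s)) / ε ^ 2) := by
  have hmeas : Measurable fun y : E3 => ‖x - y‖ := by fun_prop
  have h1 : ∫ y, poissonProfile ε ‖x - y‖ ∂μ = ∫ τ in Set.Ioi (0 : ℝ),
      3 * ε * τ / Real.sqrt (ε ^ 2 + τ ^ 2) ^ 5 * μ.real (Metric.ball x τ) := by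
    rw [integral_eq_lintegral_of_nonneg_ae
      (Eventually.of_forall fun y => poissonProfile_nonneg hε.le _)
      ((continuous_poissonProfile hε).measurable.comp hmeas).aestronglyMeasurable,
      integral_eq_lintegral_of_nonneg_ae]
    · congr 1
      have : ∀ y, ENNReal.ofReal (poissonProfile ε ‖x - y‖) = ∫⁻ τ in Set.Ioi ‖x - y‖,
          ENNReal.ofReal (3 * ε * τ / Real.sqrt (ε ^ 2 + τ ^ 2) ^ 5) := fun y =>
        (lintegral_Ioi_poissonProfile hε (norm_nonneg _)).symm
      simp_rw [this]
      rw [lintegral_lintegral_Ioi hmeas (by fun_prop), ← lintegral_indicator measurableSet_Ioi]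
      refine lintegral_congr fun τ => ?_
      have hball : {y | ‖x - y‖ < τ} = Metric.ball x τ := by
        ext y; rw [Metric.mem_ball, dist_comm, dist_eq_norm]; rfl
      rw [hball]
      by_cases h0 : 0 < τ
      · rw [Set.indicator_of_mem (Set.mem_Ioi.2 h0), ENNReal.ofReal_mul (by positivity),
          ofReal_measureReal]
      · rw [Set.indicator_of_notMem (by simpa using h0), Metric.ball_eq_empty.2 (not_lt.1 h0)]
        simp
    · filter_upwards [ae_restrict_mem measurableSet_Ioi] with τ hτ
      have : (0 : ℝ) < τ := hτ
      have := measureReal_nonneg (μ := μ) (s := Metric.ball x τ)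
      simp only [Pi.zero_apply]
      positivity
    · have := measurable_measureReal_ball μ x
      exact Measurable.aestronglyMeasurable (by fun_prop)
  have h2 := integral_comp_mul_left_Ioi (fun τ =>
      3 * ε * τ / Real.sqrt (ε ^ 2 + τ ^ 2) ^ 5 * μ.real (Metric.ball x τ)) 0 hε
  rw [mul_zero, smul_eq_mul, eq_inv_mul_iff_mul_eq₀ hε.ne'] at h2
  rw [h1, ← h2, ← integral_const_mul]
  refine setIntegral_congr_fun measurableSet_Ioi fun s _ => ?_
  have h3 : Real.sqrt (ε ^ 2 + (ε * s) ^ 2) = ε * Real.sqrt (1 ^ 2 + s ^ 2) := by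
    rw [show ε ^ 2 + (ε * s) ^ 2 = ε ^ 2 * (1 ^ 2 + s ^ 2) by ring, Real.sqrt_mul (by positivity),
      Real.sqrt_sq hε.le]
  rw [h3]
  have : 0 < Real.sqrt (1 ^ 2 + s ^ 2) := by positivity
  field_simp

/-- Integrals of Poisson profiles see the two-dimensional density of the measure. -/
theorem tendsto_integral_poissonProfile {μ : Measure E3} [IsFiniteMeasure μ] {x : E3} {ℓ : ℝ}
    (h : Tendsto (fun r => μ.real (Metric.ball x r) / r ^ 2) (𝓝[>] 0) (𝓝 ℓ)) :
    Tendsto (fun ε => ∫ y, poissonProfile ε ‖x - y‖ ∂μ) (𝓝[>] 0) (𝓝 (2 * ℓ)) := by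
  -- The density gives quadratic growth for small r and finiteness of μ gives it for large r;
  -- together they supply the dominating function.
  obtain ⟨C, hC⟩ : ∃ C : ℝ, ∀ r, 0 < r → μ.real (Metric.ball x r) ≤ C * r ^ 2 := by
    obtain ⟨δ, hδ, hb⟩ := (mem_nhdsGT_iff_exists_Ioo_subset (a := (0 : ℝ))).1
      (h.eventually (gt_mem_nhds (lt_add_one ℓ)))
    have hδ : (0 : ℝ) < δ := hδ
    have hM : 0 ≤ μ.real Set.univ := measureReal_nonneg
    refine ⟨|ℓ + 1| + μ.real Set.univ / δ ^ 2, fun r hr => ?_⟩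
    rcases lt_or_ge r δ with h1 | h1
    · have := hb ⟨hr, h1⟩
      simp only [Set.mem_ofPred_eq] at this
      rw [div_lt_iff₀ (by positivity)] at this
      have h2 : 0 ≤ μ.real Set.univ / δ ^ 2 * r ^ 2 := by positivity
      nlinarith [le_abs_self (ℓ + 1), sq_nonneg r]
    · have h2 : μ.real Set.univ ≤ μ.real Set.univ / δ ^ 2 * r ^ 2 := by
        rw [div_mul_eq_mul_div, le_div_iff₀ (by positivity)]
        gcongr
      have h3 : 0 ≤ |ℓ + 1| * r ^ 2 := by positivity
      have := measureReal_mono (μ := μ) (Set.subset_univ (Metric.ball x r))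
      linarith
  have key : Tendsto (fun ε => ∫ s in Set.Ioi (0 : ℝ), 3 * s / Real.sqrt (1 ^ 2 + s ^ 2) ^ 5 *
        (μ.real (Metric.ball x (ε * s)) / ε ^ 2)) (𝓝[>] 0)
      (𝓝 (∫ s in Set.Ioi (0 : ℝ), 3 * s / Real.sqrt (1 ^ 2 + s ^ 2) ^ 5 * s ^ 2 * ℓ)) := by
    refine tendsto_integral_filter_of_dominated_convergence
      (fun s => 3 * s / Real.sqrt (1 ^ 2 + s ^ 2) ^ 5 * s ^ 2 * C) ?_ ?_
      (integrableOn_Ioi_cube_div.mul_const C) ?_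
    · refine Eventually.of_forall fun ε => ?_
      have := (measurable_measureReal_ball μ x).comp (measurable_const_mul ε)
      simp only [Function.comp_def] at this
      exact Measurable.aestronglyMeasurable (by fun_prop)
    · filter_upwards [self_mem_nhdsWithin] with ε hε
      have hε : 0 < ε := hε
      filter_upwards [ae_restrict_mem measurableSet_Ioi] with s hs
      have hs : 0 < s := hs
      have h1 := measureReal_nonneg (μ := μ) (s := Metric.ball x (ε * s))
      rw [Real.norm_of_nonneg (by positivity), mul_assoc _ (s ^ 2)]
      gcongr
      rw [div_le_iff₀ (by positivity)]
      exact (hC _ (by positivity)).trans (by nlinarith)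
    · filter_upwards [ae_restrict_mem measurableSet_Ioi] with s hs
      have hs : 0 < s := hs
      simp_rw [mul_assoc _ (s ^ 2)]
      refine Tendsto.const_mul _ ?_
      have h1 : Tendsto (fun ε : ℝ => ε * s) (𝓝[>] 0) (𝓝[>] 0) := by
        refine tendsto_nhdsWithin_iff.2 ⟨?_, ?_⟩
        · have : Continuous (fun ε : ℝ => ε * s) := by fun_prop
          simpa using (this.tendsto 0).mono_left nhdsWithin_le_nhds
        · filter_upwards [self_mem_nhdsWithin] with ε hε
          exact mul_pos hε hs
      refine ((h.comp h1).const_mul (s ^ 2)).congr' ?_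
      filter_upwards [self_mem_nhdsWithin] with ε hε
      have hε : 0 < ε := hε
      simp only [Function.comp]
      field_simp
  rw [integral_mul_const, integral_Ioi_cube_div] at key
  refine key.congr' ?_
  filter_upwards [self_mem_nhdsWithin] with ε hε
  exact (integral_poissonProfile x hε).symm

/-! ### Algebra of Pauli matrices -/

theorem sigmaAct_add (a b : E3) : sigmaAct (a + b) = sigmaAct a + sigmaAct b := by
  rw [sigmaAct, sigmaAct, sigmaAct, ← map_add]
  congr 1
  ext i j
  fin_cases i <;> fin_cases j <;> simp [sigmaDot] <;> ring

theorem sigmaAct_smul (c : ℝ) (a : E3) : sigmaAct (c • a) = c • sigmaAct a := by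
  have : c • sigmaAct a = (c : ℂ) • sigmaAct a := by
    ext ξ : 1
    exact (Complex.coe_smul c _).symm
  rw [this, sigmaAct, sigmaAct, ← map_smul]
  congr 1
  ext i j
  fin_cases i <;> fin_cases j <;> simp [sigmaDot] <;> ring

/-- `a ↦ σ · a` as a continuous linear map. -/
noncomputable def sigmaCLM : E3 →L[ℝ] (Spinor →L[ℂ] Spinor) :=
  LinearMap.toContinuousLinearMap
    { toFun := sigmaAct, map_add' := sigmaAct_add, map_smul' := sigmaAct_smul }

theorem continuous_sigmaAct : Continuous sigmaAct := sigmaCLM.continuous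

theorem sigmaAct_neg (a : E3) : sigmaAct (-a) = -sigmaAct a := map_neg sigmaCLM a

theorem sigmaAct_sub (a b : E3) : sigmaAct (a - b) = sigmaAct a - sigmaAct b := map_sub sigmaCLM a b

theorem inner_eq_sum_three (a b : E3) : inner ℝ a b = a 0 * b 0 + a 1 * b 1 + a 2 * b 2 := by
  simp [PiLp.inner_apply, Fin.sum_univ_three, mul_comm]

/-- The Clifford relation. Both the mirror law for normals and the algebra on the sphere are
consequences of it. -/
theorem sigmaAct_mul_add_mul (a b : E3) :
    sigmaAct a * sigmaAct b + sigmaAct b * sigmaAct a = ((2 * inner ℝ a b : ℝ) : ℂ) • 1 := by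
  rw [sigmaAct, sigmaAct, ← map_mul, ← map_mul, ← map_add, ← map_one (Matrix.toEuclideanCLM
    (n := Fin 2) (𝕜 := ℂ)), ← map_smul, inner_eq_sum_three]
  congr 1
  ext i j
  have hI := Complex.I_mul_I
  fin_cases i <;> fin_cases j <;>
    simp [sigmaDot] <;> ring_nf <;> simp

theorem sigmaAct_mul_self (a : E3) : sigmaAct a * sigmaAct a = ((‖a‖ ^ 2 : ℝ) : ℂ) • 1 := by
  have h := sigmaAct_mul_add_mul a a
  rw [← two_smul ℂ, real_inner_self_eq_norm_sq] at h
  have h2 : (2 : ℂ) ≠ 0 := two_ne_zero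
  apply smul_right_injective _ h2
  simp only
  rw [h, smul_smul]
  push_cast
  rfl

theorem sigmaAct_sigmaAct (a : E3) (ξ : Spinor) :
    sigmaAct a (sigmaAct a ξ) = ((‖a‖ ^ 2 : ℝ) : ℂ) • ξ := by
  simpa using congrArg (fun T : Spinor →L[ℂ] Spinor => T ξ) (sigmaAct_mul_self a)

theorem adjoint_sigmaAct (a : E3) : ContinuousLinearMap.adjoint (sigmaAct a) = sigmaAct a := by
  rw [← ContinuousLinearMap.star_eq_adjoint, sigmaAct, ← map_star]
  congr 1
  ext i j
  fin_cases i <;> fin_cases j <;> simp [sigmaDot, Matrix.star_apply]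

theorem inner_sigmaAct_left (a : E3) (ξ η : Spinor) :
    inner ℂ (sigmaAct a ξ) η = inner ℂ ξ (sigmaAct a η) := by
  rw [← ContinuousLinearMap.adjoint_inner_right, adjoint_sigmaAct]

theorem norm_sigmaAct_apply (a : E3) (ξ : Spinor) : ‖sigmaAct a ξ‖ = ‖a‖ * ‖ξ‖ := by
  have h : ‖sigmaAct a ξ‖ ^ 2 = (‖a‖ * ‖ξ‖) ^ 2 := by
    rw [← inner_self_eq_norm_sq (𝕜 := ℂ), inner_sigmaAct_left, sigmaAct_sigmaAct, inner_smul_right,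
      mul_pow, RCLike.re_to_complex, Complex.re_ofReal_mul, ← RCLike.re_to_complex,
      inner_self_eq_norm_sq]
  exact (pow_left_inj₀ (norm_nonneg _) (by positivity) two_ne_zero).1 h

theorem aestronglyMeasurable_clm_apply {α : Type*} [MeasurableSpace α] {μ : Measure α}
    {T : α → Spinor →L[ℂ] Spinor} {u : α → Spinor} (hT : AEStronglyMeasurable T μ)
    (hu : AEStronglyMeasurable u μ) : AEStronglyMeasurable (fun y => T y (u y)) μ :=
  (isBoundedBilinearMap_apply (𝕜 := ℂ) (E := Spinor) (F := Spinor)).continuous.comp_aestronglyMeasurable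
    (hT.prodMk hu)

/-! ### The kernel -/

theorem kernelW_apply (z : E3) (ξ : Spinor) :
    kernelW z ξ = (Complex.I * ((‖z‖ ^ 3)⁻¹ : ℝ)) • sigmaAct z ξ := rfl

theorem norm_kernelW_apply_le (z : E3) (ξ : Spinor) : ‖kernelW z ξ‖ ≤ (‖z‖ ^ 2)⁻¹ * ‖ξ‖ := by
  rw [kernelW_apply, norm_smul, norm_sigmaAct_apply, norm_mul, Complex.norm_I, one_mul,
    Complex.norm_real, norm_inv, norm_pow, norm_norm, ← mul_assoc]
  rcases (norm_nonneg z).eq_or_lt' with h | h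
  · simp [h]
  · apply le_of_eq
    field_simp

/-- Since σ·z is Hermitian and i is skew, the adjoint of w(z) is w(-z); in other words W_m is
formally symmetric. -/
theorem inner_kernelW_left (z : E3) (ξ η : Spinor) :
    inner ℂ (kernelW z ξ) η = inner ℂ ξ (kernelW (-z) η) := by
  rw [kernelW_apply, kernelW_apply, inner_smul_left, inner_smul_right, inner_sigmaAct_left,
    sigmaAct_neg, norm_neg]
  simp

theorem stronglyMeasurable_kernelW : StronglyMeasurable kernelW := by
  unfold kernelW
  refine StronglyMeasurable.smul (𝕜 := ℂ) (f := fun z : E3 => Complex.I * ((‖z‖ ^ 3)⁻¹ : ℝ)) ?_ continuous_sigmaAct.stronglyMeasurable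
  exact Measurable.stronglyMeasurable (by fun_prop)

theorem continuousAt_kernelW {z : E3} (hz : z ≠ 0) : ContinuousAt kernelW z := by
  unfold kernelW
  refine ContinuousAt.smul (M := ℂ) (f := fun z : E3 => Complex.I * ((‖z‖ ^ 3)⁻¹ : ℝ)) ?_ continuous_sigmaAct.continuousAt
  refine continuousAt_const.mul (Complex.continuous_ofReal.continuousAt.comp ?_)
  exact ContinuousAt.inv₀ (by fun_prop) (by simpa using hz)

theorem aestronglyMeasurable_kernelW_apply {μ : Measure E3} {u : E3 → Spinor}
    (hu : AEStronglyMeasurable u μ) (x : E3) :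
    AEStronglyMeasurable (fun y => kernelW (x - y) (u y)) μ := by
  have h1 : StronglyMeasurable fun y => kernelW (x - y) :=
    stronglyMeasurable_kernelW.comp_measurable (by fun_prop)
  exact aestronglyMeasurable_clm_apply h1.aestronglyMeasurable hu

/-! ### Boundary square integrable functions -/

theorem Lp_integrable {Ω : Set E3} (hΩ : IsBoundedC1Domain Ω) (u : BoundaryL2 Ω) :
    Integrable u (surfaceMeasure Ω) :=
  have := hΩ.isFiniteMeasure_surfaceMeasure
  (Lp.memLp u).integrable one_le_two

theorem integrableOn_kernelW {μ : Measure E3} {u : E3 → Spinor} (hu : Integrable u μ) (x : E3)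
    {ε : ℝ} (hε : 0 < ε) : IntegrableOn (fun y => kernelW (x - y) (u y)) {y | ε < ‖x - y‖} μ := by
  have hs : MeasurableSet {y : E3 | ε < ‖x - y‖} := measurableSet_lt (by fun_prop) (by fun_prop)
  refine Integrable.mono' (g := fun y => (ε ^ 2)⁻¹ * ‖u y‖) (hu.norm.const_mul _).integrableOn
    (aestronglyMeasurable_kernelW_apply hu.aestronglyMeasurable x).restrict ?_
  filter_upwards [ae_restrict_mem hs] with y hy
  refine (norm_kernelW_apply_le _ _).trans ?_
  have hy : ε < ‖x - y‖ := hy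
  gcongr

/-- If `K(x - y) u(y)` is integrable in `y`, the principal value is the plain integral. -/
theorem tendsto_truncated_integral {μ : Measure E3} {f : E3 → Spinor} {x : E3}
    (hf : Integrable f μ) (hx : f x = 0) :
    Tendsto (fun ε : ℝ => ∫ y in {y | ε < ‖x - y‖}, f y ∂μ) (𝓝[>] 0) (𝓝 (∫ y, f y ∂μ)) := by
  have hs : ∀ ε : ℝ, MeasurableSet {y : E3 | ε < ‖x - y‖} := fun ε =>
    measurableSet_lt (by fun_prop) (by fun_prop)
  simp_rw [← fun ε => integral_indicator (μ := μ) (f := f) (hs ε)]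
  refine tendsto_integral_filter_of_dominated_convergence (fun y => ‖f y‖) ?_ ?_ hf.norm ?_
  · exact Eventually.of_forall fun ε => hf.aestronglyMeasurable.indicator (hs ε)
  · exact Eventually.of_forall fun ε => Eventually.of_forall fun y => norm_indicator_le_norm_self _ _
  · refine Eventually.of_forall fun y => ?_
    rcases eq_or_ne y x with rfl | hne
    · refine tendsto_const_nhds.congr fun ε => ?_
      rw [hx]
      by_cases h : y ∈ {z : E3 | ε < ‖y - z‖}
      · rw [Set.indicator_of_mem h, hx]
      · rw [Set.indicator_of_notMem h]
    · have : 0 < ‖x - y‖ := norm_pos_iff.2 (sub_ne_zero.2 hne.symm)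
      refine tendsto_const_nhds.congr' ?_
      filter_upwards [Ioo_mem_nhdsGT this] with ε hε
      rw [Set.indicator_of_mem]
      exact hε.2

theorem hasPrincipalValue_of_integrable {Ω : Set E3} {u : E3 → Spinor}
    (hu : Integrable u (surfaceMeasure Ω)) {x : E3}
    (h : Integrable (fun y => kernelW (x - y) (u y)) (surfaceMeasure Ω)) :
    HasPrincipalValue Ω u x
      (((4 * Real.pi)⁻¹ : ℝ) • ∫ y, kernelW (x - y) (u y) ∂surfaceMeasure Ω) := by
  refine ⟨fun ε hε => integrableOn_kernelW hu x hε, Tendsto.const_smul ?_ _⟩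
  exact tendsto_truncated_integral h (by simp [kernelW_apply])

/-! ### Products with bounded functions -/

theorem memLp_smul_of_bound {μ : Measure E3} {u : E3 → Spinor} (hu : MemLp u 2 μ) {φ : E3 → ℝ}
    (hφ : Continuous φ) {M : ℝ} (hM : ∀ y, |φ y| ≤ M) : MemLp (fun y => φ y • u y) 2 μ := by
  refine MemLp.of_le_mul (c := M) hu (hφ.aestronglyMeasurable.smul hu.aestronglyMeasurable)
    (Eventually.of_forall fun y => ?_)
  rw [norm_smul, Real.norm_eq_abs]
  gcongr
  exact hM y

namespace IsBoundedC1Domain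

variable {Ω : Set E3}

theorem aestronglyMeasurable_sigmaNu (hΩ : IsBoundedC1Domain Ω) {u : E3 → Spinor}
    (hu : AEStronglyMeasurable u (surfaceMeasure Ω)) :
    AEStronglyMeasurable (fun y => sigmaAct (outwardNormal Ω y) (u y)) (surfaceMeasure Ω) := by
  have h1 : AEStronglyMeasurable (outwardNormal Ω) (surfaceMeasure Ω) :=
    hΩ.continuousOn_outwardNormal.aestronglyMeasurable isClosed_frontier.measurableSet
  exact aestronglyMeasurable_clm_apply (continuous_sigmaAct.comp_aestronglyMeasurable h1) hu

theorem ae_norm_sigmaNu (hΩ : IsBoundedC1Domain Ω) (u : E3 → Spinor) :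
    ∀ᵐ y ∂surfaceMeasure Ω, ‖sigmaAct (outwardNormal Ω y) (u y)‖ = ‖u y‖ := by
  filter_upwards [ae_mem_frontier Ω] with y hy
  rw [norm_sigmaAct_apply, hΩ.norm_outwardNormal hy, one_mul]

theorem memLp_sigmaNu (hΩ : IsBoundedC1Domain Ω) {u : E3 → Spinor}
    (hu : MemLp u 2 (surfaceMeasure Ω)) :
    MemLp (fun y => sigmaAct (outwardNormal Ω y) (u y)) 2 (surfaceMeasure Ω) :=
  hu.of_le (hΩ.aestronglyMeasurable_sigmaNu hu.aestronglyMeasurable)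
    ((hΩ.ae_norm_sigmaNu u).mono fun _ h => h.le)

/-- Multiplication by `σ · ν` as a function on `L²`. -/
noncomputable def sigmaNu (hΩ : IsBoundedC1Domain Ω) (u : BoundaryL2 Ω) : BoundaryL2 Ω :=
  (hΩ.memLp_sigmaNu (Lp.memLp u)).toLp

theorem coeFn_sigmaNu (hΩ : IsBoundedC1Domain Ω) (u : BoundaryL2 Ω) :
    hΩ.sigmaNu u =ᵐ[surfaceMeasure Ω] fun y => sigmaAct (outwardNormal Ω y) (u y) :=
  MemLp.coeFn_toLp _

theorem sigmaNu_sigmaNu (hΩ : IsBoundedC1Domain Ω) (u : BoundaryL2 Ω) :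
    hΩ.sigmaNu (hΩ.sigmaNu u) = u := by
  refine Lp.ext ?_
  filter_upwards [hΩ.coeFn_sigmaNu (hΩ.sigmaNu u), hΩ.coeFn_sigmaNu u, ae_mem_frontier Ω]
    with y h1 h2 hy
  rw [h1, h2, sigmaAct_sigmaAct, hΩ.norm_outwardNormal hy]
  simp

theorem inner_sigmaNu_left (hΩ : IsBoundedC1Domain Ω) (u v : BoundaryL2 Ω) :
    inner ℂ (hΩ.sigmaNu u) v = inner ℂ u (hΩ.sigmaNu v) := by
  rw [L2.inner_def, L2.inner_def]
  refine integral_congr_ae ?_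
  filter_upwards [hΩ.coeFn_sigmaNu u, hΩ.coeFn_sigmaNu v] with y h1 h2
  rw [h1, h2, inner_sigmaAct_left]

theorem mem_graph_opSigmaNu (hΩ : IsBoundedC1Domain Ω) (u : BoundaryL2 Ω) :
    (u, hΩ.sigmaNu u) ∈ (opSigmaNu Ω).graph := by
  rw [opSigmaNu_graph]
  exact hΩ.coeFn_sigmaNu u

theorem mem_domain_opSigmaNu (hΩ : IsBoundedC1Domain Ω) (u : BoundaryL2 Ω) :
    u ∈ (opSigmaNu Ω).domain := LinearPMap.mem_domain_of_mem_graph (hΩ.mem_graph_opSigmaNu u)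

theorem opSigmaNu_apply (hΩ : IsBoundedC1Domain Ω) (u : (opSigmaNu Ω).domain) :
    opSigmaNu Ω u = hΩ.sigmaNu u :=
  LinearPMap.mem_graph_snd_inj _ (LinearPMap.mem_graph _ u) (hΩ.mem_graph_opSigmaNu u) rfl

end IsBoundedC1Domain

theorem mem_domain_opW_iff {Ω : Set E3} {u : BoundaryL2 Ω} :
    u ∈ (opW Ω).domain ↔ ∃ v : BoundaryL2 Ω,
      ∀ᵐ x ∂surfaceMeasure Ω, HasPrincipalValue Ω u x (v x) := by
  rw [LinearPMap.mem_domain_iff, opW_graph]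
  rfl

theorem opW_apply_hasPrincipalValue {Ω : Set E3} (u : (opW Ω).domain) :
    ∀ᵐ x ∂surfaceMeasure Ω, HasPrincipalValue Ω (u : BoundaryL2 Ω) x (opW Ω u x) := by
  have h := LinearPMap.mem_graph _ u
  rw [opW_graph] at h
  exact h

theorem opW_apply_eq {Ω : Set E3} (u : (opW Ω).domain) {v : BoundaryL2 Ω}
    (h : ∀ᵐ x ∂surfaceMeasure Ω, HasPrincipalValue Ω (u : BoundaryL2 Ω) x (v x)) :
    opW Ω u = v := by
  refine Lp.ext ?_
  filter_upwards [h, opW_apply_hasPrincipalValue u] with x h1 h2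
  exact h2.unique h1

/-! ### Products of partially defined operators -/

theorem mem_domain_opMul_iff {H : Type*} [AddCommGroup H] [Module ℂ H] {T S : H →ₗ.[ℂ] H} {u : H} :
    u ∈ (opMul T S).domain ↔ ∃ h : u ∈ S.domain, S ⟨u, h⟩ ∈ T.domain := by
  constructor
  · rintro ⟨⟨y, hy, rfl⟩, h⟩
    exact ⟨h, hy⟩
  · rintro ⟨h, h'⟩
    exact ⟨⟨⟨u, h⟩, h', rfl⟩, h⟩

theorem opMul_apply {H : Type*} [AddCommGroup H] [Module ℂ H] {T S : H →ₗ.[ℂ] H}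
    (u : (opMul T S).domain) (h : (u : H) ∈ S.domain) (h' : S ⟨u, h⟩ ∈ T.domain) :
    opMul T S u = T ⟨S ⟨u, h⟩, h'⟩ := rfl

/-! ### A Schur estimate for the weakly singular kernel `|x - y|⁻¹` -/

/-- The Riesz potential `∫ |x - y|⁻¹ |u(y)| dμ(y)`. -/
noncomputable def rieszPotential (μ : Measure E3) (u : E3 → Spinor) (x : E3) : ℝ≥0∞ :=
  ∫⁻ y, ENNReal.ofReal ‖x - y‖⁻¹ * ‖u y‖ₑ ∂μ

theorem aemeasurable_rieszPotential {μ : Measure E3} [SFinite μ] {u : E3 → Spinor}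
    (hu : AEStronglyMeasurable u μ) : AEMeasurable (rieszPotential μ u) μ := by
  refine AEMeasurable.lintegral_prod_right' (f := fun p : E3 × E3 =>
    ENNReal.ofReal ‖p.1 - p.2‖⁻¹ * ‖u p.2‖ₑ) ?_
  have h1 : Measurable fun p : E3 × E3 => ENNReal.ofReal ‖p.1 - p.2‖⁻¹ := by fun_prop
  exact h1.aemeasurable.mul hu.comp_snd.enorm

/-- Cauchy–Schwarz for 1 and |u| with respect to the measure |x-y|⁻¹ dμ(y), whose mass is at most C.
-/
theorem rieszPotential_sq_le {μ : Measure E3} {u : E3 → Spinor}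
    (hu : AEStronglyMeasurable u μ) {C : ℝ≥0∞} {x : E3}
    (hC : ∫⁻ y, ENNReal.ofReal ‖x - y‖⁻¹ ∂μ ≤ C) :
    rieszPotential μ u x ^ (2 : ℝ) ≤
      C * ∫⁻ y, ENNReal.ofReal ‖x - y‖⁻¹ * ‖u y‖ₑ ^ (2 : ℝ) ∂μ := by
  have hk : Measurable fun y : E3 => ENNReal.ofReal ‖x - y‖⁻¹ := by fun_prop
  set ν := μ.withDensity fun y => ENNReal.ofReal ‖x - y‖⁻¹ with hν
  have hue : AEMeasurable (fun y => ‖u y‖ₑ) μ := hu.enorm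
  have hF : rieszPotential μ u x = ∫⁻ y, ‖u y‖ₑ ∂ν := by
    rw [hν, lintegral_withDensity_eq_lintegral_mul₀ hk.aemeasurable hue]
    rfl
  have hG : ∫⁻ y, ENNReal.ofReal ‖x - y‖⁻¹ * ‖u y‖ₑ ^ (2 : ℝ) ∂μ = ∫⁻ y, ‖u y‖ₑ ^ (2 : ℝ) ∂ν := by
    rw [hν, lintegral_withDensity_eq_lintegral_mul₀ hk.aemeasurable (hue.pow_const _)]
    rfl
  have hU : ν Set.univ ≤ C := by
    rw [hν, withDensity_apply _ MeasurableSet.univ, Measure.restrict_univ]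
    exact hC
  have hν' : ν ≪ μ := withDensity_absolutelyContinuous _ _
  have h := ENNReal.lintegral_mul_le_Lp_mul_Lq ν Real.HolderConjugate.two_two
    (f := fun _ => 1) (g := fun y => ‖u y‖ₑ) aemeasurable_const (hue.mono_ac hν')
  simp only [Pi.mul_apply, one_mul, ENNReal.one_rpow, lintegral_const] at h
  rw [hF, hG]
  calc (∫⁻ y, ‖u y‖ₑ ∂ν) ^ (2 : ℝ)
      ≤ (ν Set.univ ^ (1 / 2 : ℝ) * (∫⁻ y, ‖u y‖ₑ ^ (2 : ℝ) ∂ν) ^ (1 / 2 : ℝ)) ^ (2 : ℝ) := by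
        gcongr
    _ = ν Set.univ * ∫⁻ y, ‖u y‖ₑ ^ (2 : ℝ) ∂ν := by
        rw [ENNReal.mul_rpow_of_nonneg _ _ (by norm_num), ← ENNReal.rpow_mul, ← ENNReal.rpow_mul]
        norm_num
    _ ≤ _ := by gcongr

/-- Schur's test: integrate the pointwise bound, exchange the integrals and use the symmetry of the
kernel. -/
theorem lintegral_rieszPotential_sq_lt_top {μ : Measure E3} [SFinite μ] {u : E3 → Spinor}
    (hu : MemLp u 2 μ) {C : ℝ≥0∞} (hCtop : C ≠ ∞)
    (hC : ∀ x, ∫⁻ y, ENNReal.ofReal ‖x - y‖⁻¹ ∂μ ≤ C) :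
    ∫⁻ x, rieszPotential μ u x ^ (2 : ℝ) ∂μ < ∞ := by
  have hue : AEMeasurable (fun y => ‖u y‖ₑ) μ := hu.1.enorm
  have hfin : ∫⁻ y, ‖u y‖ₑ ^ (2 : ℝ) ∂μ < ∞ := by
    have := lintegral_rpow_enorm_lt_top_of_eLpNorm_lt_top two_ne_zero ENNReal.ofNat_ne_top hu.2
    simpa using this
  calc ∫⁻ x, rieszPotential μ u x ^ (2 : ℝ) ∂μ
      ≤ ∫⁻ x, C * ∫⁻ y, ENNReal.ofReal ‖x - y‖⁻¹ * ‖u y‖ₑ ^ (2 : ℝ) ∂μ ∂μ :=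
        lintegral_mono fun x => rieszPotential_sq_le hu.1 (hC x)
    _ = C * ∫⁻ x, ∫⁻ y, ENNReal.ofReal ‖x - y‖⁻¹ * ‖u y‖ₑ ^ (2 : ℝ) ∂μ ∂μ :=
        lintegral_const_mul' _ _ hCtop
    _ = C * ∫⁻ y, ∫⁻ x, ENNReal.ofReal ‖x - y‖⁻¹ * ‖u y‖ₑ ^ (2 : ℝ) ∂μ ∂μ := by
        rw [lintegral_lintegral_swap]
        exact AEMeasurable.mul (Measurable.aemeasurable (by fun_prop))
          ((hue.pow_const _).comp_snd)
    _ ≤ C * ∫⁻ y, C * ‖u y‖ₑ ^ (2 : ℝ) ∂μ := by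
        gcongr with y
        rw [lintegral_mul_const _ (by fun_prop)]
        gcongr
        simp_rw [norm_sub_rev _ y]
        exact hC y
    _ = C * (C * ∫⁻ y, ‖u y‖ₑ ^ (2 : ℝ) ∂μ) := by rw [lintegral_const_mul' _ _ hCtop]
    _ < ∞ := ENNReal.mul_lt_top hCtop.lt_top (ENNReal.mul_lt_top hCtop.lt_top hfin)

namespace IsBoundedC1Domain

variable {Ω : Set E3}

theorem exists_lintegral_inv_norm_sub_le (hΩ : IsBoundedC1Domain Ω) :
    ∃ C : ℝ, ∀ x, ∫⁻ y, ENNReal.ofReal ‖x - y‖⁻¹ ∂surfaceMeasure Ω ≤ ENNReal.ofReal C := by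
  have := hΩ.isFiniteMeasure_surfaceMeasure
  obtain ⟨C, hC0, hC⟩ := hΩ.exists_forall_surfaceMeasure_ball_le
  exact ⟨_, fun x => lintegral_inv_norm_sub_le hC0.le (hC x)⟩

theorem memLp_rieszPotential (hΩ : IsBoundedC1Domain Ω) {u : E3 → Spinor}
    (hu : MemLp u 2 (surfaceMeasure Ω)) :
    (∀ᵐ x ∂surfaceMeasure Ω, rieszPotential (surfaceMeasure Ω) u x < ∞) ∧
      MemLp (fun x => (rieszPotential (surfaceMeasure Ω) u x).toReal) 2 (surfaceMeasure Ω) := by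
  have := hΩ.isFiniteMeasure_surfaceMeasure
  obtain ⟨C, hC⟩ := hΩ.exists_lintegral_inv_norm_sub_le
  have h := lintegral_rieszPotential_sq_lt_top hu ENNReal.ofReal_ne_top hC
  have hm := aemeasurable_rieszPotential hu.1
  have hae : ∀ᵐ x ∂surfaceMeasure Ω, rieszPotential (surfaceMeasure Ω) u x < ∞ := by
    filter_upwards [ae_lt_top' (hm.pow_const _) h.ne] with x hx
    exact (ENNReal.rpow_lt_top_iff_of_pos (by norm_num)).1 hx
  refine ⟨hae, hm.ennreal_toReal.aestronglyMeasurable, ?_⟩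
  refine (eLpNorm_lt_top_iff_lintegral_rpow_enorm_lt_top two_ne_zero ENNReal.ofNat_ne_top).2 ?_
  refine lt_of_le_of_lt (lintegral_mono_ae ?_) h
  filter_upwards [hae] with x hx
  rw [← ofReal_norm, Real.norm_of_nonneg ENNReal.toReal_nonneg, ENNReal.ofReal_toReal hx.ne]
  simp

/-- The domain of `W_m` is invariant under multiplication by bounded Lipschitz functions. -/
theorem exists_hasPrincipalValue_smul (hΩ : IsBoundedC1Domain Ω) {u v : BoundaryL2 Ω}
    (h : ∀ᵐ x ∂surfaceMeasure Ω, HasPrincipalValue Ω u x (v x)) {φ : E3 → ℝ} {L : ℝ≥0}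
    (hφ : LipschitzWith L φ) {M : ℝ} (hM : ∀ y, |φ y| ≤ M) :
    ∃ w : BoundaryL2 Ω,
      ∀ᵐ x ∂surfaceMeasure Ω, HasPrincipalValue Ω (fun y => φ y • u y) x (w x) := by
  have := hΩ.isFiniteMeasure_surfaceMeasure
  set μ := surfaceMeasure Ω with hμ
  have huL : MemLp u 2 μ := Lp.memLp u
  have huI : Integrable u μ := huL.integrable one_le_two
  have hφu : Integrable (fun y => φ y • u y) μ :=
    (memLp_smul_of_bound huL hφ.continuous hM).integrable one_le_two
  obtain ⟨hfin, hmem⟩ := hΩ.memLp_rieszPotential huL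
  -- Split φ(y) = φ(x) + (φ(y) - φ(x)). The first term gives φ(x) times the known principal value.
  -- In the second the Lipschitz factor cancels one power of the singularity, leaving an absolutely
  -- convergent integral dominated by the Riesz potential of u.
  set c : E3 → Spinor := fun x =>
    ((4 * Real.pi)⁻¹ : ℝ) • ∫ y, kernelW (x - y) ((φ y - φ x) • u y) ∂μ with hc
  have hbound : ∀ x y, ‖kernelW (x - y) ((φ y - φ x) • u y)‖ ≤ L * (‖x - y‖⁻¹ * ‖u y‖) := by
    intro x y
    refine (norm_kernelW_apply_le _ _).trans ?_
    rw [norm_smul, ← dist_eq_norm (φ y)]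
    have h1 : dist (φ y) (φ x) ≤ L * ‖x - y‖ := by
      rw [← dist_eq_norm x y, dist_comm x y]; exact hφ.dist_le_mul y x
    rcases (norm_nonneg (x - y)).eq_or_lt' with h0 | h0
    · rw [h0]; simp
    calc (‖x - y‖ ^ 2)⁻¹ * (dist (φ y) (φ x) * ‖u y‖)
        ≤ (‖x - y‖ ^ 2)⁻¹ * (L * ‖x - y‖ * ‖u y‖) := by gcongr
      _ = _ := by field_simp
  have hprod : AEStronglyMeasurable (fun p : E3 × E3 =>
      kernelW (p.1 - p.2) ((φ p.2 - φ p.1) • u p.2)) (μ.prod μ) := by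
    have hφc := hφ.continuous
    refine aestronglyMeasurable_clm_apply (StronglyMeasurable.aestronglyMeasurable
      (stronglyMeasurable_kernelW.comp_measurable (by fun_prop))) ?_
    have h1 : Continuous fun p : E3 × E3 => φ p.2 - φ p.1 := by fun_prop
    exact h1.aestronglyMeasurable.smul huL.1.comp_snd
  have hmeasx : ∀ x, AEStronglyMeasurable (fun y => kernelW (x - y) ((φ y - φ x) • u y)) μ := by
    intro x
    have hφc := hφ.continuous
    have h1 : Continuous fun y => φ y - φ x := by fun_prop
    exact aestronglyMeasurable_kernelW_apply (h1.aestronglyMeasurable.smul huL.1) x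
  have hlint : ∀ x, ∫⁻ y, ‖(‖x - y‖⁻¹ * ‖u y‖ : ℝ)‖ₑ ∂μ = rieszPotential μ u x := by
    intro x
    refine lintegral_congr fun y => ?_
    rw [← ofReal_norm, Real.norm_of_nonneg (by positivity), ENNReal.ofReal_mul (by positivity),
      ofReal_norm]
  have hint' : ∀ x, rieszPotential μ u x < ∞ → Integrable (fun y => ‖x - y‖⁻¹ * ‖u y‖) μ := by
    intro x hx
    have h1 : Measurable fun y : E3 => ‖x - y‖⁻¹ := by fun_prop
    refine ⟨h1.aestronglyMeasurable.mul huL.1.norm, ?_⟩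
    rw [hasFiniteIntegral_iff_enorm, hlint x]
    exact hx
  have hint : ∀ x, rieszPotential μ u x < ∞ →
      Integrable (fun y => kernelW (x - y) ((φ y - φ x) • u y)) μ := fun x hx =>
    ((hint' x hx).const_mul (L : ℝ)).mono' (hmeasx x) (Eventually.of_forall (hbound x))
  have hcL : MemLp c 2 μ := by
    refine MemLp.of_le_mul (c := (4 * Real.pi)⁻¹ * L) hmem ?_ ?_
    · exact (AEStronglyMeasurable.integral_prod_right' hprod).const_smul ((4 * Real.pi)⁻¹ : ℝ)
    · filter_upwards [hfin] with x hx
      have hpi := Real.pi_pos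
      rw [hc]
      simp only
      rw [norm_smul, Real.norm_of_nonneg (by positivity), mul_assoc]
      gcongr
      refine (norm_integral_le_of_norm_le ((hint' x hx).const_mul (L : ℝ))
        (Eventually.of_forall (hbound x))).trans (le_of_eq ?_)
      rw [integral_const_mul, Real.norm_of_nonneg ENNReal.toReal_nonneg, ← hlint x,
        integral_eq_lintegral_of_nonneg_ae (Eventually.of_forall fun y => by
          simp only [Pi.zero_apply]; positivity) (hint' x hx).1]
      congr 2
      refine lintegral_congr fun y => ?_
      rw [← ofReal_norm, Real.norm_of_nonneg (by positivity)]
  have hvL : MemLp (fun x => φ x • v x) 2 μ := memLp_smul_of_bound (Lp.memLp v) hφ.continuous hM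
  refine ⟨(hvL.add hcL).toLp, ?_⟩
  filter_upwards [h, hfin, (hvL.add hcL).coeFn_toLp] with x hx hxfin hxw
  rw [hxw]
  have h1 : HasPrincipalValue Ω (fun y => (φ y - φ x) • u y) x (c x) := by
    refine hasPrincipalValue_of_integrable ?_ (hint x hxfin)
    have := hφu.sub (huI.smul (φ x))
    refine this.congr (Eventually.of_forall fun y => ?_)
    simp [sub_smul]
  have h2 := (hx.smul ((φ x : ℝ) : ℂ)).add h1
  simp only [Complex.coe_smul] at h2
  refine h2.congr (Eventually.of_forall fun y => ?_)
  simp only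
  rw [← add_smul, add_sub_cancel]

end IsBoundedC1Domain

/-! ### Localisation of the anticommutator kernel -/

/-- A Lipschitz bump supported in the ball of radius `δ` around `p`. -/
noncomputable def cutoff (p : E3) (δ : ℝ) (y : E3) : ℝ := max 0 (δ - dist y p)

theorem lipschitzWith_cutoff (p : E3) (δ : ℝ) : LipschitzWith 1 (cutoff p δ) := by
  have h : LipschitzWith 1 fun y : E3 => δ - dist y p := by
    have := (LipschitzWith.const' (K := 0) δ).sub (LipschitzWith.dist_left (α := E3) p)
    simpa using this
  exact h.const_max 0

theorem cutoff_nonneg (p : E3) (δ : ℝ) (y : E3) : 0 ≤ cutoff p δ y := le_max_left _ _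

theorem abs_cutoff_le (p : E3) {δ : ℝ} (hδ : 0 ≤ δ) (y : E3) : |cutoff p δ y| ≤ δ := by
  rw [abs_of_nonneg (cutoff_nonneg p δ y)]
  exact max_le hδ (by linarith [dist_nonneg (x := y) (y := p)])

theorem cutoff_self (p : E3) {δ : ℝ} (hδ : 0 ≤ δ) : cutoff p δ p = δ := by
  simp [cutoff, hδ]

theorem cutoff_pos_iff {p : E3} {δ : ℝ} {y : E3} : 0 < cutoff p δ y ↔ y ∈ Metric.ball p δ := by
  simp [cutoff]

theorem dist_lt_of_cutoff_ne_zero {p : E3} {δ : ℝ} {y : E3} (h : cutoff p δ y ≠ 0) :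
    dist y p < δ :=
  cutoff_pos_iff.1 ((cutoff_nonneg p δ y).lt_of_ne' h)

theorem le_norm_sub_of_cutoff_ne_zero {p q x y : E3} {δ : ℝ} (hpq : 4 * δ ≤ dist p q)
    (hx : x ∈ Metric.ball p δ) (hy : cutoff q δ y ≠ 0) : δ ≤ ‖x - y‖ := by
  have h1 := dist_lt_of_cutoff_ne_zero hy
  have h2 : dist x p < δ := hx
  have h3 := dist_triangle4 p x y q
  rw [dist_comm p x] at h3
  rw [← dist_eq_norm]
  linarith [dist_nonneg (x := x) (y := p)]

theorem norm_kernelW_smul_le {x y : E3} {δ M : ℝ} (hδ : 0 < δ) {a : ℝ} (ha : |a| ≤ M)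
    (h : a ≠ 0 → δ ≤ ‖x - y‖) (ξ : Spinor) :
    ‖kernelW (x - y) (a • ξ)‖ ≤ (δ ^ 2)⁻¹ * M * ‖ξ‖ := by
  have hM : 0 ≤ M := (abs_nonneg a).trans ha
  rcases eq_or_ne a 0 with rfl | h0
  · rw [zero_smul, map_zero, norm_zero]; positivity
  · refine (norm_kernelW_apply_le _ _).trans ?_
    rw [norm_smul, Real.norm_eq_abs, mul_assoc]
    have := h h0
    gcongr

/-- The value of `W_m (φ u)` away from the support of `φ`. -/
noncomputable def offPotential (μ : Measure E3) (φ : E3 → ℝ) (u : E3 → Spinor) (x : E3) : Spinor :=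
  ((4 * Real.pi)⁻¹ : ℝ) • ∫ y, kernelW (x - y) (φ y • u y) ∂μ

section

variable {μ : Measure E3} {u : E3 → Spinor} {p q : E3} {δ : ℝ}

theorem aestronglyMeasurable_kernelW_cutoff (hu : AEStronglyMeasurable u μ) (x : E3) :
    AEStronglyMeasurable (fun y => kernelW (x - y) (cutoff q δ y • u y)) μ :=
  aestronglyMeasurable_kernelW_apply
    ((lipschitzWith_cutoff q δ).continuous.aestronglyMeasurable.smul hu) x

theorem integrable_kernelW_cutoff (hu : Integrable u μ) (hδ : 0 < δ) (hpq : 4 * δ ≤ dist p q)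
    {x : E3} (hx : x ∈ Metric.ball p δ) :
    Integrable (fun y => kernelW (x - y) (cutoff q δ y • u y)) μ :=
  (hu.norm.const_mul ((δ ^ 2)⁻¹ * δ)).mono' (aestronglyMeasurable_kernelW_cutoff hu.1 x)
    (Eventually.of_forall fun y => norm_kernelW_smul_le hδ (abs_cutoff_le q hδ.le y)
      (le_norm_sub_of_cutoff_ne_zero hpq hx) _)

theorem continuousAt_offPotential (hu : Integrable u μ) (hδ : 0 < δ) (hpq : 4 * δ ≤ dist p q) :
    ContinuousAt (offPotential μ (cutoff q δ) u) p := by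
  refine ContinuousAt.const_smul (c := ((4 * Real.pi)⁻¹ : ℝ)) ?_
  refine continuousAt_of_dominated (bound := fun y => (δ ^ 2)⁻¹ * δ * ‖u y‖)
    (Eventually.of_forall fun x => aestronglyMeasurable_kernelW_cutoff hu.1 x) ?_
    (hu.norm.const_mul _) (Eventually.of_forall fun y => ?_)
  · filter_upwards [Metric.ball_mem_nhds p hδ] with x hx
    exact Eventually.of_forall fun y => norm_kernelW_smul_le hδ (abs_cutoff_le q hδ.le y)
      (le_norm_sub_of_cutoff_ne_zero hpq hx) _
  · rcases eq_or_ne (cutoff q δ y) 0 with h0 | h0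
    · simp only [h0, zero_smul, map_zero]
      exact continuousAt_const
    · have h1 := le_norm_sub_of_cutoff_ne_zero hpq (Metric.mem_ball_self hδ) h0
      have h2 : p - y ≠ 0 := by
        intro h
        rw [h, norm_zero] at h1
        linarith
      have h3 : ContinuousAt (fun x => kernelW (x - y)) p :=
        (continuousAt_kernelW h2).comp (f := fun x => x - y) (by fun_prop)
      exact h3.clm_apply continuousAt_const

theorem hasPrincipalValue_offPotential {Ω : Set E3} {u : E3 → Spinor}
    (hu : Integrable u (surfaceMeasure Ω)) (hδ : 0 < δ) (hpq : 4 * δ ≤ dist p q)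
    {x : E3} (hx : x ∈ Metric.ball p δ) :
    HasPrincipalValue Ω (fun y => cutoff q δ y • u y) x
      (offPotential (surfaceMeasure Ω) (cutoff q δ) u x) := by
  refine hasPrincipalValue_of_integrable ?_ (integrable_kernelW_cutoff hu hδ hpq hx)
  refine (hu.norm.const_mul δ).mono'
    ((lipschitzWith_cutoff q δ).continuous.aestronglyMeasurable.smul hu.1)
    (Eventually.of_forall fun y => ?_)
  rw [norm_smul]
  gcongr
  exact abs_cutoff_le q hδ.le y

end

namespace IsBoundedC1Domain

variable {Ω : Set E3}

/-- The surface measure charges every ball about a boundary point, so a null exceptional set cannot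
hide a non-zero value at a point of continuity. -/
theorem eq_zero_of_ae (hΩ : IsBoundedC1Domain Ω) {f : E3 → Spinor} {p : E3} (hp : p ∈ frontier Ω)
    (hf : ContinuousWithinAt f (frontier Ω) p) {δ : ℝ} (hδ : 0 < δ)
    (h : ∀ᵐ x ∂surfaceMeasure Ω, x ∈ Metric.ball p δ → f x = 0) : f p = 0 := by
  by_contra hne
  have h1 : ∀ᶠ x in 𝓝[frontier Ω] p, f x ≠ 0 := hf.eventually_ne hne
  rw [eventually_nhdsWithin_iff, Metric.nhds_basis_ball.eventually_iff] at h1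
  obtain ⟨r, hr, hb⟩ := h1
  have hpos := hΩ.surfaceMeasure_ball_pos hp (lt_min hδ hr)
  have hnull : surfaceMeasure Ω (Metric.ball p (min δ r)) = 0 := by
    refine measure_mono_null (t := {x | ¬ (x ∈ frontier Ω ∧ (x ∈ Metric.ball p δ → f x = 0))}) ?_
      (ae_iff.1 ((ae_mem_frontier Ω).and h))
    intro x hx hcon
    exact hb (Metric.ball_subset_ball (min_le_right _ _) hx) hcon.1
      (hcon.2 (Metric.ball_subset_ball (min_le_left _ _) hx))
  exact hpos.ne' hnull

theorem norm_sigmaNu_apply (hΩ : IsBoundedC1Domain Ω) {x : E3} (hx : x ∈ frontier Ω) (ξ : Spinor) :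
    ‖sigmaAct (outwardNormal Ω x) ξ‖ = ‖ξ‖ := by
  rw [norm_sigmaAct_apply, hΩ.norm_outwardNormal hx, one_mul]

theorem integrable_sigmaNu (hΩ : IsBoundedC1Domain Ω) {u : E3 → Spinor}
    (hu : Integrable u (surfaceMeasure Ω)) :
    Integrable (fun y => sigmaAct (outwardNormal Ω y) (u y)) (surfaceMeasure Ω) :=
  hu.mono (hΩ.aestronglyMeasurable_sigmaNu hu.1) ((hΩ.ae_norm_sigmaNu u).mono fun _ h => h.le)

/-- The variables are freed one after the other. Continuity in x turns the almost-everywhere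
identity near p into one at p, for each u in D. Density of D then makes the integral kernel vanish
almost everywhere in y, and continuity in y gives its value at q, where the cut-off equals δ ≠ 0. -/
theorem kernel_identity_of_dense (hΩ : IsBoundedC1Domain Ω) {p q : E3} (hp : p ∈ frontier Ω)
    (hq : q ∈ frontier Ω) {δ : ℝ} (hδ : 0 < δ) (hpq : 4 * δ ≤ dist p q)
    {D : Set (BoundaryL2 Ω)} (hD : Dense D)
    (h : ∀ u ∈ D, ∀ᵐ x ∂surfaceMeasure Ω, x ∈ Metric.ball p δ →
      sigmaAct (outwardNormal Ω x) (offPotential (surfaceMeasure Ω) (cutoff q δ) u x) +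
      offPotential (surfaceMeasure Ω) (cutoff q δ)
        (fun y => sigmaAct (outwardNormal Ω y) (u y)) x = 0) (ξ : Spinor) :
    sigmaAct (outwardNormal Ω p) (kernelW (p - q) ξ) +
      kernelW (p - q) (sigmaAct (outwardNormal Ω q) ξ) = 0 := by
  have := hΩ.isFiniteMeasure_surfaceMeasure
  set μ := surfaceMeasure Ω with hμ
  set φ := cutoff q δ with hφ
  set ν := outwardNormal Ω with hν
  have hνp := hΩ.continuousOn_outwardNormal p hp
  have hpoint : ∀ u ∈ D, ∫ y, sigmaAct (ν p) (kernelW (p - y) (φ y • u y)) +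
      kernelW (p - y) (φ y • sigmaAct (ν y) (u y)) ∂μ = 0 := by
    intro u hu
    have huI : Integrable u μ := Lp_integrable hΩ u
    have hNu := hΩ.integrable_sigmaNu huI
    have hc : ContinuousWithinAt (fun x => sigmaAct (ν x) (offPotential μ φ u x) +
        offPotential μ φ (fun y => sigmaAct (ν y) (u y)) x) (frontier Ω) p := by
      refine ContinuousWithinAt.add (ContinuousWithinAt.clm_apply ?_ ?_) ?_
      · exact continuous_sigmaAct.continuousAt.comp_continuousWithinAt hνp
      · exact (continuousAt_offPotential huI hδ hpq).continuousWithinAt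
      · exact (continuousAt_offPotential hNu hδ hpq).continuousWithinAt
    have h0 := hΩ.eq_zero_of_ae hp hc hδ (h u hu)
    have hi1 := integrable_kernelW_cutoff huI hδ hpq (Metric.mem_ball_self hδ)
    have hi2 := integrable_kernelW_cutoff hNu hδ hpq (Metric.mem_ball_self hδ)
    rw [integral_add ((sigmaAct (ν p)).integrable_comp hi1) hi2,
      ContinuousLinearMap.integral_comp_comm _ hi1]
    simp only [offPotential] at h0
    rw [← Complex.coe_smul, map_smul, Complex.coe_smul, ← smul_add] at h0
    exact (smul_eq_zero.1 h0).resolve_left (inv_ne_zero (by positivity))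
  refine ext_inner_left ℂ fun η => ?_
  rw [inner_zero_right]
  -- The adjoint of the localised kernel applied to η, so that pairing the vanishing integral with η
  -- becomes the L² inner product of g with u.
  set g : E3 → Spinor := fun y => kernelW (y - p) (φ y • sigmaAct (ν p) η) +
    sigmaAct (ν y) (kernelW (y - p) (φ y • η)) with hg
  have hgK : ∀ y ζ, inner ℂ (g y) ζ = inner ℂ η (sigmaAct (ν p) (kernelW (p - y) (φ y • ζ)) +
      kernelW (p - y) (φ y • sigmaAct (ν y) ζ)) := by
    intro y ζ
    rw [hg]
    simp only
    rw [inner_add_left, inner_add_right, inner_kernelW_left, inner_sigmaAct_left,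
      inner_kernelW_left, neg_sub, ← Complex.coe_smul, ← Complex.coe_smul, ← Complex.coe_smul,
      ← Complex.coe_smul, map_smul, map_smul, map_smul, inner_smul_left, inner_smul_left,
      inner_smul_right, inner_smul_right, inner_sigmaAct_left]
    simp
  have hK : ∀ (a : E3) (ζ : Spinor), ‖kernelW (a - p) (φ a • ζ)‖ ≤ (δ ^ 2)⁻¹ * δ * ‖ζ‖ := by
    intro a ζ
    refine norm_kernelW_smul_le hδ (abs_cutoff_le q hδ.le a) (fun h => ?_) ζ
    rw [norm_sub_rev]
    exact le_norm_sub_of_cutoff_ne_zero hpq (Metric.mem_ball_self hδ) h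
  have hKm : ∀ ζ : Spinor, AEStronglyMeasurable (fun y => kernelW (y - p) (φ y • ζ)) μ := by
    intro ζ
    refine aestronglyMeasurable_clm_apply (StronglyMeasurable.aestronglyMeasurable
      (stronglyMeasurable_kernelW.comp_measurable (by fun_prop))) ?_
    exact (lipschitzWith_cutoff q δ).continuous.aestronglyMeasurable.smul
      aestronglyMeasurable_const
  have hgL : MemLp g 2 μ := by
    refine MemLp.of_bound ((hKm _).add (hΩ.aestronglyMeasurable_sigmaNu (hKm _)))
      ((δ ^ 2)⁻¹ * δ * ‖η‖ + (δ ^ 2)⁻¹ * δ * ‖η‖) ?_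
    filter_upwards [ae_mem_frontier Ω] with y hy
    refine (norm_add_le _ _).trans (add_le_add ?_ ?_)
    · refine (hK y _).trans (le_of_eq ?_)
      rw [hΩ.norm_sigmaNu_apply hp]
    · rw [hΩ.norm_sigmaNu_apply hy]
      exact hK y _
  have hg0 : hgL.toLp = 0 := by
    refine hD.eq_zero_of_inner_left (𝕜 := ℂ) fun u hu => ?_
    rw [L2.inner_def]
    have hi := hpoint u hu
    have huI : Integrable u μ := Lp_integrable hΩ u
    have hi1 := integrable_kernelW_cutoff huI hδ hpq (Metric.mem_ball_self hδ)
    have hi2 := integrable_kernelW_cutoff (hΩ.integrable_sigmaNu huI) hδ hpq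
      (Metric.mem_ball_self hδ)
    have hI : Integrable (fun y => sigmaAct (ν p) (kernelW (p - y) (φ y • u y)) +
        kernelW (p - y) (φ y • sigmaAct (ν y) (u y))) μ :=
      ((sigmaAct (ν p)).integrable_comp hi1).add hi2
    have e := integral_inner (𝕜 := ℂ) hI η
    rw [hi, inner_zero_right] at e
    rw [← e]
    refine integral_congr_ae ?_
    filter_upwards [hgL.coeFn_toLp] with y hy
    rw [hy, hgK]
  have hgae : ∀ᵐ y ∂μ, y ∈ Metric.ball q δ → g y = 0 := by
    filter_upwards [hgL.coeFn_toLp, Lp.coeFn_zero Spinor 2 μ] with y h1 h2 _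
    rw [← h1, hg0, h2]
    rfl
  have hqp : q - p ≠ 0 := by
    rw [sub_ne_zero]
    rintro rfl
    rw [dist_self] at hpq
    linarith
  have hgc : ContinuousWithinAt g (frontier Ω) q := by
    have hKc : ∀ ζ : Spinor, ContinuousAt (fun y => kernelW (y - p) (φ y • ζ)) q := by
      intro ζ
      have h3 : ContinuousAt (fun y => kernelW (y - p)) q :=
        (continuousAt_kernelW hqp).comp (f := fun y => y - p) (by fun_prop)
      exact h3.clm_apply ((lipschitzWith_cutoff q δ).continuous.continuousAt.smul
        continuousAt_const)
    refine (hKc _).continuousWithinAt.add (ContinuousWithinAt.clm_apply ?_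
      (hKc _).continuousWithinAt)
    exact continuous_sigmaAct.continuousAt.comp_continuousWithinAt
      (hΩ.continuousOn_outwardNormal q hq)
  have hfin := hΩ.eq_zero_of_ae hq hgc hδ hgae
  have := hgK q ξ
  rw [hfin, inner_zero_left, hφ, cutoff_self q hδ.le, ← Complex.coe_smul, ← Complex.coe_smul,
    map_smul, map_smul, map_smul, ← smul_add, inner_smul_right] at this
  exact (mul_eq_zero.1 this.symm).resolve_left (by exact_mod_cast hδ.ne')

end IsBoundedC1Domain

/-! ### The kernel identity from the operator identities -/

theorem LinearPMap.inner_apply_left_of_isSelfAdjoint {H : Type*} [NormedAddCommGroup H]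
    [InnerProductSpace ℂ H] [CompleteSpace H] {A : H →ₗ.[ℂ] H} (hA : IsSelfAdjoint A)
    (x y : A.domain) : inner ℂ (A x) (y : H) = inner ℂ (x : H) (A y) := by
  have h := LinearPMap.adjoint_isFormalAdjoint hA.dense_domain
  rw [LinearPMap.isSelfAdjoint_def.1 hA] at h
  exact h x y

namespace IsBoundedC1Domain

variable {Ω : Set E3}

theorem memLp_cutoff (u : BoundaryL2 Ω) (q : E3) {δ : ℝ} (hδ : 0 ≤ δ) :
    MemLp (fun y => cutoff q δ y • u y) 2 (surfaceMeasure Ω) :=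
  memLp_smul_of_bound (Lp.memLp u) (lipschitzWith_cutoff q δ).continuous (abs_cutoff_le q hδ)

theorem opW_cutoff {u : E3 → Spinor}
    (hu : Integrable u (surfaceMeasure Ω)) {p q : E3} {δ : ℝ}
    (hδ : 0 < δ) (hpq : 4 * δ ≤ dist p q) (w : (opW Ω).domain)
    (hw : (w : BoundaryL2 Ω) =ᵐ[surfaceMeasure Ω] fun y => cutoff q δ y • u y) :
    ∀ᵐ x ∂surfaceMeasure Ω, x ∈ Metric.ball p δ →
      opW Ω w x = offPotential (surfaceMeasure Ω) (cutoff q δ) u x := by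
  filter_upwards [opW_apply_hasPrincipalValue w] with x hx hxb
  exact (hx.congr hw).unique (hasPrincipalValue_offPotential hu hδ hpq hxb)

theorem kernel_identity_of_anticommutator (hΩ : IsBoundedC1Domain Ω)
    (h : anticommutator (opW Ω) (opSigmaNu Ω) = 0) {p q : E3} (hp : p ∈ frontier Ω)
    (hq : q ∈ frontier Ω) (hne : p ≠ q) (ξ : Spinor) :
    sigmaAct (outwardNormal Ω p) (kernelW (p - q) ξ) +
      kernelW (p - q) (sigmaAct (outwardNormal Ω q) ξ) = 0 := by
  have hdist : 0 < dist p q := dist_pos.2 hne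
  have hδ : 0 < dist p q / 4 := by positivity
  have hpq : 4 * (dist p q / 4) ≤ dist p q := by linarith
  -- The zero operator is everywhere defined, and equality of partially defined operators includes
  -- their domains; hence every u lies in the domains of both products.
  have key : ∀ u : BoundaryL2 Ω, ∃ (hu : u ∈ (opW Ω).domain)
      (hNu : hΩ.sigmaNu u ∈ (opW Ω).domain),
      opW Ω ⟨hΩ.sigmaNu u, hNu⟩ + hΩ.sigmaNu (opW Ω ⟨u, hu⟩) = 0 := by
    intro u
    have hdom : u ∈ (anticommutator (opW Ω) (opSigmaNu Ω)).domain := by rw [h]; trivial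
    have hval : anticommutator (opW Ω) (opSigmaNu Ω) ⟨u, hdom⟩ = 0 := by
      exact (LinearPMap.ext_iff.1 h).2 (hf := hdom) (hg := trivial)
    obtain ⟨h1, h2⟩ := mem_domain_opMul_iff.1 hdom.1
    obtain ⟨h3, h4⟩ := mem_domain_opMul_iff.1 hdom.2
    have h2' := h2
    rw [hΩ.opSigmaNu_apply] at h2'
    refine ⟨h3, h2', ?_⟩
    have e1 : opMul (opW Ω) (opSigmaNu Ω) ⟨u, hdom.1⟩ = opW Ω ⟨hΩ.sigmaNu u, h2'⟩ := by
      rw [opMul_apply _ h1 h2]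
      congr 2
      exact hΩ.opSigmaNu_apply _
    have e2 : opMul (opSigmaNu Ω) (opW Ω) ⟨u, hdom.2⟩ = hΩ.sigmaNu (opW Ω ⟨u, h3⟩) := by
      rw [opMul_apply _ h3 h4]
      exact hΩ.opSigmaNu_apply _
    rw [← e1, ← e2]
    exact hval
  refine hΩ.kernel_identity_of_dense hp hq hδ hpq (D := Set.univ) dense_univ (fun u _ => ?_) ξ
  set w : BoundaryL2 Ω := (memLp_cutoff u q hδ.le).toLp with hw
  have hwae : w =ᵐ[surfaceMeasure Ω] fun y => cutoff q (dist p q / 4) y • u y :=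
    MemLp.coeFn_toLp _
  obtain ⟨h1, h2, h3⟩ := key w
  have huI := Lp_integrable hΩ u
  have hNw : hΩ.sigmaNu w =ᵐ[surfaceMeasure Ω] fun y =>
      cutoff q (dist p q / 4) y • sigmaAct (outwardNormal Ω y) (u y) := by
    filter_upwards [hΩ.coeFn_sigmaNu w, hwae] with y hy1 hy2
    rw [hy1, hy2, ← Complex.coe_smul, map_smul, Complex.coe_smul]
  have h3' := congrArg (fun f : BoundaryL2 Ω => (f : E3 → Spinor)) h3
  filter_upwards [opW_cutoff huI hδ hpq ⟨w, h1⟩ hwae,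
    opW_cutoff (hΩ.integrable_sigmaNu huI) hδ hpq ⟨_, h2⟩ hNw,
    Lp.coeFn_add (opW Ω ⟨_, h2⟩) (hΩ.sigmaNu (opW Ω ⟨w, h1⟩)),
    hΩ.coeFn_sigmaNu (opW Ω ⟨w, h1⟩), Lp.coeFn_zero Spinor 2 (surfaceMeasure Ω)]
    with x hx1 hx2 hx3 hx4 hx5 hxb
  rw [h3', hx5, Pi.zero_apply, Pi.add_apply, hx4, hx1 hxb, hx2 hxb] at hx3
  rw [add_comm, ← hx3]

/-- As σ·ν is an involution, it identifies dom W_m with dom P_+, and P_+ can be tested on vectors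
(σ·ν)w. -/
theorem apply_opPPlus (hΩ : IsBoundedC1Domain Ω) (w : (opW Ω).domain) :
    ∃ h : hΩ.sigmaNu w ∈ (opPPlus Ω).domain,
      opPPlus Ω ⟨hΩ.sigmaNu w, h⟩ = (1 / 2 : ℂ) • hΩ.sigmaNu w + Complex.I • opW Ω w := by
  have h1 := hΩ.mem_domain_opSigmaNu (hΩ.sigmaNu w)
  have e : opSigmaNu Ω ⟨hΩ.sigmaNu w, h1⟩ = w := by
    rw [hΩ.opSigmaNu_apply, hΩ.sigmaNu_sigmaNu]
  have h2 : opSigmaNu Ω ⟨hΩ.sigmaNu w, h1⟩ ∈ (opW Ω).domain := by rw [e]; exact w.2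
  have hm : hΩ.sigmaNu w ∈ (opMul (opW Ω) (opSigmaNu Ω)).domain := mem_domain_opMul_iff.2 ⟨h1, h2⟩
  refine ⟨⟨trivial, hm⟩, ?_⟩
  have e2 : opMul (opW Ω) (opSigmaNu Ω) ⟨hΩ.sigmaNu w, hm⟩ = opW Ω w := by
    rw [opMul_apply _ h1 h2]
    congr 1
    exact Subtype.ext e
  rw [← e2]
  rfl

theorem mem_domain_opW_of_mem_domain_opPPlus (hΩ : IsBoundedC1Domain Ω) {u : BoundaryL2 Ω}
    (h : u ∈ (opPPlus Ω).domain) : hΩ.sigmaNu u ∈ (opW Ω).domain := by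
  have h' : u ∈ (opMul (opW Ω) (opSigmaNu Ω)).domain := h.2
  obtain ⟨h1, h2⟩ := mem_domain_opMul_iff.1 h'
  rwa [hΩ.opSigmaNu_apply] at h2

/-- The unitary involution σ·ν maps the dense domain of P_+ into dom W_m, so a vector orthogonal to
dom W_m has an image orthogonal to dom P_+. -/
theorem dense_domain_opW (hΩ : IsBoundedC1Domain Ω) (h : IsSelfAdjoint (opPPlus Ω)) :
    Dense ((opW Ω).domain : Set (BoundaryL2 Ω)) := by
  rw [Submodule.dense_iff_topologicalClosure_eq_top, Submodule.topologicalClosure_eq_top_iff,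
    Submodule.eq_bot_iff]
  intro v hv
  rw [Submodule.mem_orthogonal] at hv
  have h0 : hΩ.sigmaNu v = 0 := by
    refine h.dense_domain.eq_zero_of_inner_right (𝕜 := ℂ) fun w hw => ?_
    rw [← hΩ.inner_sigmaNu_left]
    exact hv _ (hΩ.mem_domain_opW_of_mem_domain_opPPlus hw)
  rw [← hΩ.sigmaNu_sigmaNu v, h0]
  refine Lp.ext ?_
  filter_upwards [hΩ.coeFn_sigmaNu 0, Lp.coeFn_zero Spinor 2 (surfaceMeasure Ω)] with x h1 h2
  rw [h1, h2]
  simp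

/-- Symmetry of P_+ on (σ·ν)a and (σ·ν)b; the contributions of the symmetric term 1/2 cancel. -/
theorem inner_opW_sigmaNu (hΩ : IsBoundedC1Domain Ω) (h : IsSelfAdjoint (opPPlus Ω))
    (a b : (opW Ω).domain) :
    inner ℂ (Complex.I • opW Ω a) (hΩ.sigmaNu b) =
      inner ℂ (hΩ.sigmaNu a) (Complex.I • opW Ω b) := by
  obtain ⟨ha, ea⟩ := hΩ.apply_opPPlus a
  obtain ⟨hb, eb⟩ := hΩ.apply_opPPlus b
  have := LinearPMap.inner_apply_left_of_isSelfAdjoint h ⟨_, ha⟩ ⟨_, hb⟩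
  rw [ea, eb, inner_add_left, inner_add_right] at this
  have hc : (starRingEnd ℂ) (1 / 2) = 1 / 2 := by
    rw [map_div₀, map_one, map_ofNat]
  rw [inner_smul_left _ _ (1 / 2 : ℂ), inner_smul_right _ _ (1 / 2 : ℂ), hc] at this
  exact add_left_cancel this

theorem aestronglyMeasurable_offPotential {μ : Measure E3} [SFinite μ] {u : E3 → Spinor}
    (hu : AEStronglyMeasurable u μ) (q : E3) (δ : ℝ) :
    AEStronglyMeasurable (offPotential μ (cutoff q δ) u) μ := by
  have h1 : Continuous (cutoff q δ) := (lipschitzWith_cutoff q δ).continuous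
  have h2 : Continuous fun p : E3 × E3 => cutoff q δ p.2 := by fun_prop
  have hprod : AEStronglyMeasurable (fun p : E3 × E3 =>
      kernelW (p.1 - p.2) (cutoff q δ p.2 • u p.2)) (μ.prod μ) :=
    aestronglyMeasurable_clm_apply (StronglyMeasurable.aestronglyMeasurable
      (stronglyMeasurable_kernelW.comp_measurable (by fun_prop)))
      (h2.aestronglyMeasurable.smul hu.comp_snd)
  exact (AEStronglyMeasurable.integral_prod_right' hprod).const_smul ((4 * Real.pi)⁻¹ : ℝ)

theorem norm_offPotential_le {μ : Measure E3} {u : E3 → Spinor} (hu : Integrable u μ)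
    {p q : E3} {δ : ℝ} (hδ : 0 < δ) (hpq : 4 * δ ≤ dist p q) {x : E3}
    (hx : x ∈ Metric.ball p δ) :
    ‖offPotential μ (cutoff q δ) u x‖ ≤
      (4 * Real.pi)⁻¹ * ((δ ^ 2)⁻¹ * δ * ∫ y, ‖u y‖ ∂μ) := by
  have hpi := Real.pi_pos
  rw [offPotential, norm_smul, Real.norm_of_nonneg (by positivity), ← integral_const_mul]
  gcongr
  exact norm_integral_le_of_norm_le (hu.norm.const_mul _) (Eventually.of_forall fun y =>
    norm_kernelW_smul_le hδ (abs_cutoff_le q hδ.le y) (le_norm_sub_of_cutoff_ne_zero hpq hx) _)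

/-- Fubini for the off-diagonal part of `W_m`. -/
theorem integral_inner_offPotential (hΩ : IsBoundedC1Domain Ω) {u v : E3 → Spinor}
    (hu : Integrable u (surfaceMeasure Ω)) (hv : Integrable v (surfaceMeasure Ω)) {p q : E3} {δ : ℝ}
    (hδ : 0 < δ) (hpq : 4 * δ ≤ dist p q) :
    ∫ y, inner ℂ (cutoff q δ y • u y)
        (Complex.I • offPotential (surfaceMeasure Ω) (cutoff p δ) v y) ∂surfaceMeasure Ω =
      ∫ x, inner ℂ (-(Complex.I • offPotential (surfaceMeasure Ω) (cutoff q δ) u x))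
        (cutoff p δ x • v x) ∂surfaceMeasure Ω := by
  have := hΩ.isFiniteMeasure_surfaceMeasure
  set μ := surfaceMeasure Ω
  set φ := cutoff q δ with hφ
  set ψ := cutoff p δ with hψ
  have hφc : Continuous φ := (lipschitzWith_cutoff q δ).continuous
  have hψc : Continuous ψ := (lipschitzWith_cutoff p δ).continuous
  have hqp : 4 * δ ≤ dist q p := by rwa [dist_comm]
  set F : E3 → E3 → ℂ := fun y x => inner ℂ (φ y • u y) (kernelW (y - x) (ψ x • v x)) with hF
  have hF' : ∀ y x, F y x = inner ℂ (kernelW (x - y) (φ y • u y)) (ψ x • v x) := by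
    intro y x
    rw [inner_kernelW_left, neg_sub]
  -- The two cut-offs have separated supports, on which the kernel is bounded; integrability of u
  -- and v suffices for Fubini.
  have hFi : Integrable (Function.uncurry F) (μ.prod μ) := by
    refine Integrable.mono' (g := fun z : E3 × E3 => (δ ^ 2)⁻¹ * δ * δ * (‖u z.1‖ * ‖v z.2‖))
      ((hu.norm.mul_prod hv.norm).const_mul _) ?_ (Eventually.of_forall fun z => ?_)
    · have h1 : Continuous fun p : E3 × E3 => φ p.1 := by fun_prop
      have h2 : Continuous fun p : E3 × E3 => ψ p.2 := by fun_prop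
      refine AEStronglyMeasurable.inner (h1.aestronglyMeasurable.smul hu.1.comp_fst)
        (aestronglyMeasurable_clm_apply (StronglyMeasurable.aestronglyMeasurable
        (stronglyMeasurable_kernelW.comp_measurable (by fun_prop)))
        (h2.aestronglyMeasurable.smul hv.1.comp_snd))
    · simp only [Function.uncurry, hF]
      refine (norm_inner_le_norm _ _).trans ?_
      rcases eq_or_ne (φ z.1) 0 with h0 | h0
      · rw [h0, zero_smul, norm_zero, zero_mul]; positivity
      have hz : z.1 ∈ Metric.ball q δ := dist_lt_of_cutoff_ne_zero h0
      have h3 := norm_kernelW_smul_le (x := z.1) (y := z.2) hδ (abs_cutoff_le p hδ.le z.2)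
        (le_norm_sub_of_cutoff_ne_zero hqp hz) (v z.2)
      rw [norm_smul, Real.norm_eq_abs]
      calc |φ z.1| * ‖u z.1‖ * ‖kernelW (z.1 - z.2) (ψ z.2 • v z.2)‖
          ≤ δ * ‖u z.1‖ * ((δ ^ 2)⁻¹ * δ * ‖v z.2‖) := by
            gcongr
            exact abs_cutoff_le q hδ.le z.1
        _ = _ := by ring
  have hL : ∀ y, inner ℂ (φ y • u y) (Complex.I • offPotential μ ψ v y) =
      Complex.I * ((4 * Real.pi)⁻¹ : ℝ) * ∫ x, F y x ∂μ := by
    intro y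
    rcases eq_or_ne (φ y) 0 with h0 | h0
    · simp [hF, h0]
    have hy : y ∈ Metric.ball q δ := dist_lt_of_cutoff_ne_zero h0
    rw [hF]
    simp only
    rw [integral_inner (integrable_kernelW_cutoff hv hδ hqp hy), offPotential, inner_smul_right,
      ← Complex.coe_smul (4 * Real.pi)⁻¹, inner_smul_right, mul_assoc]
  have hR : ∀ x, inner ℂ (-(Complex.I • offPotential μ φ u x)) (ψ x • v x) =
      Complex.I * ((4 * Real.pi)⁻¹ : ℝ) * ∫ y, F y x ∂μ := by
    intro x
    simp_rw [hF']
    rcases eq_or_ne (ψ x) 0 with h0 | h0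
    · simp [h0]
    have hx : x ∈ Metric.ball p δ := dist_lt_of_cutoff_ne_zero h0
    have e : ∫ y, inner ℂ (kernelW (x - y) (φ y • u y)) (ψ x • v x) ∂μ =
        inner ℂ (∫ y, kernelW (x - y) (φ y • u y) ∂μ) (ψ x • v x) := by
      rw [← inner_conj_symm, ← integral_inner (integrable_kernelW_cutoff hu hδ hpq hx),
        ← integral_conj]
      simp_rw [inner_conj_symm]
      rfl
    rw [e, offPotential, inner_neg_left, inner_smul_left, ← Complex.coe_smul (4 * Real.pi)⁻¹,
      inner_smul_left, Complex.conj_I, Complex.conj_ofReal]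
    ring
  simp_rw [hL, hR]
  rw [integral_const_mul, integral_const_mul, integral_integral_swap hFi]

theorem integrable_inner_cutoff {μ : Measure E3} {A v : E3 → Spinor}
    (hA : AEStronglyMeasurable A μ) (hv : Integrable v μ) {p : E3} {δ M : ℝ} (hδ : 0 ≤ δ)
    (hM : 0 ≤ M) (hb : ∀ᵐ x ∂μ, x ∈ Metric.ball p δ → ‖A x‖ ≤ M) :
    Integrable (fun x => inner ℂ (A x) (cutoff p δ x • v x)) μ := by
  refine (hv.norm.const_mul (M * δ)).mono' (hA.inner
    ((lipschitzWith_cutoff p δ).continuous.aestronglyMeasurable.smul hv.1)) ?_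
  filter_upwards [hb] with x hx
  refine (norm_inner_le_norm _ _).trans ?_
  rw [norm_smul, Real.norm_eq_abs, ← mul_assoc]
  rcases eq_or_ne (cutoff p δ x) 0 with h0 | h0
  · rw [h0, abs_zero, mul_zero, zero_mul]; positivity
  gcongr
  · exact hx (dist_lt_of_cutoff_ne_zero h0)
  · exact abs_cutoff_le p hδ x

theorem integral_inner_cutoff_eq_zero {μ : Measure E3} {A B v : E3 → Spinor}
    (hA : AEStronglyMeasurable A μ) (hB : AEStronglyMeasurable B μ) (hv : Integrable v μ)
    {p : E3} {δ M : ℝ} (hδ : 0 ≤ δ) (hM : 0 ≤ M)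
    (hbA : ∀ᵐ x ∂μ, x ∈ Metric.ball p δ → ‖A x‖ ≤ M)
    (hbB : ∀ᵐ x ∂μ, x ∈ Metric.ball p δ → ‖B x‖ ≤ M)
    (h : ∫ x, inner ℂ (Complex.I • A x) (cutoff p δ x • v x) ∂μ =
      ∫ x, inner ℂ (-(Complex.I • B x)) (cutoff p δ x • v x) ∂μ) :
    ∫ x, inner ℂ (cutoff p δ x • (A x + B x)) (v x) ∂μ = 0 := by
  have h1 : ∀ x, inner ℂ (Complex.I • A x) (cutoff p δ x • v x) =
      -Complex.I * inner ℂ (A x) (cutoff p δ x • v x) := fun x => by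
    rw [inner_smul_left, Complex.conj_I]
  have h2 : ∀ x, inner ℂ (-(Complex.I • B x)) (cutoff p δ x • v x) =
      Complex.I * inner ℂ (B x) (cutoff p δ x • v x) := fun x => by
    rw [inner_neg_left, inner_smul_left, Complex.conj_I, neg_mul, neg_neg]
  have h3 : ∀ x, inner ℂ (cutoff p δ x • (A x + B x)) (v x) =
      inner ℂ (A x) (cutoff p δ x • v x) + inner ℂ (B x) (cutoff p δ x • v x) := fun x => by
    rw [← inner_add_left, ← Complex.coe_smul, ← Complex.coe_smul, inner_smul_left,
      inner_smul_right, Complex.conj_ofReal]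
  simp_rw [h1, h2] at h
  simp_rw [h3]
  rw [integral_const_mul, integral_const_mul] at h
  rw [integral_add (integrable_inner_cutoff hA hv hδ hM hbA)
    (integrable_inner_cutoff hB hv hδ hM hbB)]
  have hI : Complex.I ≠ 0 := Complex.I_ne_zero
  apply mul_left_cancel₀ hI
  rw [mul_add, ← h, mul_zero]
  ring

/-- Localisation inside dom W_m. It is needed because self-adjointness yields a dense domain, not an
everywhere defined W_m. -/
theorem exists_domain_opW_cutoff (hΩ : IsBoundedC1Domain Ω) {u : BoundaryL2 Ω}
    (hu : u ∈ (opW Ω).domain) (q : E3) {δ : ℝ} (hδ : 0 < δ) :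
    ∃ w : (opW Ω).domain,
      (w : BoundaryL2 Ω) =ᵐ[surfaceMeasure Ω] fun y => cutoff q δ y • u y := by
  obtain ⟨v, hv⟩ := mem_domain_opW_iff.1 hu
  obtain ⟨w, hw⟩ := hΩ.exists_hasPrincipalValue_smul hv (lipschitzWith_cutoff q δ)
    (abs_cutoff_le q hδ.le)
  have hae := (memLp_cutoff u q hδ.le).coeFn_toLp
  exact ⟨⟨_, mem_domain_opW_iff.2 ⟨w, hw.mono fun x hx => hx.congr hae.symm⟩⟩, hae⟩

/-- The symmetry relation is applied to u cut off near q and v cut off near p. Each W_m is then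
evaluated only off the support of its argument, and Fubini moves the operator from v to (σ·ν)u. -/
theorem integral_inner_offPotential_of_isSelfAdjoint (hΩ : IsBoundedC1Domain Ω)
    (h : IsSelfAdjoint (opPPlus Ω)) {p q : E3} {δ : ℝ} (hδ : 0 < δ) (hpq : 4 * δ ≤ dist p q)
    {u v : BoundaryL2 Ω} (hu : u ∈ (opW Ω).domain) (hv : v ∈ (opW Ω).domain) :
    ∫ x, inner ℂ (Complex.I • sigmaAct (outwardNormal Ω x)
        (offPotential (surfaceMeasure Ω) (cutoff q δ) u x))
          (cutoff p δ x • v x) ∂surfaceMeasure Ω =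
      ∫ x, inner ℂ (-(Complex.I • offPotential (surfaceMeasure Ω) (cutoff q δ)
          (fun y => sigmaAct (outwardNormal Ω y) (u y)) x)) (cutoff p δ x • v x)
          ∂surfaceMeasure Ω := by
  have := hΩ.isFiniteMeasure_surfaceMeasure
  have hqp : 4 * δ ≤ dist q p := by rwa [dist_comm]
  have huI : Integrable u (surfaceMeasure Ω) := Lp_integrable hΩ u
  have hvI : Integrable v (surfaceMeasure Ω) := Lp_integrable hΩ v
  obtain ⟨a, ha⟩ := hΩ.exists_domain_opW_cutoff hu q hδ
  obtain ⟨b, hb⟩ := hΩ.exists_domain_opW_cutoff hv p hδ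
  have hsym := hΩ.inner_opW_sigmaNu h a b
  rw [L2.inner_def, L2.inner_def] at hsym
  rw [← hΩ.integral_inner_offPotential (hΩ.integrable_sigmaNu huI) hvI hδ hpq]
  refine Eq.trans ?_ (hsym.trans ?_)
  · refine integral_congr_ae ?_
    filter_upwards [hΩ.coeFn_sigmaNu b, hb, Lp.coeFn_smul Complex.I (opW Ω a),
      opW_cutoff huI hδ hpq a ha] with x h1 h2 h3 h4
    rw [h1, h2, h3, Pi.smul_apply]
    rcases eq_or_ne (cutoff p δ x) 0 with h0 | h0
    · simp [h0]
    rw [h4 (dist_lt_of_cutoff_ne_zero h0), ← inner_sigmaAct_left, map_smul]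
  · refine integral_congr_ae ?_
    filter_upwards [hΩ.coeFn_sigmaNu a, ha, Lp.coeFn_smul Complex.I (opW Ω b),
      opW_cutoff hvI hδ hqp b hb] with y h1 h2 h3 h4
    rw [h1, h2, h3, Pi.smul_apply]
    rcases eq_or_ne (cutoff q δ y) 0 with h0 | h0
    · simp [h0]
    rw [h4 (dist_lt_of_cutoff_ne_zero h0), ← Complex.coe_smul, map_smul, Complex.coe_smul]

theorem _root_.ae_eq_zero_of_dense_integral {μ : Measure E3} {D : Set (Lp Spinor 2 μ)}
    (hD : Dense D) {g : E3 → Spinor} (hg : MemLp g 2 μ)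
    (h : ∀ v ∈ D, ∫ x, inner ℂ (g x) (v x) ∂μ = 0) : g =ᵐ[μ] 0 := by
  have hg0 : hg.toLp = 0 := by
    refine hD.eq_zero_of_inner_left (𝕜 := ℂ) fun v hv => ?_
    rw [L2.inner_def, ← h v hv]
    exact integral_congr_ae (hg.coeFn_toLp.mono fun x hx => by simp only [hx])
  filter_upwards [hg.coeFn_toLp, Lp.coeFn_zero Spinor 2 μ] with x h1 h2
  rw [← h1, hg0, h2]

theorem _root_.memLp_cutoff_smul {μ : Measure E3} [IsFiniteMeasure μ] {A : E3 → Spinor}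
    (hA : AEStronglyMeasurable A μ) {p : E3} {δ M : ℝ} (hδ : 0 ≤ δ) (hM : 0 ≤ M)
    (hb : ∀ᵐ x ∂μ, x ∈ Metric.ball p δ → ‖A x‖ ≤ M) :
    MemLp (fun x => cutoff p δ x • A x) 2 μ := by
  refine MemLp.of_bound ((lipschitzWith_cutoff p δ).continuous.aestronglyMeasurable.smul hA)
    (δ * M) ?_
  filter_upwards [hb] with x hx
  rw [norm_smul, Real.norm_eq_abs]
  rcases eq_or_ne (cutoff p δ x) 0 with h0 | h0
  · rw [h0, abs_zero, zero_mul]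
    positivity
  gcongr
  · exact abs_cutoff_le p hδ x
  · exact hx (dist_lt_of_cutoff_ne_zero h0)

/-- Symmetry says weakly that W_m and σ·ν anticommute off the diagonal: the localised sum is
orthogonal to the dense domain of W_m, hence zero almost everywhere near p. -/
theorem kernel_identity_of_isSelfAdjoint (hΩ : IsBoundedC1Domain Ω)
    (h : IsSelfAdjoint (opPPlus Ω)) {p q : E3} (hp : p ∈ frontier Ω)
    (hq : q ∈ frontier Ω) (hne : p ≠ q) (ξ : Spinor) :
    sigmaAct (outwardNormal Ω p) (kernelW (p - q) ξ) +
      kernelW (p - q) (sigmaAct (outwardNormal Ω q) ξ) = 0 := by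
  have := hΩ.isFiniteMeasure_surfaceMeasure
  have hdist : 0 < dist p q := dist_pos.2 hne
  obtain ⟨δ, hδ, hpq⟩ : ∃ δ > 0, 4 * δ ≤ dist p q := ⟨dist p q / 4, by positivity, by linarith⟩
  refine hΩ.kernel_identity_of_dense hp hq hδ hpq (hΩ.dense_domain_opW h) (fun u hu => ?_) ξ
  have huI : Integrable u (surfaceMeasure Ω) := Lp_integrable hΩ u
  have hNuI := hΩ.integrable_sigmaNu huI
  have hpi := Real.pi_pos
  obtain ⟨M, hM, hbA, hbB⟩ : ∃ M : ℝ, 0 ≤ M ∧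
      (∀ᵐ x ∂surfaceMeasure Ω, x ∈ Metric.ball p δ → ‖sigmaAct (outwardNormal Ω x)
        (offPotential (surfaceMeasure Ω) (cutoff q δ) u x)‖ ≤ M) ∧
      (∀ᵐ x ∂surfaceMeasure Ω, x ∈ Metric.ball p δ → ‖offPotential (surfaceMeasure Ω) (cutoff q δ)
          (fun y => sigmaAct (outwardNormal Ω y) (u y)) x‖ ≤ M) := by
    refine ⟨(4 * Real.pi)⁻¹ * ((δ ^ 2)⁻¹ * δ * ∫ y, ‖u y‖ ∂surfaceMeasure Ω) +
      (4 * Real.pi)⁻¹ * ((δ ^ 2)⁻¹ * δ *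
        ∫ y, ‖sigmaAct (outwardNormal Ω y) (u y)‖ ∂surfaceMeasure Ω), by positivity, ?_, ?_⟩
    · filter_upwards [ae_mem_frontier Ω] with x hx hxb
      rw [hΩ.norm_sigmaNu_apply hx]
      exact (norm_offPotential_le huI hδ hpq hxb).trans (le_add_of_nonneg_right (by positivity))
    · refine Eventually.of_forall fun x hxb => ?_
      exact (norm_offPotential_le hNuI hδ hpq hxb).trans (le_add_of_nonneg_left (by positivity))
  have hAm := hΩ.aestronglyMeasurable_sigmaNu (aestronglyMeasurable_offPotential huI.1 q δ)
  have hBm := aestronglyMeasurable_offPotential hNuI.1 q δ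
  have hL := memLp_cutoff_smul (hAm.add hBm) hδ.le (add_nonneg hM hM) (p := p)
    (by filter_upwards [hbA, hbB] with x h1 h2 hx
        exact (norm_add_le _ _).trans (add_le_add (h1 hx) (h2 hx)))
  have h0 := ae_eq_zero_of_dense_integral (hΩ.dense_domain_opW h) hL fun v hv =>
    integral_inner_cutoff_eq_zero hAm hBm (Lp_integrable hΩ v) hδ.le hM hbA hbB
      (hΩ.integral_inner_offPotential_of_isSelfAdjoint h hδ hpq hu hv)
  filter_upwards [h0] with x hx hxb
  exact (smul_eq_zero.1 hx).resolve_left (cutoff_pos_iff.2 hxb).ne'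

end IsBoundedC1Domain

/-! ### Rigidity: the kernel identity forces a ball -/

theorem sigmaAct_injective {a b : E3} (h : sigmaAct a = sigmaAct b) : a = b := by
  have h1 := sigmaAct_mul_self (a - b)
  rw [sigmaAct_sub, h, sub_self, zero_mul] at h1
  have h2 := congrArg (fun T : Spinor →L[ℂ] Spinor => T (EuclideanSpace.single 0 1)) h1
  have h3 : ((‖a - b‖ ^ 2 : ℝ) : ℂ) = 0 := by
    have := congrArg (fun ξ : Spinor => ξ 0) h2
    simpa using this.symm
  rw [Complex.ofReal_eq_zero] at h3
  exact sub_eq_zero.1 (norm_eq_zero.1 (pow_eq_zero_iff two_ne_zero |>.1 h3))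

theorem exists_orthogonal_ne_zero (a : E3) : ∃ e : E3, e ≠ 0 ∧ inner ℝ e a = 0 := by
  by_cases h : a 0 = 0 ∧ a 1 = 0
  · refine ⟨EuclideanSpace.single 0 1, by simp, ?_⟩
    rw [inner_eq_sum_three]
    simp [h.1]
  · refine ⟨!₂[-a 1, a 0, 0], fun h0 => h ⟨?_, ?_⟩, ?_⟩
    · simpa using congrArg (fun v : E3 => v 1) h0
    · simpa using congrArg (fun v : E3 => v 0) h0
    · rw [inner_eq_sum_three]
      simp
      ring

/-- The commutation relation between `σ·a` and two vectors means that they are mirror images. -/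
theorem sub_eq_smul_of_sigmaAct_mul {a n m : E3} (ha : a ≠ 0)
    (h : sigmaAct n * sigmaAct a + sigmaAct a * sigmaAct m = 0) :
    n - m = (-(2 * inner ℝ a m) / ‖a‖ ^ 2) • a := by
  have ha' : ‖a‖ ^ 2 ≠ 0 := by simpa using ha
  -- The hypothesis turns the product into minus an anticommutator, a scalar. Multiplying by σ_a
  -- once more and using σ_a² = |a|² isolates n - m.
  have h1 : sigmaAct (n - m) * sigmaAct a = -(((2 * inner ℝ a m : ℝ) : ℂ) • 1) := by
    rw [← sigmaAct_mul_add_mul, sigmaAct_sub, sub_mul, eq_neg_of_add_eq_zero_left h]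
    abel
  have h2 : sigmaAct (‖a‖ ^ 2 • (n - m)) = sigmaAct (-(2 * inner ℝ a m) • a) := by
    have h3 := congrArg (· * sigmaAct a) h1
    simp only [mul_assoc] at h3
    rw [sigmaAct_mul_self, mul_smul_comm, mul_one] at h3
    rw [sigmaAct_smul, sigmaAct_smul]
    ext ξ : 1
    have h4 := congrArg (fun T : Spinor →L[ℂ] Spinor => T ξ) h3
    simp only [smul_apply, neg_apply,
      mul_apply_eq_comp, one_apply_eq_self, Complex.coe_smul] at h4 ⊢
    rw [h4, neg_smul]
  have h3 := sigmaAct_injective h2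
  rw [div_eq_inv_mul, mul_smul, ← h3, smul_smul, inv_mul_cancel₀ ha', one_smul]

namespace IsBoundedC1Domain

variable {Ω : Set E3}

theorem exists_ray_mem_frontier (hΩ : IsBoundedC1Domain Ω) {x d : E3} (hx : x ∈ Ω) (hd : d ≠ 0) :
    ∃ t : ℝ, 0 ≤ t ∧ x + t • d ∈ frontier Ω := by
  obtain ⟨M, hM⟩ := hΩ.isBounded.exists_norm_le
  have hs : IsPreconnected ((fun t : ℝ => x + t • d) '' Set.Ici 0) :=
    isPreconnected_Ici.image _ (by fun_prop)
  have hM0 : 0 ≤ M := (norm_nonneg x).trans (hM x hx)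
  have hd' : 0 < ‖d‖ := norm_pos_iff.2 hd
  obtain ⟨y, ⟨t, ht, rfl⟩, hy⟩ := hs.inter_frontier_nonempty (t := Ω)
    ⟨x, ⟨0, by simp, by simp⟩, hx⟩
    ⟨x + ((M + ‖x‖ + 1) / ‖d‖) • d, ⟨_, Set.mem_Ici.2 (by positivity), rfl⟩, fun hmem => by
      have h1 := hM _ hmem
      have h2 := norm_sub_norm_le (((M + ‖x‖ + 1) / ‖d‖) • d) (-x)
      rw [norm_smul, Real.norm_of_nonneg (by positivity), div_mul_cancel₀ _ hd'.ne', norm_neg,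
        sub_neg_eq_add, add_comm _ x] at h2
      linarith⟩
  exact ⟨t, ht, hy⟩

/-- The boundary lies in no plane: the open set Ω has a point off the plane, and a ray from it
parallel to the plane reaches ∂Ω. -/
theorem exists_inner_ne (hΩ : IsBoundedC1Domain Ω) {e : E3} (he : e ≠ 0) (c : ℝ) :
    ∃ r ∈ frontier Ω, inner ℝ e r ≠ c := by
  obtain ⟨x, hx, hxc⟩ : ∃ x ∈ Ω, inner ℝ e x ≠ c := by
    obtain ⟨x, hx⟩ := hΩ.isConnected.nonempty
    by_cases hxc : inner ℝ e x = c
    · have h1 : Tendsto (fun t : ℝ => x + t • e) (𝓝[>] 0) (𝓝 x) := by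
        have : Continuous fun t : ℝ => x + t • e := by fun_prop
        simpa using (this.tendsto 0).mono_left nhdsWithin_le_nhds
      obtain ⟨t, ht, ht0⟩ := ((h1.eventually (hΩ.isOpen.mem_nhds hx)).and
        self_mem_nhdsWithin).exists
      refine ⟨_, ht, ?_⟩
      rw [inner_add_right, inner_smul_right, hxc, real_inner_self_eq_norm_sq]
      have : 0 < t * ‖e‖ ^ 2 := mul_pos ht0 (by positivity)
      linarith
    · exact ⟨x, hx, hxc⟩
  obtain ⟨d, hd, hde⟩ := exists_orthogonal_ne_zero e
  obtain ⟨t, -, ht⟩ := hΩ.exists_ray_mem_frontier hx hd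
  refine ⟨_, ht, ?_⟩
  rwa [inner_add_right, inner_smul_right, real_inner_comm d e, hde, mul_zero, add_zero]

theorem exists_linearIndependent (hΩ : IsBoundedC1Domain Ω) (p : E3) {a : E3} (ha : a ≠ 0) :
    ∃ r ∈ frontier Ω, LinearIndependent ℝ ![a, r - p] := by
  obtain ⟨e, he, hea⟩ := exists_orthogonal_ne_zero a
  obtain ⟨r, hr, hne⟩ := hΩ.exists_inner_ne he (inner ℝ e p)
  refine ⟨r, hr, (LinearIndependent.pair_iff' ha).2 fun t ht => hne ?_⟩
  have : inner ℝ e (r - p) = 0 := by rw [← ht, inner_smul_right, hea, mul_zero]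
  rwa [inner_sub_right, sub_eq_zero] at this

/-- A point of Ω beyond the sphere could be moved radially outwards to a boundary point still
farther away. Conversely, the connected open ball meets Ω but not ∂Ω, so Ω fills it. -/
theorem eq_ball_of_frontier_subset (hΩ : IsBoundedC1Domain Ω) {c : E3} {R : ℝ} (hR : 0 < R)
    (h : frontier Ω ⊆ Metric.sphere c R) : Ω = Metric.ball c R := by
  have h1 : Ω ⊆ Metric.closedBall c R := by
    intro x hx
    by_contra hxR
    rw [Metric.mem_closedBall, not_le, dist_eq_norm] at hxR
    have hne : x - c ≠ 0 := fun h0 => by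
      rw [h0, norm_zero] at hxR
      exact hxR.not_gt hR
    obtain ⟨t, ht, hmem⟩ := hΩ.exists_ray_mem_frontier hx hne
    have h2 := h hmem
    rw [Metric.mem_sphere, dist_eq_norm] at h2
    have e : x + t • (x - c) - c = (1 + t) • (x - c) := by module
    rw [e, norm_smul, Real.norm_of_nonneg (by positivity)] at h2
    nlinarith
  have h2 : Ω ⊆ Metric.ball c R := by
    have := interior_maximal h1 hΩ.isOpen
    rwa [interior_closedBall c hR.ne'] at this
  refine h2.antisymm fun y hy => ?_
  by_contra hyΩ
  obtain ⟨x, hx⟩ := hΩ.isConnected.nonempty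
  obtain ⟨z, hz, hzf⟩ := (convex_ball c R).isPreconnected.inter_frontier_nonempty (t := Ω)
    ⟨x, h2 hx, hx⟩ ⟨y, hy, hyΩ⟩
  have h3 := h hzf
  rw [Metric.mem_sphere] at h3
  rw [Metric.mem_ball] at hz
  exact hz.ne h3

theorem frontier_nonempty (hΩ : IsBoundedC1Domain Ω) : (frontier Ω).Nonempty := by
  obtain ⟨r, hr, -⟩ := hΩ.exists_inner_ne (e := EuclideanSpace.single 0 1) (by simp) 0
  exact ⟨r, hr⟩

/-- A bounded `C¹` domain whose normal differences are parallel to the chords is a ball. -/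
theorem exists_eq_ball_of_normal_sub (hΩ : IsBoundedC1Domain Ω) {l : E3 → E3 → ℝ}
    (hl : ∀ p ∈ frontier Ω, ∀ q ∈ frontier Ω,
      outwardNormal Ω p - outwardNormal Ω q = l p q • (p - q)) (l_ne : ∀ p ∈ frontier Ω,
      ∃ q ∈ frontier Ω, outwardNormal Ω p ≠ outwardNormal Ω q) :
    ∃ (c : E3) (r : ℝ), 0 < r ∧ Ω = Metric.ball c r := by
  -- The three normal differences around a triangle add up to zero, and two sides of it are
  -- independent; this equates the factors.
  have key : ∀ p ∈ frontier Ω, ∀ q ∈ frontier Ω, ∀ r ∈ frontier Ω,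
      LinearIndependent ℝ ![q - p, r - p] → l q p = l r p := by
    intro p hp q hq r hr h
    have h1 : l q p • (q - p) - l r p • (r - p) = l q r • (q - r) := by
      rw [← hl q hq p hp, ← hl r hr p hp, ← hl q hq r hr]
      abel
    have h2 : (l q p - l q r) • (q - p) + (l q r - l r p) • (r - p) = 0 := by
      have e : (l q p - l q r) • (q - p) + (l q r - l r p) • (r - p) =
        l q p • (q - p) - l r p • (r - p) - l q r • (q - r) := by module
      rw [e, h1, sub_self]
    obtain ⟨h3, h4⟩ := LinearIndependent.pair_iff.1 h _ _ h2
    linarith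
  obtain ⟨p, hp⟩ := hΩ.frontier_nonempty
  have hconst : ∃ L : ℝ, ∀ q ∈ frontier Ω, outwardNormal Ω q - outwardNormal Ω p = L • (q - p) := by
    obtain ⟨q₀, hq₀, hne⟩ := l_ne p hp
    have hq₀p : q₀ - p ≠ 0 := fun h0 => hne (by rw [sub_eq_zero.1 h0])
    refine ⟨l q₀ p, fun q hq => ?_⟩
    rw [hl q hq p hp]
    rcases eq_or_ne (q - p) 0 with h0 | h0
    · rw [h0, smul_zero, smul_zero]
    congr 1
    by_cases hli : LinearIndependent ℝ ![q₀ - p, q - p]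
    · exact (key p hp q₀ hq₀ q hq hli).symm
    -- If p, q₀, q are collinear, the two factors are compared through a boundary point s off their
    -- line.
    · rw [LinearIndependent.pair_iff' hq₀p] at hli
      push Not at hli
      obtain ⟨t, ht⟩ := hli
      obtain ⟨s, hs, hsli⟩ := hΩ.exists_linearIndependent p hq₀p
      have hsli' : LinearIndependent ℝ ![q - p, s - p] := by
        have ht0 : t ≠ 0 := by
          rintro rfl
          exact h0 (by rw [← ht, zero_smul])
        rw [LinearIndependent.pair_iff] at hsli ⊢
        intro x y hxy
        rw [← ht, smul_smul] at hxy
        obtain ⟨h1, h2⟩ := hsli _ _ hxy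
        exact ⟨(mul_eq_zero.1 h1).resolve_right ht0, h2⟩
      rw [key p hp q hq s hs hsli', key p hp q₀ hq₀ s hs hsli]
  obtain ⟨L, hL⟩ := hconst
  have hL0 : L ≠ 0 := by
    rintro rfl
    obtain ⟨q, hq, hne⟩ := l_ne p hp
    have := hL q hq
    rw [zero_smul, sub_eq_zero] at this
    exact hne this.symm
  -- The vector ν(q) - Lq does not depend on q, so neither does q - ν(q)/L: this is the centre, at
  -- distance 1/|L| from every boundary point.
  refine ⟨p - L⁻¹ • outwardNormal Ω p, |L|⁻¹, by positivity, ?_⟩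
  refine hΩ.eq_ball_of_frontier_subset (by positivity) fun q hq => ?_
  have e : q - (p - L⁻¹ • outwardNormal Ω p) = L⁻¹ • outwardNormal Ω q := by
    rw [← sub_add_cancel (outwardNormal Ω q) (outwardNormal Ω p), hL q hq, smul_add, smul_smul,
      inv_mul_cancel₀ hL0]
    module
  rw [Metric.mem_sphere, dist_eq_norm, e, norm_smul, hΩ.norm_outwardNormal hq, mul_one, norm_inv,
    Real.norm_eq_abs]

theorem exists_eq_ball_of_kernel_identity (hΩ : IsBoundedC1Domain Ω)
    (h : ∀ p ∈ frontier Ω, ∀ q ∈ frontier Ω, p ≠ q → ∀ ξ : Spinor,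
      sigmaAct (outwardNormal Ω p) (kernelW (p - q) ξ) +
        kernelW (p - q) (sigmaAct (outwardNormal Ω q) ξ) = 0) :
    ∃ (c : E3) (r : ℝ), 0 < r ∧ Ω = Metric.ball c r := by
  have hs : ∀ p ∈ frontier Ω, ∀ q ∈ frontier Ω, outwardNormal Ω p - outwardNormal Ω q =
      (-(2 * inner ℝ (p - q) (outwardNormal Ω q)) / ‖p - q‖ ^ 2) • (p - q) := by
    intro p hp q hq
    rcases eq_or_ne p q with rfl | hne
    · simp
    have hne' : p - q ≠ 0 := sub_ne_zero.2 hne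
    refine sub_eq_smul_of_sigmaAct_mul hne' ?_
    ext ξ : 1
    have h1 := h p hp q hq hne ξ
    rw [kernelW_apply, kernelW_apply, map_smul, ← smul_add, smul_eq_zero] at h1
    refine h1.resolve_left ?_
    simpa using hne'
  refine hΩ.exists_eq_ball_of_normal_sub hs fun p hp => ?_
  -- If all normals agreed with ν(p), every reflection coefficient would vanish and ∂Ω would lie in
  -- the plane through p orthogonal to ν(p).
  by_contra! hcon
  have hn : outwardNormal Ω p ≠ 0 := fun h0 => by
    simpa [h0] using hΩ.norm_outwardNormal hp
  obtain ⟨q, hq, hne⟩ := hΩ.exists_inner_ne hn (inner ℝ (outwardNormal Ω p) p)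
  have h1 := hs p hp q hq
  rw [← hcon q hq, sub_self] at h1
  have hpq : p - q ≠ 0 := fun h0 => hne (by rw [sub_eq_zero.1 h0])
  have h2 := (smul_eq_zero.1 h1.symm).resolve_right hpq
  rw [div_eq_zero_iff, neg_eq_zero] at h2
  have h3 : inner ℝ (p - q) (outwardNormal Ω p) = 0 := by
    rcases h2 with h2 | h2
    · linarith
    · exact absurd h2 (by simpa using hpq)
  rw [real_inner_comm, inner_sub_right, sub_eq_zero] at h3
  exact hne h3.symm

end IsBoundedC1Domain

/-! ### Rotation invariant measures on the unit sphere -/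

/-- Finite rotation invariant measures on the unit sphere. -/
structure IsSphereMeasure (μ : Measure E3) : Prop where
  isFiniteMeasure : IsFiniteMeasure μ
  ae_norm : ∀ᵐ y ∂μ, ‖y‖ = 1
  measurePreserving : ∀ L : E3 ≃ₗᵢ[ℝ] E3, MeasurePreserving L μ μ

namespace IsSphereMeasure

variable {μ : Measure E3}

theorem aestronglyMeasurable (hμ : IsSphereMeasure μ) {F : Type*} [NormedAddCommGroup F]
    {f : E3 → F} (hf : ContinuousOn f (Metric.sphere 0 1)) : AEStronglyMeasurable f μ := by
  have h1 : μ.restrict (Metric.sphere 0 1) = μ := Measure.restrict_eq_self_of_ae_mem <| by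
    filter_upwards [hμ.ae_norm] with y hy
    simpa using hy
  rw [← h1]
  exact hf.aestronglyMeasurable_of_isCompact (isCompact_sphere _ _)
    Metric.isClosed_sphere.measurableSet

theorem integrable (hμ : IsSphereMeasure μ) {F : Type*} [NormedAddCommGroup F]
    {f : E3 → F} (hf : ContinuousOn f (Metric.sphere 0 1)) : Integrable f μ := by
  have := hμ.isFiniteMeasure
  obtain ⟨C, hC⟩ := (isCompact_sphere (0 : E3) 1).exists_bound_of_continuousOn hf
  refine Integrable.of_bound (hμ.aestronglyMeasurable hf) C ?_
  filter_upwards [hμ.ae_norm] with y hy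
  exact hC y (by simpa using hy)

theorem mapsTo_smul {ρ r : ℝ} (hr : |r| < ρ) :
    Set.MapsTo (fun y : E3 => r • y) (Metric.sphere 0 1) (Metric.ball 0 ρ) := by
  intro y hy
  rw [mem_sphere_zero_iff_norm] at hy
  rw [mem_ball_zero_iff, norm_smul, hy, mul_one]
  exact hr

/-- Skew-adjoint linear vector fields are divergence free on the sphere. -/
theorem integral_fderiv_skewAdjoint (hμ : IsSphereMeasure μ) {h : E3 → ℂ} {ρ : ℝ}
    (hh : ContDiffOn ℝ 1 h (Metric.ball 0 ρ)) {r : ℝ} (hr : |r| < ρ) {J : E3 →L[ℝ] E3}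
    (hJ : J ∈ skewAdjoint (E3 →L[ℝ] E3)) :
    ∫ y, fderiv ℝ h (r • y) (J (r • y)) ∂μ = 0 := by
  have := hμ.isFiniteMeasure
  let _ : NormedAlgebra ℚ (E3 →L[ℝ] E3) := NormedAlgebra.restrictScalars ℚ ℝ _
  have hU : ∀ θ : ℝ, NormedSpace.exp (θ • J) ∈ unitary (E3 →L[ℝ] E3) := fun θ =>
    NormedSpace.exp_mem_unitary_of_mem_skewAdjoint (skewAdjoint.smul_mem θ hJ)
  -- The flow of a skew-adjoint J consists of isometries, so the integral of h(r L_θ y) does not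
  -- depend on θ. Its derivative at θ = 0 is the integral in question.
  set L : ℝ → (E3 ≃ₗᵢ[ℝ] E3) := fun θ => Unitary.linearIsometryEquiv ⟨_, hU θ⟩ with hL
  have hLapp : ∀ θ y, L θ y = NormedSpace.exp (θ • J) y := fun θ y => rfl
  have hder : ∀ (θ : ℝ) (y : E3), HasDerivAt (fun θ => L θ y) (J (L θ y)) θ := fun θ y => by
    have h1 := hasDerivAt_exp_smul_const' (𝕂 := ℝ) J θ
    have h2 := (ContinuousLinearMap.apply ℝ E3 y).hasFDerivAt.comp_hasDerivAt θ h1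
    exact h2
  have hfc := hh.continuousOn_fderiv_of_isOpen Metric.isOpen_ball le_rfl
  have hsub : Metric.closedBall (0 : E3) |r| ⊆ Metric.ball 0 ρ := Metric.closedBall_subset_ball hr
  obtain ⟨M, hM⟩ := (isCompact_closedBall (0 : E3) |r|).exists_bound_of_continuousOn
    (hfc.mono hsub)
  have hM0 : 0 ≤ M := (norm_nonneg _).trans (hM 0 (by simp))
  have hnorm : ∀ (θ : ℝ) (y : E3), ‖y‖ = 1 → ‖r • L θ y‖ = |r| := fun θ y hy => by
    rw [norm_smul, LinearIsometryEquiv.norm_map, hy, mul_one, Real.norm_eq_abs]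
  have hmem : ∀ (θ : ℝ) (y : E3), ‖y‖ = 1 → r • L θ y ∈ Metric.ball (0 : E3) ρ := fun θ y hy => by
    rwa [mem_ball_zero_iff, hnorm θ y hy]
  have hmaps : ∀ θ, Set.MapsTo (fun y => r • L θ y) (Metric.sphere 0 1) (Metric.ball 0 ρ) :=
    fun θ y hy => hmem θ y (by simpa using hy)
  have hcontL : ∀ θ, Continuous fun y => r • L θ y := fun θ => by fun_prop
  have key := hasDerivAt_integral_of_dominated_loc_of_deriv_le (μ := μ) (𝕜 := ℝ) (x₀ := 0)
    (F := fun θ y => h (r • L θ y)) (F' := fun θ y => fderiv ℝ h (r • L θ y) (J (r • L θ y)))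
    (s := Set.univ) (bound := fun _ => M * (‖J‖ * |r|)) univ_mem
    (Eventually.of_forall fun θ => hμ.aestronglyMeasurable
      (hh.continuousOn.comp (hcontL θ).continuousOn (hmaps θ)))
    (hμ.integrable (hh.continuousOn.comp (hcontL 0).continuousOn (hmaps 0)))
    (hμ.aestronglyMeasurable ((hfc.comp (hcontL 0).continuousOn (hmaps 0)).clm_apply
      (J.continuous.comp (hcontL 0)).continuousOn))
    (by
      filter_upwards [hμ.ae_norm] with y hy θ _
      refine (ContinuousLinearMap.le_opNorm _ _).trans ?_
      gcongr
      · exact hM _ (by rw [mem_closedBall_zero_iff, hnorm θ y hy])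
      · exact (J.le_opNorm _).trans_eq (by rw [hnorm θ y hy]))
    (integrable_const _)
    (by
      filter_upwards [hμ.ae_norm] with y hy θ _
      have h1 := (hh.differentiableOn one_ne_zero).differentiableAt
        (Metric.isOpen_ball.mem_nhds (hmem θ y hy))
      have h2 := h1.hasFDerivAt.comp_hasDerivAt (f := fun θ => r • L θ y) θ
        ((hder θ y).fun_const_smul r)
      rw [map_smul J r (L θ y)]
      exact h2)
  have hconst : (fun θ => ∫ y, h (r • L θ y) ∂μ) = fun _ => ∫ y, h (r • y) ∂μ := by
    funext θ
    exact (hμ.measurePreserving (L θ)).integral_comp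
      (L θ).toHomeomorph.measurableEmbedding (fun y => h (r • y))
  have h0 : ∀ y, L 0 y = y := fun y => by
    have h1 : NormedSpace.exp ((0 : ℝ) • J) y = y := by
      have e : (0 : ℝ) • J = 0 := zero_smul ℝ J
      rw [e, NormedSpace.exp_zero, one_apply_eq_self]
    exact h1
  have h2 := key.2
  rw [hconst] at h2
  simpa [h0] using (h2.unique (hasDerivAt_const _ _))

/-- The mean over concentric spheres of a function whose radial derivative is, up to a divergence,
`-g`. -/
theorem integral_eq_zero_of_radial (hμ : IsSphereMeasure μ) {g : E3 → ℂ} {ρ : ℝ} (hρ : 1 < ρ)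
    (hg : ContDiffOn ℝ 1 g (Metric.ball 0 ρ))
    (h : ∀ r : ℝ, |r| < ρ → ∫ y, (g (r • y) + fderiv ℝ g (r • y) (r • y)) ∂μ = 0) :
    ∫ y, g y ∂μ = 0 := by
  have := hμ.isFiniteMeasure
  have hfc := hg.continuousOn_fderiv_of_isOpen Metric.isOpen_ball le_rfl
  have hsm : ∀ r : ℝ, Continuous fun y : E3 => r • y := fun r => by fun_prop
  -- The hypothesis is the derivative of r times the integral of g(ry). That product is therefore
  -- constant, and it vanishes at r = 0.
  have hder : ∀ r : ℝ, |r| < ρ → HasDerivAt (fun r : ℝ => ∫ y, (r : ℂ) * g (r • y) ∂μ) 0 r := by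
    intro r hr
    obtain ⟨r', hr1, hr2⟩ := exists_between hr
    have hsub : Metric.closedBall (0 : E3) r' ⊆ Metric.ball 0 ρ := Metric.closedBall_subset_ball hr2
    obtain ⟨M, hM⟩ := (isCompact_closedBall (0 : E3) r').exists_bound_of_continuousOn
      (hfc.mono hsub)
    obtain ⟨M', hM'⟩ := (isCompact_closedBall (0 : E3) r').exists_bound_of_continuousOn
      (hg.continuousOn.mono hsub)
    have key := hasDerivAt_integral_of_dominated_loc_of_deriv_le (μ := μ) (𝕜 := ℝ) (x₀ := r)
      (F := fun r y => (r : ℂ) * g (r • y))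
      (F' := fun r y => g (r • y) + fderiv ℝ g (r • y) (r • y))
      (s := {t | |t| < r'}) (bound := fun _ => M' + M * r')
      ((isOpen_lt continuous_abs continuous_const).mem_nhds hr1)
      (by
        filter_upwards [(isOpen_lt continuous_abs continuous_const).mem_nhds hr] with t ht
        exact (hμ.aestronglyMeasurable (hg.continuousOn.comp (hsm t).continuousOn
          (mapsTo_smul ht))).const_mul _)
      ((hμ.integrable (hg.continuousOn.comp (hsm r).continuousOn (mapsTo_smul hr))).const_mul _)
      (hμ.aestronglyMeasurable ((hg.continuousOn.comp (hsm r).continuousOn (mapsTo_smul hr)).add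
        ((hfc.comp (hsm r).continuousOn (mapsTo_smul hr)).clm_apply (hsm r).continuousOn)))
      (by
        filter_upwards [hμ.ae_norm] with y hy t ht
        have ht' : ‖t • y‖ ≤ r' := by
          rw [norm_smul, hy, mul_one]
          exact (show |t| < r' from ht).le
        have hmem : t • y ∈ Metric.closedBall (0 : E3) r' := by rwa [mem_closedBall_zero_iff]
        refine (norm_add_le _ _).trans (add_le_add (hM' _ hmem) ?_)
        exact (ContinuousLinearMap.le_opNorm _ _).trans
          (mul_le_mul (hM _ hmem) ht' (norm_nonneg _) ((norm_nonneg _).trans (hM _ hmem))))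
      (integrable_const _)
      (by
        filter_upwards [hμ.ae_norm] with y hy t ht
        have hmem : t • y ∈ Metric.ball (0 : E3) ρ := by
          rw [mem_ball_zero_iff, norm_smul, hy, mul_one]
          exact (show |t| < r' from ht).trans hr2
        have h1 := (hg.differentiableOn one_ne_zero).differentiableAt
          (Metric.isOpen_ball.mem_nhds hmem)
        have h2 := h1.hasFDerivAt.comp_hasDerivAt t ((hasDerivAt_id t).smul_const y)
        have h3 := (Complex.ofRealCLM.hasDerivAt (x := t)).mul h2
        refine h3.congr_deriv ?_
        simp)
    rw [h r hr] at key
    exact key.2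
  have hopen : IsOpen (Metric.ball (0 : ℝ) ρ) := Metric.isOpen_ball
  have hmem : ∀ r ∈ Metric.ball (0 : ℝ) ρ, |r| < ρ := fun r hr => by simpa using hr
  have hc := hopen.is_const_of_deriv_eq_zero (convex_ball _ _).isPreconnected
    (fun r hr => (hder r (hmem r hr)).differentiableAt.differentiableWithinAt)
    (fun r hr => (hder r (hmem r hr)).deriv) (x := 1) (y := 0) (by simpa using hρ)
    (by simpa using one_pos.trans hρ)
  simpa using hc

end IsSphereMeasure

/-! ### Cauchy's theorem for monogenic spinor fields on the sphere -/

theorem sigmaAct_apply_zero (a : E3) (ξ : Spinor) :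
    sigmaAct a ξ 0 = (a 2 : ℂ) * ξ 0 + ((a 0 : ℂ) - Complex.I * a 1) * ξ 1 := by
  simp [sigmaAct, sigmaDot, Matrix.ofLp_toEuclideanCLM, Matrix.mulVec, dotProduct, Fin.sum_univ_two]
  ring_nf
  tauto

theorem sigmaAct_apply_one (a : E3) (ξ : Spinor) :
    sigmaAct a ξ 1 = ((a 0 : ℂ) + Complex.I * a 1) * ξ 0 - (a 2 : ℂ) * ξ 1 := by
  simp [sigmaAct, sigmaDot, Matrix.ofLp_toEuclideanCLM, Matrix.mulVec, dotProduct, Fin.sum_univ_two]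
  ring

theorem inner_spinor (ξ η : Spinor) :
    inner ℂ ξ η = (starRingEnd ℂ) (ξ 0) * η 0 + (starRingEnd ℂ) (ξ 1) * η 1 := by
  simp [PiLp.inner_apply, Fin.sum_univ_two, mul_comm]

/-- The `k`-th standard basis vector. -/
noncomputable abbrev basisE3 (k : Fin 3) : E3 := EuclideanSpace.single k 1

/-- The cross product with a fixed vector. -/
noncomputable def crossCLM (e : E3) : E3 →L[ℝ] E3 :=
  LinearMap.toContinuousLinearMap
    { toFun := fun z => !₂[e 1 * z 2 - e 2 * z 1, e 2 * z 0 - e 0 * z 2, e 0 * z 1 - e 1 * z 0]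
      map_add' := fun a b => by
        ext i
        fin_cases i <;> simp <;> ring
      map_smul' := fun c a => by
        ext i
        fin_cases i <;> simp <;> ring }

theorem crossCLM_apply (e z : E3) : crossCLM e z =
    !₂[e 1 * z 2 - e 2 * z 1, e 2 * z 0 - e 0 * z 2, e 0 * z 1 - e 1 * z 0] := rfl

theorem crossCLM_mem_skewAdjoint (e : E3) : crossCLM e ∈ skewAdjoint (E3 →L[ℝ] E3) := by
  rw [skewAdjoint.mem_iff, ContinuousLinearMap.star_eq_adjoint, eq_comm,
    ContinuousLinearMap.eq_adjoint_iff]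
  intro x y
  rw [inner_eq_sum_three, inner_eq_sum_three, neg_apply]
  simp [crossCLM_apply]
  ring

/-- The Dirac operator `∑ σ_k ∂_k`, as a function of the derivative. -/
noncomputable def diracSymbol (T : E3 →L[ℝ] Spinor) : Spinor :=
  sigmaAct (basisE3 0) (T (basisE3 0)) + sigmaAct (basisE3 1) (T (basisE3 1)) +
    sigmaAct (basisE3 2) (T (basisE3 2))

theorem eq_sum_basisE3 (y : E3) : y = y 0 • basisE3 0 + y 1 • basisE3 1 + y 2 • basisE3 2 := by
  ext i
  fin_cases i <;> simp

/-- `σ·a`, as a real bilinear map. -/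
noncomputable def sigmaBilin : E3 →L[ℝ] Spinor →L[ℝ] Spinor :=
  (ContinuousLinearMap.restrictScalarsL ℂ Spinor Spinor ℝ ℝ).comp sigmaCLM

/-- The endomorphism T will be 1 for the radial derivative and σ_k for the rotational ones. -/
theorem hasFDerivAt_inner_sigmaAct {U V : E3 → Spinor} {U' V' : E3 →L[ℝ] Spinor} {y : E3}
    (hU : HasFDerivAt U U' y) (hV : HasFDerivAt V V' y) (T : Spinor →L[ℂ] Spinor) :
    ∃ L : E3 →L[ℝ] ℂ, HasFDerivAt (fun y => inner ℂ (U y) (T (sigmaAct y (V y)))) L y ∧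
      ∀ w, L w = inner ℂ (U y) (T (sigmaAct w (V y) + sigmaAct y (V' w))) +
        inner ℂ (U' w) (T (sigmaAct y (V y))) := by
  have h1 : HasFDerivAt (fun y => sigmaBilin y (V y))
      (((sigmaBilin y).comp V') + sigmaBilin.flip (V y)) y := sigmaBilin.hasFDerivAt.clm_apply hV
  have h2 : HasFDerivAt (fun y => T (sigmaAct y (V y))) ((T.restrictScalars ℝ).comp _) y :=
    (T.restrictScalars ℝ).hasFDerivAt.comp y h1
  refine ⟨_, hU.inner ℂ h2, fun w => ?_⟩
  change inner ℂ (U y) (T (sigmaAct y (V' w) + sigmaAct w (V y))) + inner ℂ (U' w) (T (sigmaAct y (V y))) = _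
  rw [add_comm (sigmaAct y (V' w))]

/-- The algebraic core of Cauchy's theorem. For monogenic U and V, the derivative of r times the
pairing along a ray is a sum of derivatives along the rotation fields e_k × y, and these integrate
to zero over spheres. -/
theorem inner_sigmaAct_divergence (U V : Spinor) (U' V' : E3 →L[ℝ] Spinor) (y : E3)
    (hU : diracSymbol U' = 0) (hV : diracSymbol V' = 0) (D : (Spinor →L[ℂ] Spinor) → E3 → ℂ)
    (hD : ∀ T w, D T w = inner ℂ U (T (sigmaAct w V + sigmaAct y (V' w))) +
      inner ℂ (U' w) (T (sigmaAct y V))) :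
    inner ℂ U (sigmaAct y V) + D 1 y =
      Complex.I * (D (sigmaAct (basisE3 0)) (crossCLM (basisE3 0) y) +
        D (sigmaAct (basisE3 1)) (crossCLM (basisE3 1) y) +
        D (sigmaAct (basisE3 2)) (crossCLM (basisE3 2) y)) := by
  have c0 : crossCLM (basisE3 0) y = y 1 • basisE3 2 - y 2 • basisE3 1 := by
    ext i
    fin_cases i <;> simp [crossCLM_apply]
  have c1 : crossCLM (basisE3 1) y = y 2 • basisE3 0 - y 0 • basisE3 2 := by
    ext i
    fin_cases i <;> simp [crossCLM_apply]
  have c2 : crossCLM (basisE3 2) y = y 0 • basisE3 1 - y 1 • basisE3 0 := by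
    ext i
    fin_cases i <;> simp [crossCLM_apply]
  have cU : U' y = y 0 • U' (basisE3 0) + y 1 • U' (basisE3 1) + y 2 • U' (basisE3 2) := by
    conv_lhs => rw [eq_sum_basisE3 y]
    simp only [map_add, map_smul]
  have cV : V' y = y 0 • V' (basisE3 0) + y 1 • V' (basisE3 1) + y 2 • V' (basisE3 2) := by
    conv_lhs => rw [eq_sum_basisE3 y]
    simp only [map_add, map_smul]
  have hU0 := congrArg (fun ξ : Spinor => (starRingEnd ℂ) (ξ 0)) hU
  have hU1 := congrArg (fun ξ : Spinor => (starRingEnd ℂ) (ξ 1)) hU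
  have hV0 := congrArg (fun ξ : Spinor => ξ 0) hV
  have hV1 := congrArg (fun ξ : Spinor => ξ 1) hV
  simp only [hD, c0, c1, c2, map_sub, map_smul, cU, cV]
  simp only [diracSymbol, inner_spinor, sigmaAct_apply_zero, sigmaAct_apply_one, PiLp.add_apply,
    PiLp.sub_apply, PiLp.smul_apply, one_apply_eq_self, PiLp.zero_apply] at *
  simp only [map_add, map_sub, map_mul, map_zero, Complex.conj_I, Complex.conj_ofReal, basisE3,
    PiLp.single_apply, Complex.real_smul, smul_eq_mul] at *
  simp only [Fin.isValue, Fin.reduceEq, if_true, if_false, Complex.ofReal_zero, Complex.ofReal_one,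
    mul_zero, mul_one, zero_mul, one_mul, sub_zero, zero_sub, add_zero, zero_add,
    Complex.ofReal_neg] at *
  -- The two sides differ by |y|² times the pairings of U and V with the two Dirac equations; what
  -- remains after that only needs i² = -1.
  linear_combination (norm := skip)
    ((y 0 : ℂ) ^ 2 + (y 1 : ℂ) ^ 2 + (y 2 : ℂ) ^ 2) * ((starRingEnd ℂ) (U 0) * hV0 +
      (starRingEnd ℂ) (U 1) * hV1 + V 0 * hU0 + V 1 * hU1)
  ring_nf
  simp only [Complex.I_sq, Complex.I_pow_three]
  ring

theorem contDiffOn_inner_sigmaAct {U V : E3 → Spinor} {s : Set E3} (hU : ContDiffOn ℝ 1 U s)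
    (hV : ContDiffOn ℝ 1 V s) (T : Spinor →L[ℂ] Spinor) :
    ContDiffOn ℝ 1 (fun y => inner ℂ (U y) (T (sigmaAct y (V y)))) s := by
  have h1 : ContDiffOn ℝ 1 (fun y => sigmaBilin y (V y)) s :=
    sigmaBilin.contDiff.contDiffOn.clm_apply hV
  exact hU.inner ℂ ((T.restrictScalars ℝ).contDiff.comp_contDiffOn h1)

/-- Cauchy's theorem on the unit sphere for two monogenic spinor fields. -/
theorem IsSphereMeasure.integral_inner_sigmaAct_eq_zero {μ : Measure E3} (hμ : IsSphereMeasure μ)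
    {U V : E3 → Spinor} {ρ : ℝ} (hρ : 1 < ρ) (hU : ContDiffOn ℝ 1 U (Metric.ball 0 ρ))
    (hV : ContDiffOn ℝ 1 V (Metric.ball 0 ρ))
    (hDU : ∀ y ∈ Metric.ball (0 : E3) ρ, diracSymbol (fderiv ℝ U y) = 0)
    (hDV : ∀ y ∈ Metric.ball (0 : E3) ρ, diracSymbol (fderiv ℝ V y) = 0) :
    ∫ y, inner ℂ (U y) (sigmaAct y (V y)) ∂μ = 0 := by
  set h : (Spinor →L[ℂ] Spinor) → E3 → ℂ := fun T y => inner ℂ (U y) (T (sigmaAct y (V y))) with hh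
  have hC : ∀ T, ContDiffOn ℝ 1 (h T) (Metric.ball 0 ρ) := contDiffOn_inner_sigmaAct hU hV
  refine hμ.integral_eq_zero_of_radial (g := h 1) hρ (hC 1) fun r hr => ?_
  have hpt : ∀ y : E3, ‖y‖ = 1 → h 1 (r • y) + fderiv ℝ (h 1) (r • y) (r • y) =
      Complex.I *
        (fderiv ℝ (h (sigmaAct (basisE3 0))) (r • y) (crossCLM (basisE3 0) (r • y)) +
        fderiv ℝ (h (sigmaAct (basisE3 1))) (r • y) (crossCLM (basisE3 1) (r • y)) +
        fderiv ℝ (h (sigmaAct (basisE3 2))) (r • y) (crossCLM (basisE3 2) (r • y))) := by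
    intro y hy
    have hmem : r • y ∈ Metric.ball (0 : E3) ρ := mapsTo_smul hr (by simpa using hy)
    have hn := Metric.isOpen_ball.mem_nhds hmem
    have hU' := ((hU.differentiableOn one_ne_zero).differentiableAt hn).hasFDerivAt
    have hV' := ((hV.differentiableOn one_ne_zero).differentiableAt hn).hasFDerivAt
    refine inner_sigmaAct_divergence (U (r • y)) (V (r • y)) _ _ (r • y) (hDU _ hmem) (hDV _ hmem)
      (fun T w => fderiv ℝ (h T) (r • y) w) fun T w => ?_
    obtain ⟨L, hL, hLw⟩ := hasFDerivAt_inner_sigmaAct hU' hV' T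
    rw [← hLw, hL.fderiv]
  have hint : ∀ k, Integrable (fun y =>
      fderiv ℝ (h (sigmaAct (basisE3 k))) (r • y) (crossCLM (basisE3 k) (r • y))) μ := by
    intro k
    have hsm : Continuous fun y : E3 => r • y := by fun_prop
    exact hμ.integrable ((((hC _).continuousOn_fderiv_of_isOpen Metric.isOpen_ball le_rfl).comp
      hsm.continuousOn (mapsTo_smul hr)).clm_apply
        ((crossCLM _).continuous.comp hsm).continuousOn)
  rw [integral_congr_ae (hμ.ae_norm.mono hpt), integral_const_mul,
    integral_add ((hint 0).fun_add (hint 1)) (hint 2), integral_add (hint 0) (hint 1)]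
  simp only [hμ.integral_fderiv_skewAdjoint (hC _) hr (crossCLM_mem_skewAdjoint _), add_zero,
    mul_zero]

/-- The denominator of the Cauchy kernel of the unit ball. -/
noncomputable def cauchyDenom (b y : E3) : ℝ := 1 - 2 * inner ℝ y b + ‖b‖ ^ 2 * ‖y‖ ^ 2

theorem cauchyDenom_pos {b y : E3} (h : ‖y‖ * ‖b‖ < 1) : 0 < cauchyDenom b y := by
  have h1 := real_inner_le_norm y b
  rw [cauchyDenom]
  nlinarith [sq_nonneg (1 - ‖y‖ * ‖b‖)]

/-- The Cauchy kernel of the unit ball, `(1 - σ_y σ_b) ξ / (1 - 2 y·b + |y|²|b|²)^{3/2}`. -/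
noncomputable def cauchyKernel (b : E3) (ξ : Spinor) (y : E3) : Spinor :=
  (√(cauchyDenom b y) ^ 3)⁻¹ • (ξ - sigmaAct y (sigmaAct b ξ))

theorem hasDerivAt_inv_sqrt_pow_three {t : ℝ} (ht : 0 < t) :
    HasDerivAt (fun t => (√t ^ 3)⁻¹) (-(3 / 2) * (√t ^ 5)⁻¹) t := by
  have hs : 0 < √t := Real.sqrt_pos.2 ht
  refine (((Real.hasDerivAt_sqrt ht.ne').fun_pow 3).fun_inv (by positivity)).congr_deriv ?_
  field_simp
  norm_num
  ring

theorem hasFDerivAt_cauchyDenom (b y : E3) :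
    ∃ L : E3 →L[ℝ] ℝ, HasFDerivAt (cauchyDenom b) L y ∧
      ∀ w, L w = -2 * inner ℝ w b + 2 * ‖b‖ ^ 2 * inner ℝ y w := by
  have h1 : HasFDerivAt (fun y : E3 => inner ℝ b y) (innerSL ℝ b) y := (innerSL ℝ b).hasFDerivAt
  have h2 := (hasStrictFDerivAt_norm_sq y).hasFDerivAt
  have h3 := ((h1.const_mul 2).const_sub 1).add (h2.const_mul (‖b‖ ^ 2))
  have e : cauchyDenom b = ((fun y => 1 - 2 * inner ℝ b y) + fun y => ‖b‖ ^ 2 * ‖y‖ ^ 2) := by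
    funext y
    simp [cauchyDenom, real_inner_comm]
  refine ⟨_, e ▸ h3, fun w => ?_⟩
  simp [real_inner_comm]
  ring

theorem hasFDerivAt_cauchyKernel {b y : E3} (ξ : Spinor) (h : ‖y‖ * ‖b‖ < 1) :
    ∃ L : E3 →L[ℝ] Spinor, HasFDerivAt (cauchyKernel b ξ) L y ∧ ∀ w, L w =
      (√(cauchyDenom b y) ^ 3)⁻¹ • (-sigmaAct w (sigmaAct b ξ)) +
      (-(3 / 2) * (√(cauchyDenom b y) ^ 5)⁻¹ *
        (-2 * inner ℝ w b + 2 * ‖b‖ ^ 2 * inner ℝ y w)) • (ξ - sigmaAct y (sigmaAct b ξ)) := by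
  obtain ⟨L, hL, hLw⟩ := hasFDerivAt_cauchyDenom b y
  have h1 := (hasDerivAt_inv_sqrt_pow_three (cauchyDenom_pos h)).comp_hasFDerivAt y hL
  have h2 : HasFDerivAt (fun y => ξ - sigmaAct y (sigmaAct b ξ))
      (-(sigmaBilin.flip (sigmaAct b ξ))) y :=
    (sigmaBilin.flip (sigmaAct b ξ)).hasFDerivAt.const_sub ξ
  refine ⟨_, h1.smul h2, fun w => ?_⟩
  rw [← hLw]
  rfl

/-- For b ≠ 0 let b* = b/|b|². Then 1 - σ_y σ_b = -σ_{y-b*} σ_b and the denominator is |b|²|y-b*|²,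
so up to a constant spinor this is the fundamental solution of the Dirac operator with pole at the
inverse point b*. The polynomial form also covers b = 0. The proof is a computation with
t²·denominator = 1. -/
theorem diracSymbol_cauchyKernel {b y : E3} (ξ : Spinor) (h : ‖y‖ * ‖b‖ < 1) :
    diracSymbol (fderiv ℝ (cauchyKernel b ξ) y) = 0 := by
  obtain ⟨L, hL, hLw⟩ := hasFDerivAt_cauchyKernel ξ h
  have hpos := cauchyDenom_pos h
  set t : ℝ := (√(cauchyDenom b y))⁻¹ with ht
  have htQ : t ^ 2 * cauchyDenom b y = 1 := by
    rw [ht, inv_pow, Real.sq_sqrt hpos.le, inv_mul_cancel₀ hpos.ne']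
  have hn : ∀ a : E3, ‖a‖ ^ 2 = a 0 * a 0 + a 1 * a 1 + a 2 * a 2 := fun a => by
    rw [← real_inner_self_eq_norm_sq, inner_eq_sum_three]
  have htC : (t : ℂ) ^ 2 * (1 - 2 * (y 0 * b 0 + y 1 * b 1 + y 2 * b 2) +
      (b 0 * b 0 + b 1 * b 1 + b 2 * b 2) * (y 0 * y 0 + y 1 * y 1 + y 2 * y 2)) = 1 := by
    have := congrArg (fun r : ℝ => (r : ℂ)) htQ
    rw [cauchyDenom, inner_eq_sum_three, hn, hn] at this
    push_cast at this
    exact this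
  rw [hL.fderiv, diracSymbol]
  simp only [hLw, ← inv_pow]
  rw [← ht]
  simp only [hn, inner_eq_sum_three]
  ext i
  fin_cases i
  · simp only [Fin.isValue, Fin.zero_eta, sigmaAct_apply_zero, sigmaAct_apply_one, PiLp.add_apply,
      PiLp.sub_apply, PiLp.smul_apply, PiLp.neg_apply, PiLp.zero_apply, basisE3, PiLp.single_apply,
      Complex.real_smul, Fin.reduceEq, if_true, if_false]
    push_cast
    linear_combination (norm := skip) (3 * (t : ℂ) ^ 3 *
      ((b 2 : ℂ) * ξ 0 + ((b 0 : ℂ) - Complex.I * b 1) * ξ 1)) * htC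
    ring_nf
    simp only [Complex.I_sq, Complex.I_pow_three]
    ring
  · simp only [Fin.isValue, Fin.mk_one, sigmaAct_apply_zero, sigmaAct_apply_one, PiLp.add_apply,
      PiLp.sub_apply, PiLp.smul_apply, PiLp.neg_apply, PiLp.zero_apply, basisE3, PiLp.single_apply,
      Complex.real_smul, Fin.reduceEq, if_true, if_false]
    push_cast
    linear_combination (norm := skip) (3 * (t : ℂ) ^ 3 *
      (((b 0 : ℂ) + Complex.I * b 1) * ξ 0 - (b 2 : ℂ) * ξ 1)) * htC
    ring_nf
    simp only [Complex.I_sq, Complex.I_pow_three]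
    ring

theorem contDiffOn_cauchyKernel {b : E3} (ξ : Spinor) {s : Set E3} (h : ∀ y ∈ s, ‖y‖ * ‖b‖ < 1) :
    ContDiffOn ℝ 1 (cauchyKernel b ξ) s := by
  have h1 : ContDiff ℝ 1 (cauchyDenom b) := by
    unfold cauchyDenom
    exact (contDiff_const.sub (contDiff_const.mul (contDiff_id.inner ℝ contDiff_const))).add
      (contDiff_const.mul (contDiff_norm_sq ℝ))
  have h2 : ContDiff ℝ 1 fun y => ξ - sigmaAct y (sigmaAct b ξ) :=
    contDiff_const.sub (sigmaBilin.flip (sigmaAct b ξ)).contDiff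
  unfold cauchyKernel
  refine ContDiffOn.smul (ContDiffOn.inv (((h1.contDiffOn).sqrt fun y hy =>
    (cauchyDenom_pos (h y hy)).ne').pow 3) fun y hy => ?_) h2.contDiffOn
  have := Real.sqrt_pos.2 (cauchyDenom_pos (h y hy))
  positivity

theorem IsSphereMeasure.integral_inner_cauchyKernel {μ : Measure E3} (hμ : IsSphereMeasure μ)
    {a b : E3} (ha : ‖a‖ < 1) (hb : ‖b‖ < 1) (ξ η : Spinor) :
    ∫ y, inner ℂ (cauchyKernel a ξ y) (sigmaAct y (cauchyKernel b η y)) ∂μ = 0 := by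
  set m := max ‖a‖ ‖b‖ with hm
  have hm1 : m < 1 := max_lt ha hb
  have hm0 : 0 ≤ m := (norm_nonneg a).trans (le_max_left _ _)
  have hmem : ∀ c : E3, ‖c‖ ≤ m → ∀ y ∈ Metric.ball (0 : E3) (2 / (1 + m)), ‖y‖ * ‖c‖ < 1 := by
    intro c hc y hy
    rw [mem_ball_zero_iff, lt_div_iff₀ (by positivity)] at hy
    nlinarith [norm_nonneg y, mul_le_mul_of_nonneg_left hc (norm_nonneg y)]
  -- This radius exceeds 1 because m < 1, and 2m/(1+m) < 1 keeps the poles of both kernels outside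
  -- the ball.
  refine hμ.integral_inner_sigmaAct_eq_zero (ρ := 2 / (1 + m)) ?_
    (contDiffOn_cauchyKernel ξ (hmem a (le_max_left _ _)))
    (contDiffOn_cauchyKernel η (hmem b (le_max_right _ _)))
    (fun y hy => diracSymbol_cauchyKernel ξ (hmem a (le_max_left _ _) y hy))
    (fun y hy => diracSymbol_cauchyKernel η (hmem b (le_max_right _ _) y hy))
  rw [lt_div_iff₀ (by positivity)]
  linarith

/-! ### Lebesgue points and Poisson averages -/

/-- Lebesgue differentiation by the Besicovitch covering theorem. The quadratic upper bound on μ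
allows dividing by r² in place of the measure of the ball. -/
theorem ae_tendsto_integral_ball {μ : Measure E3} [IsFiniteMeasure μ] {C : ℝ}
    (hC : ∀ x r, 0 ≤ r → μ.real (Metric.ball x r) ≤ C * r ^ 2) {w : E3 → Spinor}
    (hw : Integrable w μ) :
    ∀ᵐ x ∂μ, Tendsto (fun r : ℝ => (∫ y in Metric.ball x r, ‖w y - w x‖ ∂μ) / r ^ 2)
      (𝓝[>] 0) (𝓝 0) := by
  filter_upwards [(Besicovitch.vitaliFamily μ).ae_tendsto_average_norm_sub hw.locallyIntegrable]
    with x hx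
  have h1 := hx.comp (Besicovitch.tendsto_filterAt μ x)
  have h2 := h1.const_mul (C * 4)
  rw [mul_zero] at h2
  refine squeeze_zero' (Eventually.of_forall fun r => by positivity) ?_ h2
  filter_upwards [self_mem_nhdsWithin] with r hr
  have hr : 0 < r := hr
  have hi : Integrable (fun y => ‖w y - w x‖) μ := (hw.sub (integrable_const _)).norm
  have hm : μ.real (Metric.closedBall x r) ≤ C * 4 * r ^ 2 := by
    refine (measureReal_mono (Metric.closedBall_subset_ball (by linarith : r < 2 * r))).trans
      ((hC x (2 * r) (by positivity)).trans_eq (by ring))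
  rw [Function.comp_apply, div_le_iff₀ (by positivity), setAverage_eq, smul_eq_mul]
  have h0 : 0 ≤ ∫ y in Metric.closedBall x r, ‖w y - w x‖ ∂μ := by positivity
  have h3 : ∫ y in Metric.ball x r, ‖w y - w x‖ ∂μ ≤
      ∫ y in Metric.closedBall x r, ‖w y - w x‖ ∂μ :=
    setIntegral_mono_set hi.integrableOn (Eventually.of_forall fun y => norm_nonneg _)
      Metric.ball_subset_closedBall.eventuallyLE
  refine h3.trans ?_
  rcases eq_or_ne (μ.real (Metric.closedBall x r)) 0 with h4 | h4
  · rw [setIntegral_measure_zero _ ((measureReal_eq_zero_iff).1 h4)]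
    simp
  have h5 : 0 < μ.real (Metric.closedBall x r) := lt_of_le_of_ne measureReal_nonneg h4.symm
  calc ∫ y in Metric.closedBall x r, ‖w y - w x‖ ∂μ
      = μ.real (Metric.closedBall x r) * ((μ.real (Metric.closedBall x r))⁻¹ *
          ∫ y in Metric.closedBall x r, ‖w y - w x‖ ∂μ) := by field_simp
    _ ≤ C * 4 * r ^ 2 * ((μ.real (Metric.closedBall x r))⁻¹ *
          ∫ y in Metric.closedBall x r, ‖w y - w x‖ ∂μ) := by gcongr
    _ = _ := by ring

/-- At a Lebesgue point x the measure |w - w(x)| dμ has two-dimensional density zero, so its Poisson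
integrals tend to zero. -/
theorem ae_tendsto_integral_poissonProfile_mul {μ : Measure E3} [IsFiniteMeasure μ] {C : ℝ}
    (hC : ∀ x r, 0 ≤ r → μ.real (Metric.ball x r) ≤ C * r ^ 2) {w : E3 → Spinor}
    (hwm : StronglyMeasurable w) (hw : Integrable w μ) :
    ∀ᵐ x ∂μ, Tendsto (fun ε => ∫ y, poissonProfile ε ‖x - y‖ * ‖w y - w x‖ ∂μ)
      (𝓝[>] 0) (𝓝 0) := by
  filter_upwards [ae_tendsto_integral_ball hC hw] with x hx
  have hi : Integrable (fun y => w y - w x) μ := hw.sub (integrable_const _)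
  have hm : Measurable fun y => ‖w y - w x‖ₑ :=
    (hwm.sub stronglyMeasurable_const).enorm
  set ν := μ.withDensity fun y => ‖w y - w x‖ₑ with hν
  have : IsFiniteMeasure ν := isFiniteMeasure_withDensity hi.2.ne
  have hball : ∀ r, ν.real (Metric.ball x r) = ∫ y in Metric.ball x r, ‖w y - w x‖ ∂μ := by
    intro r
    rw [Measure.real, hν, withDensity_apply _ measurableSet_ball,
      ← ofReal_integral_norm_eq_lintegral_enorm hi.integrableOn,
      ENNReal.toReal_ofReal (by positivity)]
  have h := tendsto_integral_poissonProfile (μ := ν) (x := x) (ℓ := 0)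
    (by simpa only [hball] using hx)
  rw [mul_zero] at h
  refine h.congr fun ε => ?_
  rw [hν, integral_withDensity_eq_integral_toReal_smul hm (Eventually.of_forall fun y => by simp)]
  refine integral_congr_ae (Eventually.of_forall fun y => ?_)
  simp [mul_comm]

/-- Poisson averages converge almost everywhere. -/
theorem tendsto_integral_poissonProfile_smul {μ : Measure E3} [IsFiniteMeasure μ] {x : E3}
    {w : E3 → Spinor} (hw : Integrable w μ) {ℓ : ℝ}
    (hx : Tendsto (fun r => μ.real (Metric.ball x r) / r ^ 2) (𝓝[>] 0) (𝓝 ℓ))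
    (h : Tendsto (fun ε => ∫ y, poissonProfile ε ‖x - y‖ * ‖w y - w x‖ ∂μ) (𝓝[>] 0) (𝓝 0)) :
    Tendsto (fun ε => ∫ y, poissonProfile ε ‖x - y‖ • w y ∂μ) (𝓝[>] 0) (𝓝 ((2 * ℓ) • w x)) := by
  have h1 := (tendsto_integral_poissonProfile hx).smul_const (w x)
  have h2 : Tendsto (fun ε => ∫ y, poissonProfile ε ‖x - y‖ • (w y - w x) ∂μ) (𝓝[>] 0) (𝓝 0) := by
    refine squeeze_zero_norm' ?_ h
    filter_upwards [self_mem_nhdsWithin] with ε hε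
    refine (norm_integral_le_integral_norm _).trans_eq (integral_congr_ae
      (Eventually.of_forall fun y => ?_))
    simp only [norm_smul, Real.norm_of_nonneg (poissonProfile_nonneg (le_of_lt hε) _)]
  have h3 := h2.add h1
  rw [zero_add] at h3
  refine h3.congr' ?_
  filter_upwards [self_mem_nhdsWithin] with ε hε
  have hε : 0 < ε := hε
  have hcont : Continuous fun y => poissonProfile ε ‖x - y‖ :=
    (continuous_poissonProfile hε).comp (by fun_prop)
  have hbd : ∀ y, ‖poissonProfile ε ‖x - y‖‖ ≤ ε / √(ε ^ 2) ^ 3 := fun y => by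
    rw [Real.norm_of_nonneg (poissonProfile_nonneg hε.le _), poissonProfile]
    gcongr
    nlinarith [sq_nonneg ‖x - y‖]
  have hi1 : Integrable (fun y => poissonProfile ε ‖x - y‖) μ :=
    Integrable.of_bound hcont.aestronglyMeasurable _ (Eventually.of_forall hbd)
  have hi2 : Integrable (fun y => poissonProfile ε ‖x - y‖ • (w y - w x)) μ :=
    Integrable.bdd_smul (hw.sub (integrable_const _)) _ hcont.aestronglyMeasurable
      (Eventually.of_forall hbd)
  rw [← integral_smul_const, ← integral_add hi2 (hi1.smul_const _)]
  refine integral_congr_ae (Eventually.of_forall fun y => ?_)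
  simp only [smul_sub, sub_add_cancel]

/-! ### The boundary of a ball -/

section Ball

variable {c : E3} {R : ℝ}

/-- The map from the sphere with centre `c` and radius `R` to the unit sphere. -/
noncomputable def sphereMap (c : E3) (R : ℝ) (x : E3) : E3 := R⁻¹ • (x - c)

theorem continuous_sphereMap (c : E3) (R : ℝ) : Continuous (sphereMap c R) := by
  unfold sphereMap
  fun_prop

theorem norm_sphereMap (hR : 0 < R) {x : E3} (hx : x ∈ Metric.sphere c R) :
    ‖sphereMap c R x‖ = 1 := by
  rw [mem_sphere_iff_norm] at hx
  rw [sphereMap, norm_smul, hx, norm_inv, Real.norm_of_nonneg hR.le, inv_mul_cancel₀ hR.ne']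

theorem sphereMap_sub (c : E3) (R : ℝ) (x y : E3) :
    sphereMap c R x - sphereMap c R y = R⁻¹ • (x - y) := by
  rw [sphereMap, sphereMap]
  module

theorem norm_sphereMap_sub (hR : 0 < R) (x y : E3) :
    ‖sphereMap c R x - sphereMap c R y‖ = R⁻¹ * ‖x - y‖ := by
  rw [sphereMap_sub, norm_smul, norm_inv, Real.norm_of_nonneg hR.le]

theorem isOutwardUnitNormal_ball (hR : 0 < R) {x : E3} (hx : x ∈ Metric.sphere c R) :
    IsOutwardUnitNormal (Metric.ball c R) x (sphereMap c R x) := by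
  have hx' : ‖x - c‖ = R := by rwa [mem_sphere_iff_norm] at hx
  have hg : HasGradientAt (fun y : E3 => ‖y - c‖ ^ 2 - R ^ 2) ((2 : ℝ) • (x - c)) x := by
    rw [hasGradientAt_iff_hasFDerivAt]
    have h1 := ((hasStrictFDerivAt_norm_sq (x - c)).hasFDerivAt.comp x
      ((hasFDerivAt_id x).sub_const c)).sub_const (R ^ 2)
    refine h1.congr_fderiv ?_
    ext w
    simp
  have hne : x - c ≠ 0 := fun h0 => hR.ne' (by rw [← hx', h0, norm_zero])
  refine ⟨fun y => ‖y - c‖ ^ 2 - R ^ 2, ⟨?_, ?_, ?_, ?_⟩, ?_⟩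
  · exact (((contDiff_id.sub contDiff_const).norm_sq ℝ).sub contDiff_const).contDiffAt
  · simp [hx']
  · rw [hg.gradient]
    exact smul_ne_zero two_ne_zero hne
  · refine Eventually.of_forall fun y => ?_
    rw [Metric.mem_ball, dist_eq_norm, sub_neg, pow_lt_pow_iff_left₀ (norm_nonneg _) hR.le two_ne_zero]
  · rw [hg.gradient, norm_smul, hx', sphereMap, smul_smul, Real.norm_of_nonneg zero_le_two]
    congr 1
    field_simp

theorem outwardNormal_ball (hR : 0 < R) {x : E3} (hx : x ∈ Metric.sphere c R) :
    outwardNormal (Metric.ball c R) x = sphereMap c R x :=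
  (isOutwardUnitNormal_ball hR hx).outwardNormal_eq

theorem ae_mem_sphere (hR : 0 < R) :
    ∀ᵐ x ∂surfaceMeasure (Metric.ball c R), x ∈ Metric.sphere c R := by
  rw [← frontier_ball c hR.ne']
  exact IsBoundedC1Domain.ae_mem_frontier _

theorem measurePreserving_rotation (hR : 0 < R) (L : E3 ≃ₗᵢ[ℝ] E3) :
    MeasurePreserving (fun x => c + L (x - c)) (surfaceMeasure (Metric.ball c R))
      (surfaceMeasure (Metric.ball c R)) := by
  set A : E3 ≃ᵢ E3 := ((IsometryEquiv.subRight c).trans L.toIsometryEquiv).trans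
    (IsometryEquiv.addLeft c) with hA
  have h1 : MeasurePreserving A _ _ := IsometryEquiv.measurePreserving_euclideanHausdorffMeasure A 2
  have h2 := h1.restrict_preimage (s := Metric.sphere c R) Metric.isClosed_sphere.measurableSet
  have h3 : A ⁻¹' Metric.sphere c R = Metric.sphere c R := by
    ext x
    have : A x = c + L (x - c) := rfl
    rw [Set.mem_preimage, this, mem_sphere_iff_norm, mem_sphere_iff_norm, add_sub_cancel_left,
      L.norm_map]
  rw [h3] at h2
  rw [surfaceMeasure, frontier_ball c hR.ne']
  exact h2

theorem isSphereMeasure_map (hΩ : IsBoundedC1Domain (Metric.ball c R)) (hR : 0 < R) :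
    IsSphereMeasure ((surfaceMeasure (Metric.ball c R)).map (sphereMap c R)) := by
  have := hΩ.isFiniteMeasure_surfaceMeasure
  have hm : Measurable (sphereMap c R) := (continuous_sphereMap c R).measurable
  refine ⟨inferInstance, ?_, fun L => ⟨L.continuous.measurable, ?_⟩⟩
  · rw [ae_map_iff hm.aemeasurable (measurableSet_eq_fun (by fun_prop) (by fun_prop))]
    exact (ae_mem_sphere hR).mono fun x hx => norm_sphereMap hR hx
  · rw [Measure.map_map L.continuous.measurable hm]
    have h1 : L ∘ sphereMap c R = sphereMap c R ∘ fun x => c + L (x - c) := by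
      funext x
      simp [sphereMap]
    rw [h1, ← Measure.map_map hm (measurePreserving_rotation hR L).measurable,
      (measurePreserving_rotation hR L).map_eq]

theorem integral_sphereMap {F : Type*} [NormedAddCommGroup F] [NormedSpace ℝ F] (hR : 0 < R)
    (f : E3 → F) :
    ∫ y, f y ∂(surfaceMeasure (Metric.ball c R)).map (sphereMap c R) =
      ∫ y, f (sphereMap c R y) ∂surfaceMeasure (Metric.ball c R) := by
  have e : MeasurableEmbedding (sphereMap c R) :=
    ((Homeomorph.subRight c).trans (Homeomorph.smulOfNeZero R⁻¹ (inv_ne_zero hR.ne'))).measurableEmbedding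
  exact e.integral_map f

end Ball

/-! ### Zonal averages and the regularised kernel on the sphere. -/

section Ball

variable {c : E3} {R : ℝ}

theorem inner_sphereMap (hR : 0 < R) {x y : E3} (hx : x ∈ Metric.sphere c R)
    (hy : y ∈ Metric.sphere c R) :
    inner ℝ (sphereMap c R x) (sphereMap c R y) = 1 - ‖x - y‖ ^ 2 / (2 * R ^ 2) := by
  have h1 := norm_sub_sq_real (sphereMap c R x) (sphereMap c R y)
  rw [norm_sphereMap hR hx, norm_sphereMap hR hy, norm_sphereMap_sub hR] at h1
  field_simp at h1 ⊢
  linarith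

theorem norm_sub_le_of_mem_sphere {x y : E3} (hx : x ∈ Metric.sphere c R)
    (hy : y ∈ Metric.sphere c R) : ‖x - y‖ ≤ 2 * R := by
  rw [← dist_eq_norm]
  have := dist_triangle_right x y c
  rw [Metric.mem_sphere] at hx hy
  linarith

/-- Averages of `σ_x σ_y` against a zonal function. -/
theorem integral_zonal_smul_sigmaAct (hR : 0 < R) {x : E3}
    (hx : x ∈ Metric.sphere c R) {g : ℝ → ℝ} (hg : Measurable g)
    (hgi : Integrable (fun y => g ‖x - y‖) (surfaceMeasure (Metric.ball c R))) (ξ : Spinor) :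
    Integrable (fun y => g ‖x - y‖ • sigmaAct (sphereMap c R x) (sigmaAct (sphereMap c R y) ξ))
        (surfaceMeasure (Metric.ball c R)) ∧
      ∫ y, g ‖x - y‖ • sigmaAct (sphereMap c R x) (sigmaAct (sphereMap c R y) ξ)
        ∂surfaceMeasure (Metric.ball c R) =
      (∫ y, g ‖x - y‖ * (1 - ‖x - y‖ ^ 2 / (2 * R ^ 2)) ∂surfaceMeasure (Metric.ball c R)) • ξ := by
  set σ := surfaceMeasure (Metric.ball c R) with hσ
  set X := sphereMap c R x with hX
  have hX1 : ‖X‖ = 1 := norm_sphereMap hR hx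
  have hcont : Continuous fun y => sigmaAct X (sigmaAct (sphereMap c R y) ξ) :=
    (sigmaAct X).continuous.comp
      ((continuous_sigmaAct.comp (continuous_sphereMap c R)).clm_apply continuous_const)
  have hgm : Measurable fun y : E3 => g ‖x - y‖ := hg.comp (by fun_prop)
  have hi : Integrable (fun y => g ‖x - y‖ • sigmaAct X (sigmaAct (sphereMap c R y) ξ)) σ := by
    refine (hgi.norm.mul_const ‖ξ‖).mono'
      (hgm.aestronglyMeasurable.smul hcont.aestronglyMeasurable) ?_
    filter_upwards [ae_mem_sphere hR] with y hy
    rw [norm_smul, norm_sigmaAct_apply, norm_sigmaAct_apply, hX1, norm_sphereMap hR hy, one_mul,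
      one_mul]
  refine ⟨hi, ?_⟩
  -- The half-turn about the axis X fixes x and preserves both the measure and |x-y|. The average of
  -- Y and LY is (X·Y)X, so σ_X σ_Y may be replaced by the scalar X·Y.
  set L := (Submodule.span ℝ {X}).reflection with hL
  have hLX : L X = X := Submodule.reflection_mem_subspace_eq_self (Submodule.mem_span_singleton_self X)
  have hLv : ∀ v, L v = (2 * inner ℝ X v) • X - v := fun v => by
    rw [hL, Submodule.reflection_apply, Submodule.starProjection_singleton, hX1]
    simp [two_smul, two_mul, add_smul]
  have hmp := measurePreserving_rotation hR L (c := c)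
  have hemb : MeasurableEmbedding fun y => c + L (y - c) :=
    (((Homeomorph.subRight c).trans L.toHomeomorph).trans (Homeomorph.addLeft c)).measurableEmbedding
  have hdist : ∀ y, ‖x - (c + L (y - c))‖ = ‖x - y‖ := fun y => by
    have h1 : x - c = R • X := by
      rw [hX, sphereMap, smul_smul, mul_inv_cancel₀ hR.ne', one_smul]
    have h2 : L (x - c) = x - c := by rw [h1, map_smul, hLX]
    have h3 : x - (c + L (y - c)) = L (x - y) := by
      rw [← sub_sub_sub_cancel_right x y c, map_sub L (x - c), h2]
      abel
    rw [h3, L.norm_map]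
  have hmap : ∀ y, sphereMap c R (c + L (y - c)) = L (sphereMap c R y) := fun y => by
    simp [sphereMap]
  have hsym : ∫ y, g ‖x - y‖ • sigmaAct X (sigmaAct (sphereMap c R y) ξ) ∂σ =
      ∫ y, g ‖x - y‖ • sigmaAct X (sigmaAct (L (sphereMap c R y)) ξ) ∂σ := by
    rw [← hmp.integral_comp hemb]
    simp only [hdist, hmap]
    rfl
  have hi2 : Integrable (fun y => g ‖x - y‖ • sigmaAct X (sigmaAct (L (sphereMap c R y)) ξ)) σ := by
    have := hmp.integrable_comp_emb hemb |>.2 hi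
    simpa only [Function.comp_def, hdist, hmap] using this
  have hsum : ∀ y ∈ Metric.sphere c R, g ‖x - y‖ • sigmaAct X (sigmaAct (sphereMap c R y) ξ) +
      g ‖x - y‖ • sigmaAct X (sigmaAct (L (sphereMap c R y)) ξ) =
      (2 : ℝ) • (g ‖x - y‖ * (1 - ‖x - y‖ ^ 2 / (2 * R ^ 2))) • ξ := by
    intro y hy
    rw [← smul_add, ← map_add, ← add_apply, ← sigmaAct_add, hLv, add_sub_cancel, sigmaAct_smul,
      inner_sphereMap hR hx hy, smul_apply, ← Complex.coe_smul (2 * _) (sigmaAct X ξ), map_smul,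
      sigmaAct_sigmaAct, hX1]
    simp only [one_pow, Complex.ofReal_one, one_smul, Complex.coe_smul, smul_smul]
    congr 1
    ring
  have h2 : (2 : ℝ) • ∫ y, g ‖x - y‖ • sigmaAct X (sigmaAct (sphereMap c R y) ξ) ∂σ =
      (2 : ℝ) • (∫ y, g ‖x - y‖ * (1 - ‖x - y‖ ^ 2 / (2 * R ^ 2)) ∂σ) • ξ := by
    rw [two_smul]
    nth_rw 2 [hsym]
    rw [← integral_add hi hi2, ← integral_smul_const, ← integral_smul]
    exact integral_congr_ae ((ae_mem_sphere hR).mono hsum)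
  exact smul_right_injective _ (two_ne_zero (α := ℝ)) h2

/-- The radius `q ∈ (0,1]` with `1/q - q = e`. -/
noncomputable def poissonRadius (e : ℝ) : ℝ := (√(e ^ 2 + 4) - e) / 2

theorem poissonRadius_sq (e : ℝ) : poissonRadius e ^ 2 = 1 - e * poissonRadius e := by
  have h := Real.sq_sqrt (by positivity : 0 ≤ e ^ 2 + 4)
  rw [poissonRadius]
  linear_combination h / 4

theorem poissonRadius_pos (e : ℝ) : 0 < poissonRadius e := by
  have : |e| < √(e ^ 2 + 4) := by
    rw [← Real.sqrt_sq_eq_abs]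
    exact Real.sqrt_lt_sqrt (sq_nonneg _) (by linarith)
  rw [poissonRadius]
  linarith [le_abs_self e]

theorem poissonRadius_lt_one {e : ℝ} (he : 0 < e) : poissonRadius e < 1 := by
  have h1 := poissonRadius_sq e
  have h2 := poissonRadius_pos e
  have h3 := mul_pos he h2
  nlinarith

theorem tendsto_poissonRadius (R : ℝ) :
    Tendsto (fun ε => poissonRadius (ε / R)) (𝓝[>] 0) (𝓝 1) := by
  have h : Continuous fun ε => poissonRadius (ε / R) := by
    unfold poissonRadius
    fun_prop
  have h1 := (h.tendsto 0).mono_left (nhdsWithin_le_nhds (s := Set.Ioi 0))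
  have h2 : poissonRadius (0 / R) = 1 := by
    rw [zero_div, poissonRadius, show (0 : ℝ) ^ 2 + 4 = 2 ^ 2 by norm_num,
      Real.sqrt_sq zero_le_two]
    norm_num
  rwa [h2] at h1

/-- The regularized kernel `(1 - q² σ_x σ_y) (ε² + |x-y|²)^{-3/2}`. -/
noncomputable def smoothKernel (c : E3) (R ε : ℝ) (x y : E3) (ξ : Spinor) : Spinor :=
  (√(ε ^ 2 + ‖x - y‖ ^ 2) ^ 3)⁻¹ • (ξ - (poissonRadius (ε / R) ^ 2) •
    sigmaAct (sphereMap c R x) (sigmaAct (sphereMap c R y) ξ))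

/-- The truncated kernel `(1 - σ_x σ_y) |x-y|⁻³`, for `|x-y| > ε`. -/
noncomputable def truncatedKernel (c : E3) (R ε : ℝ) (x y : E3) (ξ : Spinor) : Spinor :=
  (if ε < ‖x - y‖ then (‖x - y‖ ^ 3)⁻¹ else 0) • (ξ -
    sigmaAct (sphereMap c R x) (sigmaAct (sphereMap c R y) ξ))

theorem norm_sub_sigmaAct (hR : 0 < R) {x y : E3} (hx : x ∈ Metric.sphere c R) (ξ : Spinor) :
    ‖ξ - sigmaAct (sphereMap c R x) (sigmaAct (sphereMap c R y) ξ)‖ = R⁻¹ * ‖x - y‖ * ‖ξ‖ := by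
  have h : ξ - sigmaAct (sphereMap c R x) (sigmaAct (sphereMap c R y) ξ) =
      sigmaAct (sphereMap c R x) (sigmaAct (sphereMap c R x - sphereMap c R y) ξ) := by
    rw [sigmaAct_sub, sub_apply, map_sub, sigmaAct_sigmaAct, norm_sphereMap hR hx]
    simp
  rw [h, norm_sigmaAct_apply, norm_sigmaAct_apply, norm_sphereMap hR hx, norm_sphereMap_sub hR,
    one_mul]

/-- With D = √(ε²+δ²), factor D³ - δ³ and use D - δ ≤ ε²/(2δ), D ≤ 2δ and ε < δ. This gives 7/2,
rounded up to 6. -/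
theorem inv_cube_sub_le {ε δ : ℝ} (hε : 0 < ε) (hδ : ε < δ) :
    δ * ((δ ^ 3)⁻¹ - (√(ε ^ 2 + δ ^ 2) ^ 3)⁻¹) ≤ 6 * poissonProfile ε δ := by
  have hδ0 : 0 < δ := hε.trans hδ
  set D := √(ε ^ 2 + δ ^ 2) with hD
  have hD0 : 0 < D := Real.sqrt_pos.2 (by positivity)
  have hD2 : D ^ 2 = ε ^ 2 + δ ^ 2 := Real.sq_sqrt (by positivity)
  have hDδ : δ ≤ D := Real.le_sqrt_of_sq_le (by nlinarith)
  have hD2δ : D ≤ 2 * δ := by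
    rw [hD]
    refine Real.sqrt_le_iff.2 ⟨by positivity, by nlinarith⟩
  have key : δ * (D ^ 3 - δ ^ 3) ≤ 6 * ε * δ ^ 3 := by
    have h1 : 2 * δ * (D - δ) ≤ ε ^ 2 := by nlinarith
    have h2 : D ^ 2 + D * δ + δ ^ 2 ≤ 7 * δ ^ 2 := by nlinarith
    calc δ * (D ^ 3 - δ ^ 3) = δ * (D - δ) * (D ^ 2 + D * δ + δ ^ 2) := by ring
      _ ≤ δ * (D - δ) * (7 * δ ^ 2) := by
        have := sub_nonneg.2 hDδ
        gcongr
      _ = 7 / 2 * δ ^ 2 * (2 * δ * (D - δ)) := by ring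
      _ ≤ 7 / 2 * δ ^ 2 * (ε * δ) := by
        exact mul_le_mul_of_nonneg_left (h1.trans (by nlinarith)) (by positivity)
      _ ≤ 6 * ε * δ ^ 3 := by nlinarith [show 0 < ε * δ ^ 3 by positivity]
  rw [poissonProfile, ← hD]
  have e1 : δ * ((δ ^ 3)⁻¹ - (D ^ 3)⁻¹) = δ * (D ^ 3 - δ ^ 3) / (δ ^ 3 * D ^ 3) := by
    field_simp
  rw [e1, div_le_iff₀ (by positivity)]
  refine key.trans_eq ?_
  field_simp

/-- The factor 1 - σ_X σ_Y has size |x-y|/R and cancels one power of the singularity, while 1 - q² ≤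
ε/R. The difference is thus dominated by an approximate identity and only sees u near x. -/
theorem norm_smoothKernel_sub_truncatedKernel_le (hR : 0 < R) {ε : ℝ} (hε : 0 < ε) {x y : E3}
    (hx : x ∈ Metric.sphere c R) (hy : y ∈ Metric.sphere c R) (ξ : Spinor) :
    ‖smoothKernel c R ε x y ξ - truncatedKernel c R ε x y ξ‖ ≤
      7 / R * (poissonProfile ε ‖x - y‖ * ‖ξ‖) := by
  set δ := ‖x - y‖ with hδ
  set q := poissonRadius (ε / R) with hq
  set Z := sigmaAct (sphereMap c R x) (sigmaAct (sphereMap c R y) ξ) with hZ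
  have hδ0 : 0 ≤ δ := norm_nonneg _
  have hq2 : 1 - q ^ 2 = ε / R * q := by rw [poissonRadius_sq]; ring
  have hq1 : q < 1 := poissonRadius_lt_one (by positivity)
  have hq0 : 0 < q := poissonRadius_pos _
  have hqe : 1 - q ^ 2 ≤ ε / R := by
    rw [hq2]
    exact mul_le_of_le_one_right (by positivity) hq1.le
  have hqe0 : 0 ≤ 1 - q ^ 2 := by rw [hq2]; positivity
  have hZn : ‖Z‖ = ‖ξ‖ := by
    rw [hZ, norm_sigmaAct_apply, norm_sigmaAct_apply, norm_sphereMap hR hx, norm_sphereMap hR hy,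
      one_mul, one_mul]
  have h1 : ‖ξ - Z‖ = R⁻¹ * δ * ‖ξ‖ := norm_sub_sigmaAct hR hx ξ
  have hsplit : ξ - q ^ 2 • Z = (ξ - Z) + (1 - q ^ 2) • Z := by module
  set s := (√(ε ^ 2 + δ ^ 2) ^ 3)⁻¹ with hs
  have hs0 : 0 ≤ s := by positivity
  have hp : poissonProfile ε δ = ε * s := by rw [poissonProfile, hs, div_eq_mul_inv]
  have hp0 : 0 ≤ poissonProfile ε δ := poissonProfile_nonneg hε.le _
  have h2 : ‖s • (1 - q ^ 2) • Z‖ ≤ 1 / R * (poissonProfile ε δ * ‖ξ‖) := by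
    rw [norm_smul, norm_smul, hZn, Real.norm_of_nonneg hs0, Real.norm_of_nonneg hqe0, hp]
    calc s * ((1 - q ^ 2) * ‖ξ‖) ≤ s * (ε / R * ‖ξ‖) := by gcongr
      _ = _ := by ring
  rw [smoothKernel, truncatedKernel, ← hδ, ← hq, ← hZ, ← hs, hsplit, smul_add]
  split_ifs with h
  · have h3 : s • (ξ - Z) + s • (1 - q ^ 2) • Z - (δ ^ 3)⁻¹ • (ξ - Z) =
        s • (1 - q ^ 2) • Z - ((δ ^ 3)⁻¹ - s) • (ξ - Z) := by module
    rw [h3]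
    have h4 : ‖((δ ^ 3)⁻¹ - s) • (ξ - Z)‖ ≤ 6 / R * (poissonProfile ε δ * ‖ξ‖) := by
      have h5 : 0 ≤ (δ ^ 3)⁻¹ - s := by
        have hδ1 : 0 < δ := hε.trans h
        rw [sub_nonneg, hs]
        gcongr
        exact Real.le_sqrt_of_sq_le (by nlinarith)
      rw [norm_smul, h1, Real.norm_of_nonneg h5]
      calc ((δ ^ 3)⁻¹ - s) * (R⁻¹ * δ * ‖ξ‖) = R⁻¹ * ‖ξ‖ * (δ * ((δ ^ 3)⁻¹ - s)) := by ring
        _ ≤ R⁻¹ * ‖ξ‖ * (6 * poissonProfile ε δ) := by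
          exact mul_le_mul_of_nonneg_left (inv_cube_sub_le hε h) (by positivity)
        _ = _ := by ring
    calc _ ≤ _ := norm_sub_le _ _
      _ ≤ 1 / R * (poissonProfile ε δ * ‖ξ‖) + 6 / R * (poissonProfile ε δ * ‖ξ‖) := add_le_add h2 h4
      _ = _ := by ring
  · rw [zero_smul, sub_zero]
    have h4 : ‖s • (ξ - Z)‖ ≤ 1 / R * (poissonProfile ε δ * ‖ξ‖) := by
      rw [norm_smul, h1, Real.norm_of_nonneg hs0, hp]
      calc s * (R⁻¹ * δ * ‖ξ‖) ≤ s * (R⁻¹ * ε * ‖ξ‖) := by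
            gcongr
            exact not_lt.1 h
        _ = _ := by ring
    calc _ ≤ _ := norm_add_le _ _
      _ ≤ 1 / R * (poissonProfile ε δ * ‖ξ‖) + 1 / R * (poissonProfile ε δ * ‖ξ‖) := add_le_add h4 h2
      _ = 2 / R * (poissonProfile ε δ * ‖ξ‖) := by ring
      _ ≤ _ := by gcongr; norm_num

end Ball

/-! ### The limit of regularised minus truncated integrals. -/

section Ball

variable {c : E3} {R : ℝ}

theorem inv_sqrt_pow_three_le {ε : ℝ} (hε : 0 < ε) (δ : ℝ) :
    (√(ε ^ 2 + δ ^ 2) ^ 3)⁻¹ ≤ (ε ^ 3)⁻¹ := by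
  gcongr
  exact Real.le_sqrt_of_sq_le (by nlinarith [sq_nonneg δ])

theorem truncated_inv_le {ε : ℝ} (hε : 0 < ε) (δ : ℝ) :
    (if ε < δ then (δ ^ 3)⁻¹ else 0) ≤ (ε ^ 3)⁻¹ := by
  split_ifs with h
  · gcongr
  · positivity

theorem truncated_inv_nonneg {ε : ℝ} (hε : 0 < ε) (δ : ℝ) :
    0 ≤ (if ε < δ then (δ ^ 3)⁻¹ else 0) := by
  split_ifs with h
  · have := hε.trans h
    positivity
  · rfl

theorem measurable_truncated_inv (ε : ℝ) : Measurable fun δ : ℝ => if ε < δ then (δ ^ 3)⁻¹ else 0 :=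
  Measurable.ite measurableSet_Ioi (by fun_prop) measurable_const

theorem measurable_inv_sqrt_pow_three (ε : ℝ) : Measurable fun δ : ℝ => (√(ε ^ 2 + δ ^ 2) ^ 3)⁻¹ := by
  fun_prop

theorem integrable_zonal [IsFiniteMeasure (surfaceMeasure (Metric.ball c R))] (x : E3) {g : ℝ → ℝ}
    (hg : Measurable g) {M : ℝ} (h0 : ∀ δ, 0 ≤ g δ) (hM : ∀ δ, g δ ≤ M) :
    Integrable (fun y => g ‖x - y‖) (surfaceMeasure (Metric.ball c R)) := by
  have hm : Measurable fun y : E3 => g ‖x - y‖ := hg.comp (by fun_prop)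
  refine Integrable.of_bound hm.aestronglyMeasurable M (Eventually.of_forall fun y => ?_)
  rw [Real.norm_of_nonneg (h0 _)]
  exact hM _

theorem integrable_zonal_smul {x : E3} (hR : 0 < R) (hx : x ∈ Metric.sphere c R) {g : ℝ → ℝ}
    (hg : Measurable g) {M : ℝ} (h0 : ∀ δ, 0 ≤ g δ) (hM : ∀ δ, g δ ≤ M) {u : E3 → Spinor}
    (hu : Integrable u (surfaceMeasure (Metric.ball c R))) (a : ℝ) :
    Integrable (fun y => g ‖x - y‖ • (u y - a • sigmaAct (sphereMap c R x)
      (sigmaAct (sphereMap c R y) (u y)))) (surfaceMeasure (Metric.ball c R)) := by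
  have hm : Measurable fun y : E3 => g ‖x - y‖ := hg.comp (by fun_prop)
  have hc : Continuous fun y => sigmaAct (sphereMap c R y) :=
    continuous_sigmaAct.comp (continuous_sphereMap c R)
  have hi : Integrable (fun y => u y - a • sigmaAct (sphereMap c R x)
      (sigmaAct (sphereMap c R y) (u y))) (surfaceMeasure (Metric.ball c R)) := by
    refine hu.sub (Integrable.fun_smul a (Integrable.mono hu
      ((sigmaAct _).continuous.comp_aestronglyMeasurable
        (aestronglyMeasurable_clm_apply hc.aestronglyMeasurable hu.1)) ?_))
    filter_upwards [ae_mem_sphere hR] with y hy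
    rw [norm_sigmaAct_apply, norm_sigmaAct_apply, norm_sphereMap hR hx, norm_sphereMap hR hy,
      one_mul, one_mul]
  exact hi.bdd_smul M hm.aestronglyMeasurable (Eventually.of_forall fun y => by
    rw [Real.norm_of_nonneg (h0 _)]
    exact hM _)

theorem integrable_smoothKernel {x : E3} (hR : 0 < R) (hx : x ∈ Metric.sphere c R) {ε : ℝ}
    (hε : 0 < ε) {u : E3 → Spinor} (hu : Integrable u (surfaceMeasure (Metric.ball c R))) :
    Integrable (fun y => smoothKernel c R ε x y (u y)) (surfaceMeasure (Metric.ball c R)) :=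
  integrable_zonal_smul hR hx (measurable_inv_sqrt_pow_three ε) (fun δ => by positivity)
    (inv_sqrt_pow_three_le hε) hu _

theorem integrable_truncatedKernel {x : E3} (hR : 0 < R) (hx : x ∈ Metric.sphere c R) {ε : ℝ}
    (hε : 0 < ε) {u : E3 → Spinor} (hu : Integrable u (surfaceMeasure (Metric.ball c R))) :
    Integrable (fun y => truncatedKernel c R ε x y (u y)) (surfaceMeasure (Metric.ball c R)) := by
  simpa only [one_smul, truncatedKernel] using
    integrable_zonal_smul hR hx (measurable_truncated_inv ε)
    (truncated_inv_nonneg hε) (truncated_inv_le hε) hu 1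

theorem integrable_inv_norm_sub (hΩ : IsBoundedC1Domain (Metric.ball c R)) (x : E3) :
    Integrable (fun y => ‖x - y‖⁻¹) (surfaceMeasure (Metric.ball c R)) := by
  obtain ⟨C, hC⟩ := hΩ.exists_lintegral_inv_norm_sub_le
  have hm : Measurable fun y : E3 => ‖x - y‖⁻¹ := by fun_prop
  refine ⟨hm.aestronglyMeasurable, ?_⟩
  rw [hasFiniteIntegral_iff_ofReal (Eventually.of_forall fun y => by positivity)]
  exact (hC x).trans_lt ENNReal.ofReal_lt_top

/-- The regularised and the truncated second moments have the same finite limit, so they cancel when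
the two kernels are compared on constants. -/
theorem tendsto_integral_smooth_mul_sq (hΩ : IsBoundedC1Domain (Metric.ball c R)) (x : E3) :
    Tendsto (fun ε => ∫ y, (√(ε ^ 2 + ‖x - y‖ ^ 2) ^ 3)⁻¹ * ‖x - y‖ ^ 2
      ∂surfaceMeasure (Metric.ball c R)) (𝓝[>] 0)
      (𝓝 (∫ y, ‖x - y‖⁻¹ ∂surfaceMeasure (Metric.ball c R))) := by
  refine tendsto_integral_filter_of_dominated_convergence (fun y => ‖x - y‖⁻¹) ?_ ?_
    (integrable_inv_norm_sub hΩ x) (Eventually.of_forall fun y => ?_)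
  · refine Eventually.of_forall fun ε => ?_
    have : Measurable fun y => (√(ε ^ 2 + ‖x - y‖ ^ 2) ^ 3)⁻¹ * ‖x - y‖ ^ 2 := by fun_prop
    exact this.aestronglyMeasurable
  · refine Eventually.of_forall fun ε => Eventually.of_forall fun y => ?_
    rcases (norm_nonneg (x - y)).eq_or_lt' with h | h
    · rw [h]; simp
    rw [Real.norm_of_nonneg (by positivity)]
    have h1 : ‖x - y‖ ≤ √(ε ^ 2 + ‖x - y‖ ^ 2) :=
      Real.le_sqrt_of_sq_le (by nlinarith [sq_nonneg ε])
    calc (√(ε ^ 2 + ‖x - y‖ ^ 2) ^ 3)⁻¹ * ‖x - y‖ ^ 2 ≤ (‖x - y‖ ^ 3)⁻¹ * ‖x - y‖ ^ 2 := by gcongr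
      _ = ‖x - y‖⁻¹ := by field_simp
  · rcases (norm_nonneg (x - y)).eq_or_lt' with h | h
    · rw [h]; simp
    have hc : ContinuousAt (fun ε : ℝ => (√(ε ^ 2 + ‖x - y‖ ^ 2) ^ 3)⁻¹ * ‖x - y‖ ^ 2) 0 := by
      refine ContinuousAt.mul (ContinuousAt.inv₀ (by fun_prop) ?_) continuousAt_const
      have : 0 < √((0 : ℝ) ^ 2 + ‖x - y‖ ^ 2) := Real.sqrt_pos.2 (by positivity)
      positivity
    have h1 := hc.tendsto.mono_left (nhdsWithin_le_nhds (s := Set.Ioi 0))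
    have h2 : (√((0 : ℝ) ^ 2 + ‖x - y‖ ^ 2) ^ 3)⁻¹ * ‖x - y‖ ^ 2 = ‖x - y‖⁻¹ := by
      rw [zero_pow two_ne_zero, zero_add, Real.sqrt_sq h.le]
      field_simp
    rwa [h2] at h1

theorem tendsto_integral_truncated_mul_sq (hΩ : IsBoundedC1Domain (Metric.ball c R)) (x : E3) :
    Tendsto (fun ε => ∫ y, (if ε < ‖x - y‖ then (‖x - y‖ ^ 3)⁻¹ else 0) * ‖x - y‖ ^ 2
      ∂surfaceMeasure (Metric.ball c R)) (𝓝[>] 0)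
      (𝓝 (∫ y, ‖x - y‖⁻¹ ∂surfaceMeasure (Metric.ball c R))) := by
  have key : ∀ δ : ℝ, (δ ^ 3)⁻¹ * δ ^ 2 = δ⁻¹ := fun δ => by
    rcases eq_or_ne δ 0 with rfl | h
    · simp
    · field_simp
  refine tendsto_integral_filter_of_dominated_convergence (fun y => ‖x - y‖⁻¹) ?_ ?_
    (integrable_inv_norm_sub hΩ x) (Eventually.of_forall fun y => ?_)
  · refine Eventually.of_forall fun ε => ?_
    have h1 : Measurable fun y : E3 => ‖x - y‖ := by fun_prop
    exact (((measurable_truncated_inv ε).comp h1).mul (h1.pow_const 2)).aestronglyMeasurable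
  · refine Eventually.of_forall fun ε => Eventually.of_forall fun y => ?_
    split_ifs
    · rw [key, Real.norm_of_nonneg (by positivity)]
    · simp
  · rcases (norm_nonneg (x - y)).eq_or_lt' with h | h
    · rw [h]; simp
    refine tendsto_const_nhds.congr' ?_
    filter_upwards [mem_nhdsWithin_of_mem_nhds (gt_mem_nhds h)] with ε hε
    rw [if_pos hε, key]

/-- Zonal averaging replaces σ_X σ_Y by X·Y = 1 - |x-y|²/(2R²). The remaining factor 1 - q² = qε/R
turns the most singular term into a Poisson profile. -/
theorem integral_smoothKernel_const (hΩ : IsBoundedC1Domain (Metric.ball c R)) (hR : 0 < R) {x : E3}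
    (hx : x ∈ Metric.sphere c R) {ε : ℝ} (hε : 0 < ε) (ξ : Spinor) :
    ∫ y, smoothKernel c R ε x y ξ ∂surfaceMeasure (Metric.ball c R) =
      (poissonRadius (ε / R) / R * ∫ y, poissonProfile ε ‖x - y‖ ∂surfaceMeasure (Metric.ball c R) +
        poissonRadius (ε / R) ^ 2 / (2 * R ^ 2) *
          ∫ y, (√(ε ^ 2 + ‖x - y‖ ^ 2) ^ 3)⁻¹ * ‖x - y‖ ^ 2
            ∂surfaceMeasure (Metric.ball c R)) • ξ := by
  have := hΩ.isFiniteMeasure_surfaceMeasure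
  set σ := surfaceMeasure (Metric.ball c R)
  set q := poissonRadius (ε / R) with hq
  have hg := measurable_inv_sqrt_pow_three ε
  have hgi : Integrable (fun y => (√(ε ^ 2 + ‖x - y‖ ^ 2) ^ 3)⁻¹) σ :=
    integrable_zonal x hg (fun δ => by positivity) (inv_sqrt_pow_three_le hε)
  obtain ⟨h1, h2⟩ := integral_zonal_smul_sigmaAct hR hx hg hgi ξ
  have hgi2 : Integrable (fun y => (√(ε ^ 2 + ‖x - y‖ ^ 2) ^ 3)⁻¹ * ‖x - y‖ ^ 2) σ := by
    refine (hgi.mul_const ((2 * R) ^ 2)).mono' ?_ ?_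
    · have : Measurable fun y => (√(ε ^ 2 + ‖x - y‖ ^ 2) ^ 3)⁻¹ * ‖x - y‖ ^ 2 := by fun_prop
      exact this.aestronglyMeasurable
    · filter_upwards [ae_mem_sphere hR] with y hy
      rw [Real.norm_of_nonneg (by positivity)]
      gcongr
      exact norm_sub_le_of_mem_sphere hx hy
  have e1 : ∀ y, smoothKernel c R ε x y ξ = (√(ε ^ 2 + ‖x - y‖ ^ 2) ^ 3)⁻¹ • ξ -
      q ^ 2 • (√(ε ^ 2 + ‖x - y‖ ^ 2) ^ 3)⁻¹ •
        sigmaAct (sphereMap c R x) (sigmaAct (sphereMap c R y) ξ) := fun y => by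
    rw [smoothKernel, smul_sub, ← hq, smul_comm (q ^ 2)]
  have e2 : ∫ y, (√(ε ^ 2 + ‖x - y‖ ^ 2) ^ 3)⁻¹ * (1 - ‖x - y‖ ^ 2 / (2 * R ^ 2)) ∂σ =
      ∫ y, (√(ε ^ 2 + ‖x - y‖ ^ 2) ^ 3)⁻¹ ∂σ -
        (2 * R ^ 2)⁻¹ * ∫ y, (√(ε ^ 2 + ‖x - y‖ ^ 2) ^ 3)⁻¹ * ‖x - y‖ ^ 2 ∂σ := by
    rw [← integral_const_mul, ← integral_sub hgi (hgi2.const_mul _)]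
    refine integral_congr_ae (Eventually.of_forall fun y => ?_)
    simp only
    ring
  have e3 : ∫ y, poissonProfile ε ‖x - y‖ ∂σ = ε * ∫ y, (√(ε ^ 2 + ‖x - y‖ ^ 2) ^ 3)⁻¹ ∂σ := by
    rw [← integral_const_mul]
    rfl
  simp_rw [e1]
  rw [integral_sub (hgi.smul_const ξ) (h1.fun_smul (q ^ 2)), integral_smul, h2, integral_smul_const,
    e2, e3, smul_smul, ← sub_smul]
  congr 1
  have hq2 : q ^ 2 = 1 - ε / R * q := poissonRadius_sq _
  have : q ^ 2 * (∫ y, (√(ε ^ 2 + ‖x - y‖ ^ 2) ^ 3)⁻¹ ∂σ) =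
      (1 - ε / R * q) * ∫ y, (√(ε ^ 2 + ‖x - y‖ ^ 2) ^ 3)⁻¹ ∂σ := by rw [hq2]
  rw [mul_sub, this]
  ring

theorem integral_truncatedKernel_const (hΩ : IsBoundedC1Domain (Metric.ball c R)) (hR : 0 < R)
    {x : E3} (hx : x ∈ Metric.sphere c R) {ε : ℝ} (hε : 0 < ε) (ξ : Spinor) :
    ∫ y, truncatedKernel c R ε x y ξ ∂surfaceMeasure (Metric.ball c R) =
      ((2 * R ^ 2)⁻¹ * ∫ y, (if ε < ‖x - y‖ then (‖x - y‖ ^ 3)⁻¹ else 0) * ‖x - y‖ ^ 2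
            ∂surfaceMeasure (Metric.ball c R)) • ξ := by
  have := hΩ.isFiniteMeasure_surfaceMeasure
  set σ := surfaceMeasure (Metric.ball c R)
  have hg := measurable_truncated_inv ε
  have hgi : Integrable (fun y => if ε < ‖x - y‖ then (‖x - y‖ ^ 3)⁻¹ else 0) σ :=
    integrable_zonal x hg (truncated_inv_nonneg hε) (truncated_inv_le hε)
  obtain ⟨h1, h2⟩ := integral_zonal_smul_sigmaAct hR hx hg hgi ξ
  have hgi2 : Integrable (fun y => (if ε < ‖x - y‖ then (‖x - y‖ ^ 3)⁻¹ else 0) * ‖x - y‖ ^ 2) σ := by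
    have hm : Measurable fun y : E3 => ‖x - y‖ := by fun_prop
    refine (hgi.mul_const ((2 * R) ^ 2)).mono'
      (((hg.comp hm).mul (hm.pow_const 2)).aestronglyMeasurable) ?_
    filter_upwards [ae_mem_sphere hR] with y hy
    have := truncated_inv_nonneg hε ‖x - y‖
    rw [Real.norm_of_nonneg (by positivity)]
    gcongr
    exact norm_sub_le_of_mem_sphere hx hy
  have e2 : ∫ y, (if ε < ‖x - y‖ then (‖x - y‖ ^ 3)⁻¹ else 0) * (1 - ‖x - y‖ ^ 2 / (2 * R ^ 2)) ∂σ =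
      ∫ y, (if ε < ‖x - y‖ then (‖x - y‖ ^ 3)⁻¹ else 0) ∂σ -
        (2 * R ^ 2)⁻¹ * ∫ y, (if ε < ‖x - y‖ then (‖x - y‖ ^ 3)⁻¹ else 0) * ‖x - y‖ ^ 2 ∂σ := by
    rw [← integral_const_mul, ← integral_sub hgi (hgi2.const_mul _)]
    refine integral_congr_ae (Eventually.of_forall fun y => ?_)
    simp only
    ring
  simp_rw [truncatedKernel, smul_sub]
  rw [integral_sub (hgi.smul_const ξ) h1, h2, integral_smul_const, e2, ← sub_smul]
  congr 1
  ring

/-- The jump term: of the two formulas only the Poisson mass, 2π for a surface of density π,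
survives, divided by R. -/
theorem tendsto_integral_kernel_sub_const (hΩ : IsBoundedC1Domain (Metric.ball c R)) (hR : 0 < R)
    {x : E3} (hx : x ∈ Metric.sphere c R) (ξ : Spinor) :
    Tendsto (fun ε => ∫ y, smoothKernel c R ε x y ξ ∂surfaceMeasure (Metric.ball c R) -
      ∫ y, truncatedKernel c R ε x y ξ ∂surfaceMeasure (Metric.ball c R)) (𝓝[>] 0)
      (𝓝 ((2 * Real.pi / R) • ξ)) := by
  have := hΩ.isFiniteMeasure_surfaceMeasure
  have hq := tendsto_poissonRadius R
  have hp := tendsto_integral_poissonProfile (hΩ.tendsto_surfaceMeasure_ball (x := x)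
    (by rwa [frontier_ball c hR.ne']))
  have h1 := ((hq.div_const R).mul hp).add (((hq.pow 2).div_const (2 * R ^ 2)).mul
    (tendsto_integral_smooth_mul_sq hΩ x))
  have h2 := (h1.sub ((tendsto_integral_truncated_mul_sq hΩ x).const_mul (2 * R ^ 2)⁻¹)).smul_const ξ
  have e : 1 / R * (2 * Real.pi) + 1 ^ 2 / (2 * R ^ 2) *
      ∫ y, ‖x - y‖⁻¹ ∂surfaceMeasure (Metric.ball c R) -
      (2 * R ^ 2)⁻¹ * ∫ y, ‖x - y‖⁻¹ ∂surfaceMeasure (Metric.ball c R) = 2 * Real.pi / R := by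
    ring
  rw [e] at h2
  refine h2.congr' ?_
  filter_upwards [self_mem_nhdsWithin] with ε hε
  rw [integral_smoothKernel_const hΩ hR hx hε, integral_truncatedKernel_const hΩ hR hx hε, sub_smul]

theorem smoothKernel_sub_apply (ε : ℝ) (x y : E3) (ξ η : Spinor) :
    smoothKernel c R ε x y (ξ - η) = smoothKernel c R ε x y ξ - smoothKernel c R ε x y η := by
  simp only [smoothKernel, map_sub]
  module

theorem truncatedKernel_sub_apply (ε : ℝ) (x y : E3) (ξ η : Spinor) :
    truncatedKernel c R ε x y (ξ - η) =
      truncatedKernel c R ε x y ξ - truncatedKernel c R ε x y η := by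
  simp only [truncatedKernel, map_sub]
  module

theorem integrable_poissonProfile_mul {μ : Measure E3} {x : E3} {ε : ℝ} (hε : 0 < ε) {f : E3 → ℝ}
    (hf : Integrable f μ) : Integrable (fun y => poissonProfile ε ‖x - y‖ * f y) μ := by
  have hc : Continuous fun y : E3 => poissonProfile ε ‖x - y‖ :=
    (continuous_poissonProfile hε).comp (by fun_prop)
  refine hf.bdd_mul (c := ε * (ε ^ 3)⁻¹) hc.aestronglyMeasurable (Eventually.of_forall fun y => ?_)
  rw [Real.norm_of_nonneg (poissonProfile_nonneg hε.le _), poissonProfile, div_eq_mul_inv]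
  exact mul_le_mul_of_nonneg_left (inv_sqrt_pow_three_le hε _) hε.le

/-- The regularized and the truncated integrals differ by a multiple of the density. -/
theorem tendsto_integral_kernel_sub (hΩ : IsBoundedC1Domain (Metric.ball c R)) (hR : 0 < R)
    {x : E3} (hx : x ∈ Metric.sphere c R) {u : E3 → Spinor}
    (hu : Integrable u (surfaceMeasure (Metric.ball c R)))
    (h : Tendsto (fun ε => ∫ y, poissonProfile ε ‖x - y‖ * ‖u y - u x‖
      ∂surfaceMeasure (Metric.ball c R)) (𝓝[>] 0) (𝓝 0)) :
    Tendsto (fun ε => ∫ y, smoothKernel c R ε x y (u y) ∂surfaceMeasure (Metric.ball c R) -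
      ∫ y, truncatedKernel c R ε x y (u y) ∂surfaceMeasure (Metric.ball c R)) (𝓝[>] 0)
      (𝓝 ((2 * Real.pi / R) • u x)) := by
  have := hΩ.isFiniteMeasure_surfaceMeasure
  set σ := surfaceMeasure (Metric.ball c R)
  have h1 : Tendsto (fun ε => ∫ y, (smoothKernel c R ε x y (u y - u x) -
      truncatedKernel c R ε x y (u y - u x)) ∂σ) (𝓝[>] 0) (𝓝 0) := by
    have h2 := h.const_mul (7 / R)
    rw [mul_zero] at h2
    refine squeeze_zero_norm' ?_ h2
    filter_upwards [self_mem_nhdsWithin] with ε hε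
    have hε : 0 < ε := hε
    rw [← integral_const_mul]
    refine norm_integral_le_of_norm_le ((integrable_poissonProfile_mul hε
      (hu.sub (integrable_const (u x))).norm).const_mul _) ?_
    filter_upwards [ae_mem_sphere hR] with y hy
    exact norm_smoothKernel_sub_truncatedKernel_le hR hε hx hy _
  have h3 := h1.add (tendsto_integral_kernel_sub_const hΩ hR hx (u x))
  rw [zero_add] at h3
  refine h3.congr' ?_
  filter_upwards [self_mem_nhdsWithin] with ε hε
  have hc : Integrable (fun _ : E3 => u x) σ := integrable_const _
  have i1 := integrable_smoothKernel hR hx hε hu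
  have i2 := integrable_smoothKernel hR hx hε hc
  have i3 := integrable_truncatedKernel hR hx hε hu
  have i4 := integrable_truncatedKernel hR hx hε hc
  simp_rw [smoothKernel_sub_apply, truncatedKernel_sub_apply]
  have i5 : Integrable (fun y => smoothKernel c R ε x y (u y) - smoothKernel c R ε x y (u x)) σ :=
    i1.sub i2
  have i6 : Integrable (fun y => truncatedKernel c R ε x y (u y) - truncatedKernel c R ε x y (u x)) σ :=
    i3.sub i4
  rw [integral_sub i5 i6, integral_sub i1 i2, integral_sub i3 i4]
  abel

end Ball

/-! ### The Hardy space of the sphere and the principal values -/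

section Ball

variable {c : E3} {R : ℝ}

/-- The Hardy space of the ball: the closed span of the Cauchy kernels. -/
noncomputable def hardySpace (c : E3) (R : ℝ) : Submodule ℂ (BoundaryL2 (Metric.ball c R)) :=
  (Submodule.span ℂ {u : BoundaryL2 (Metric.ball c R) | ∃ (b : E3) (ξ : Spinor), ‖b‖ < 1 ∧
    u =ᵐ[surfaceMeasure (Metric.ball c R)]
      fun y => cauchyKernel b ξ (sphereMap c R y)}).topologicalClosure

theorem memLp_cauchyKernel (hΩ : IsBoundedC1Domain (Metric.ball c R)) (hR : 0 < R) {b : E3}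
    (hb : ‖b‖ < 1) (ξ : Spinor) :
    MemLp (fun y => cauchyKernel b ξ (sphereMap c R y)) 2 (surfaceMeasure (Metric.ball c R)) := by
  have := hΩ.isFiniteMeasure_surfaceMeasure
  have hc : ContinuousOn (cauchyKernel b ξ) (Metric.sphere 0 1) :=
    (contDiffOn_cauchyKernel ξ fun y hy => by
      rw [mem_sphere_zero_iff_norm] at hy
      rwa [hy, one_mul]).continuousOn
  have hc' : ContinuousOn (fun y => cauchyKernel b ξ (sphereMap c R y)) (Metric.sphere c R) :=
    hc.comp (continuous_sphereMap c R).continuousOn fun y hy => by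
      simpa using norm_sphereMap hR hy
  have hm : AEStronglyMeasurable (fun y => cauchyKernel b ξ (sphereMap c R y))
      (surfaceMeasure (Metric.ball c R)) := by
    have h1 : (surfaceMeasure (Metric.ball c R)).restrict (Metric.sphere c R) =
        surfaceMeasure (Metric.ball c R) :=
      Measure.restrict_eq_self_of_ae_mem (ae_mem_sphere hR)
    rw [← h1]
    exact hc'.aestronglyMeasurable_of_isCompact (isCompact_sphere _ _)
      Metric.isClosed_sphere.measurableSet
  obtain ⟨C, hC⟩ := (isCompact_sphere c R).exists_bound_of_continuousOn hc'
  exact MemLp.of_bound hm C ((ae_mem_sphere hR).mono hC)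

theorem toLp_cauchyKernel_mem (hΩ : IsBoundedC1Domain (Metric.ball c R)) (hR : 0 < R) {b : E3}
    (hb : ‖b‖ < 1) (ξ : Spinor) : (memLp_cauchyKernel hΩ hR hb ξ).toLp ∈ hardySpace c R :=
  Submodule.le_topologicalClosure _ (Submodule.subset_span ⟨b, ξ, hb, MemLp.coeFn_toLp _⟩)

theorem sigmaNu_ball_ae (hΩ : IsBoundedC1Domain (Metric.ball c R)) (hR : 0 < R)
    (u : BoundaryL2 (Metric.ball c R)) : hΩ.sigmaNu u =ᵐ[surfaceMeasure (Metric.ball c R)]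
      fun y => sigmaAct (sphereMap c R y) (u y) := by
  filter_upwards [hΩ.coeFn_sigmaNu u, ae_mem_sphere hR] with y h1 h2
  rw [h1, outwardNormal_ball hR h2]

/-- Multiplication by `σ·ν` maps the Hardy space to its orthogonal complement. -/
theorem inner_cauchyKernel_sigmaNu (hΩ : IsBoundedC1Domain (Metric.ball c R)) (hR : 0 < R) {b : E3}
    (hb : ‖b‖ < 1) (ξ : Spinor) {k : BoundaryL2 (Metric.ball c R)} (hk : k ∈ hardySpace c R) :
    inner ℂ ((memLp_cauchyKernel hΩ hR hb ξ).toLp : BoundaryL2 (Metric.ball c R))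
      (hΩ.sigmaNu k) = 0 := by
  rw [← hΩ.inner_sigmaNu_left]
  set f : BoundaryL2 (Metric.ball c R) := (memLp_cauchyKernel hΩ hR hb ξ).toLp with hf
  have hfae : f =ᵐ[surfaceMeasure (Metric.ball c R)] fun y => cauchyKernel b ξ (sphereMap c R y) :=
    MemLp.coeFn_toLp _
  -- Orthogonality to a closed span is tested on the generators, where it is Cauchy's theorem for
  -- two Cauchy kernels.
  have key : hΩ.sigmaNu f ∈ (hardySpace c R)ᗮ := by
    rw [hardySpace, Submodule.orthogonal_closure, Submodule.mem_orthogonal]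
    intro u hu
    induction hu using Submodule.span_induction with
    | mem u hu =>
      obtain ⟨a, η, ha, hae⟩ := hu
      rw [L2.inner_def, ← (isSphereMeasure_map hΩ hR).integral_inner_cauchyKernel ha hb η ξ,
        integral_sphereMap hR]
      refine integral_congr_ae ?_
      filter_upwards [hae, hfae, sigmaNu_ball_ae hΩ hR f] with y h1 h2 h3
      rw [h1, h3, h2]
    | zero => exact inner_zero_left _
    | add u v _ _ hu hv => rw [inner_add_left, hu, hv, add_zero]
    | smul a u _ hu => rw [inner_smul_left, hu, mul_zero]
  exact Submodule.inner_left_of_mem_orthogonal hk key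

/-- The choice 1/q - q = ε/R is made for this: at b = q²X the Cauchy denominator is (1-q²)² +
q²|x-y|²/R² = (q/R)²(ε²+|x-y|²). -/
theorem inner_smoothKernel (hR : 0 < R) {ε : ℝ} (hε : 0 < ε) {x y : E3} (hx : x ∈ Metric.sphere c R)
    (hy : y ∈ Metric.sphere c R) (ξ η : Spinor) :
    inner ℂ ξ (smoothKernel c R ε x y η) = (((poissonRadius (ε / R) / R) ^ 3 : ℝ) : ℂ) *
      inner ℂ (cauchyKernel (poissonRadius (ε / R) ^ 2 • sphereMap c R x) ξ (sphereMap c R y)) η := by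
  set q := poissonRadius (ε / R) with hq
  have hq0 : 0 < q := poissonRadius_pos _
  have hq2 : q ^ 2 = 1 - ε / R * q := poissonRadius_sq _
  have hden : cauchyDenom (q ^ 2 • sphereMap c R x) (sphereMap c R y) =
      (q / R) ^ 2 * (ε ^ 2 + ‖x - y‖ ^ 2) := by
    rw [cauchyDenom, inner_smul_right, real_inner_comm, inner_sphereMap hR hx hy, norm_smul,
      norm_sphereMap hR hx, norm_sphereMap hR hy, Real.norm_of_nonneg (by positivity)]
    have e : (q / R) ^ 2 * ε ^ 2 = (1 - q ^ 2) ^ 2 := by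
      rw [hq2]
      ring
    rw [mul_add, e]
    field_simp
    ring
  have hs : √(cauchyDenom (q ^ 2 • sphereMap c R x) (sphereMap c R y)) =
      q / R * √(ε ^ 2 + ‖x - y‖ ^ 2) := by
    rw [hden, Real.sqrt_mul (by positivity), Real.sqrt_sq (by positivity)]
  have hs0 : 0 < √(ε ^ 2 + ‖x - y‖ ^ 2) := Real.sqrt_pos.2 (by positivity)
  rw [smoothKernel, cauchyKernel, hs, ← hq, ← Complex.coe_smul (√(ε ^ 2 + ‖x - y‖ ^ 2) ^ 3)⁻¹,
    ← Complex.coe_smul ((q / R * √(ε ^ 2 + ‖x - y‖ ^ 2)) ^ 3)⁻¹, inner_smul_right,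
    inner_smul_left, Complex.conj_ofReal, ← mul_assoc, ← Complex.ofReal_mul]
  congr 1
  · congr 1
    field_simp
  · rw [inner_sub_left, inner_sub_right, sigmaAct_smul, smul_apply, ← Complex.coe_smul (q ^ 2),
      ← Complex.coe_smul (q ^ 2), map_smul, inner_smul_left, inner_smul_right, Complex.conj_ofReal,
      inner_sigmaAct_left, inner_sigmaAct_left]

/-- Every component of the regularised integral is a pairing with one Cauchy kernel f, which lies in
the Hardy space and is orthogonal to the image of that space under σ·ν. -/
theorem inner_integral_smoothKernel (hΩ : IsBoundedC1Domain (Metric.ball c R)) (hR : 0 < R) {ε : ℝ}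
    (hε : 0 < ε) {x : E3} (hx : x ∈ Metric.sphere c R) (ξ : Spinor) : ∃ f ∈ hardySpace c R,
      (∀ k ∈ hardySpace c R, inner ℂ f (hΩ.sigmaNu k) = 0) ∧
      ∀ u : BoundaryL2 (Metric.ball c R),
      inner ℂ ξ (∫ y, smoothKernel c R ε x y (u y) ∂surfaceMeasure (Metric.ball c R)) =
        (((poissonRadius (ε / R) / R) ^ 3 : ℝ) : ℂ) * inner ℂ f u := by
  have hb : ‖poissonRadius (ε / R) ^ 2 • sphereMap c R x‖ < 1 := by
    rw [norm_smul, norm_sphereMap hR hx, mul_one, norm_pow,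
      Real.norm_of_nonneg (poissonRadius_pos _).le]
    exact pow_lt_one₀ (poissonRadius_pos _).le (poissonRadius_lt_one (by positivity)) two_ne_zero
  refine ⟨_, toLp_cauchyKernel_mem hΩ hR hb ξ, fun k hk => inner_cauchyKernel_sigmaNu hΩ hR hb ξ hk,
    fun u => ?_⟩
  rw [← integral_inner (integrable_smoothKernel hR hx hε (Lp_integrable hΩ u)), L2.inner_def,
    ← integral_const_mul]
  refine integral_congr_ae ?_
  filter_upwards [ae_mem_sphere hR, (memLp_cauchyKernel hΩ hR hb ξ).coeFn_toLp] with y hy h1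
  rw [inner_smoothKernel hR hε hx hy, h1]

theorem integral_smoothKernel_of_mem_orthogonal (hΩ : IsBoundedC1Domain (Metric.ball c R))
    (hR : 0 < R) {ε : ℝ} (hε : 0 < ε) {x : E3} (hx : x ∈ Metric.sphere c R)
    {u : BoundaryL2 (Metric.ball c R)} (hu : u ∈ (hardySpace c R)ᗮ) :
    ∫ y, smoothKernel c R ε x y (u y) ∂surfaceMeasure (Metric.ball c R) = 0 := by
  refine ext_inner_left ℂ fun ξ => ?_
  obtain ⟨f, hf, -, h⟩ := inner_integral_smoothKernel hΩ hR hε hx ξ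
  rw [h, inner_zero_right, Submodule.inner_right_of_mem_orthogonal hf hu, mul_zero]

theorem integral_smoothKernel_sigmaNu (hΩ : IsBoundedC1Domain (Metric.ball c R))
    (hR : 0 < R) {ε : ℝ} (hε : 0 < ε) {x : E3} (hx : x ∈ Metric.sphere c R)
    {u : BoundaryL2 (Metric.ball c R)} (hu : u ∈ hardySpace c R) :
    ∫ y, smoothKernel c R ε x y (hΩ.sigmaNu u y) ∂surfaceMeasure (Metric.ball c R) = 0 := by
  refine ext_inner_left ℂ fun ξ => ?_
  obtain ⟨f, hf, h0, h⟩ := inner_integral_smoothKernel hΩ hR hε hx ξ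
  rw [h, inner_zero_right, h0 u hu, mul_zero]

/-- On the Hardy space the regularized integral is a Poisson integral. -/
theorem integral_smoothKernel_of_mem (hΩ : IsBoundedC1Domain (Metric.ball c R))
    (hR : 0 < R) {ε : ℝ} (hε : 0 < ε) {x : E3} (hx : x ∈ Metric.sphere c R)
    {u : BoundaryL2 (Metric.ball c R)} (hu : u ∈ hardySpace c R) :
    ∫ y, smoothKernel c R ε x y (u y) ∂surfaceMeasure (Metric.ball c R) =
      (poissonRadius (ε / R) * (1 + poissonRadius (ε / R) ^ 2) / R) •
        ∫ y, poissonProfile ε ‖x - y‖ • u y ∂surfaceMeasure (Metric.ball c R) := by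
  have huI : Integrable u (surfaceMeasure (Metric.ball c R)) := Lp_integrable hΩ u
  set q := poissonRadius (ε / R) with hq
  have hq2 : q ^ 2 = 1 - ε / R * q := poissonRadius_sq _
  have hi := integrable_smoothKernel hR hx hε huI
  have hi2 := integrable_smoothKernel hR hx hε (Lp_integrable hΩ (hΩ.sigmaNu u))
  have h0 := integral_smoothKernel_sigmaNu hΩ hR hε hx hu
  -- Adding q²σ_X times the vanishing integral of σ_Y u cancels the mixed terms, since q²σ_X(σ_Y -
  -- q²σ_X) = q²σ_Xσ_Y - q⁴. The kernel becomes the scalar 1 - q⁴ = q(1+q²)ε/R over the denominator.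
  have h1 : ∫ y, q ^ 2 • sigmaAct (sphereMap c R x) (smoothKernel c R ε x y (hΩ.sigmaNu u y))
      ∂surfaceMeasure (Metric.ball c R) = 0 := by
    rw [integral_smul, ContinuousLinearMap.integral_comp_comm _ hi2, h0, map_zero, smul_zero]
  have hi3 : Integrable (fun y => q ^ 2 • sigmaAct (sphereMap c R x)
      (smoothKernel c R ε x y (hΩ.sigmaNu u y))) (surfaceMeasure (Metric.ball c R)) :=
    ((sigmaAct (sphereMap c R x)).integrable_comp hi2).fun_smul _
  rw [← add_zero (∫ y, smoothKernel c R ε x y (u y) ∂_), ← h1, ← integral_add hi hi3, ← integral_smul]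
  refine integral_congr_ae ?_
  filter_upwards [ae_mem_sphere hR, sigmaNu_ball_ae hΩ hR u] with y hy hN
  have e1 : sigmaAct (sphereMap c R y) (sigmaAct (sphereMap c R y) (u y)) = u y := by
    rw [sigmaAct_sigmaAct, norm_sphereMap hR hy]
    simp
  have e2 : ∀ ξ, sigmaAct (sphereMap c R x) (sigmaAct (sphereMap c R x) ξ) = ξ := fun ξ => by
    rw [sigmaAct_sigmaAct, norm_sphereMap hR hx]
    simp
  have e3 : ∀ (a : ℝ) ξ, sigmaAct (sphereMap c R x) (a • ξ) = a • sigmaAct (sphereMap c R x) ξ :=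
    fun a ξ => by rw [← Complex.coe_smul, map_smul, Complex.coe_smul]
  rw [smoothKernel, smoothKernel, hN, e1, e3, map_sub, e3, e2, ← hq, poissonProfile]
  have e4 : q * (1 + q ^ 2) / R * (ε / √(ε ^ 2 + ‖x - y‖ ^ 2) ^ 3) =
      (√(ε ^ 2 + ‖x - y‖ ^ 2) ^ 3)⁻¹ * (1 - q ^ 2 * q ^ 2) := by
    have : 1 - q ^ 2 * q ^ 2 = ε / R * q * (1 + q ^ 2) := by linear_combination (-1 - q ^ 2) * hq2
    rw [this]
    ring
  rw [smul_smul (q * (1 + q ^ 2) / R), e4]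
  module

/-- The principal value on the sphere, in terms of the projection to the Hardy space. -/
theorem hasPrincipalValue_sigmaNu (hΩ : IsBoundedC1Domain (Metric.ball c R)) (hR : 0 < R)
    (u : BoundaryL2 (Metric.ball c R)) [(hardySpace c R).HasOrthogonalProjection] :
    ∀ᵐ x ∂surfaceMeasure (Metric.ball c R), HasPrincipalValue (Metric.ball c R) (hΩ.sigmaNu u) x
      (-Complex.I • ((hardySpace c R).starProjection u x - (1 / 2 : ℂ) • u x)) := by
  have := hΩ.isFiniteMeasure_surfaceMeasure
  set σ := surfaceMeasure (Metric.ball c R) with hσ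
  set k := (hardySpace c R).starProjection u with hk
  have hkm : k ∈ hardySpace c R := Submodule.starProjection_apply_mem _ _
  have huk : u - k ∈ (hardySpace c R)ᗮ := Submodule.sub_starProjection_mem_orthogonal _
  have huI : Integrable u σ := Lp_integrable hΩ u
  have hkI : Integrable k σ := Lp_integrable hΩ k
  obtain ⟨C, -, hC⟩ := hΩ.exists_forall_surfaceMeasure_ball_le
  filter_upwards [ae_mem_sphere hR,
    ae_tendsto_integral_poissonProfile_mul hC (Lp.stronglyMeasurable u) huI,
    ae_tendsto_integral_poissonProfile_mul hC (Lp.stronglyMeasurable k) hkI] with x hx hLu hLk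
  refine ⟨fun ε hε => integrableOn_kernelW (Lp_integrable hΩ _) x hε, ?_⟩
  have hball := hΩ.tendsto_surfaceMeasure_ball (x := x) (by rwa [frontier_ball c hR.ne'])
  have h1 := tendsto_integral_poissonProfile_smul hkI hball hLk
  have hq := tendsto_poissonRadius R
  have h2 := ((hq.mul ((hq.pow 2).const_add 1)).div_const R).smul h1
  have h3 := tendsto_integral_kernel_sub hΩ hR hx huI hLu
  -- The factor comes from i/(4π) and σ·(x-y) σ_Y = -R(1 - σ_X σ_Y). The truncated integral is the
  -- regularised one, with limit (4π/R)k(x), minus the difference, with limit (2π/R)u(x).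
  have h4 := (h2.sub h3).const_smul (-Complex.I * (R / (4 * Real.pi) : ℝ))
  have hlim : (-Complex.I * (R / (4 * Real.pi) : ℝ)) • ((1 * (1 + 1 ^ 2) / R) •
      (2 * Real.pi) • k x - (2 * Real.pi / R) • u x) = -Complex.I • (k x - (1 / 2 : ℂ) • u x) := by
    have hpi := Real.pi_pos.ne'
    rw [mul_smul]
    congr 1
    rw [Complex.coe_smul, smul_sub, smul_smul, smul_smul, smul_smul]
    have e1 : R / (4 * Real.pi) * (1 * (1 + 1 ^ 2) / R) * (2 * Real.pi) = 1 := by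
      field_simp
      norm_num
    have e2 : R / (4 * Real.pi) * (2 * Real.pi / R) = 1 / 2 := by
      field_simp
      norm_num
    rw [e1, e2, one_smul, ← Complex.coe_smul (1 / 2 : ℝ)]
    norm_num
  rw [hlim] at h4
  refine h4.congr' ?_
  filter_upwards [self_mem_nhdsWithin] with ε hε
  have hε : 0 < ε := hε
  -- The part u - k is orthogonal to the Hardy space and contributes nothing to the regularised
  -- integral.
  have h5 : ∫ y, smoothKernel c R ε x y (u y) ∂σ = (poissonRadius (ε / R) *
      (1 + poissonRadius (ε / R) ^ 2) / R) • ∫ y, poissonProfile ε ‖x - y‖ • k y ∂σ := by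
    rw [← integral_smoothKernel_of_mem hΩ hR hε hx hkm, ← sub_eq_zero, ← integral_sub
      (integrable_smoothKernel hR hx hε huI) (integrable_smoothKernel hR hx hε hkI),
      ← integral_smoothKernel_of_mem_orthogonal hΩ hR hε hx huk]
    refine integral_congr_ae ?_
    filter_upwards [Lp.coeFn_sub u k] with y hy
    rw [hy, Pi.sub_apply, smoothKernel_sub_apply]
  have hs : MeasurableSet {y : E3 | ε < ‖x - y‖} := measurableSet_lt (by fun_prop) (by fun_prop)
  rw [← h5, sub_sub_cancel, ← integral_indicator hs, ← Complex.coe_smul (4 * Real.pi)⁻¹,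
    ← integral_smul, ← integral_smul]
  refine integral_congr_ae ?_
  filter_upwards [ae_mem_sphere hR, sigmaNu_ball_ae hΩ hR u] with y hy hN
  simp only [truncatedKernel, Set.indicator_apply, Set.mem_ofPred_eq]
  split_ifs with h
  · have e1 : x - y = R • (sphereMap c R x - sphereMap c R y) := by
      rw [sphereMap_sub, smul_smul, mul_inv_cancel₀ hR.ne', one_smul]
    rw [kernelW_apply, hN]
    have e2 : sigmaAct (x - y) (sigmaAct (sphereMap c R y) (u y)) = (R : ℂ) •
        -(u y - sigmaAct (sphereMap c R x) (sigmaAct (sphereMap c R y) (u y))) := by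
      rw [e1, sigmaAct_smul, smul_apply, sigmaAct_sub, sub_apply, sigmaAct_sigmaAct,
        norm_sphereMap hR hy, Complex.coe_smul]
      simp
    rw [e2, ← Complex.coe_smul (‖x - y‖ ^ 3)⁻¹, smul_neg, smul_neg, smul_neg, smul_smul, smul_smul,
      smul_smul, ← neg_smul]
    congr 1
    push_cast
    ring
  · simp

end Ball

/-! ### The operators on the ball and the equivalence. -/

theorem isSelfAdjoint_of_isOrthogonalProjection {H : Type*} [NormedAddCommGroup H]
    [InnerProductSpace ℂ H] [CompleteSpace H] {T : H →ₗ.[ℂ] H} (h : IsOrthogonalProjection T) :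
    IsSelfAdjoint T := by
  obtain ⟨K, hK, rfl⟩ := h
  rw [LinearPMap.isSelfAdjoint_def,
    ContinuousLinearMap.toPMap_adjoint_eq_adjoint_toPMap_of_dense _ dense_univ]
  congr 2
  exact isSelfAdjoint_starProjection K

section Ball

variable {c : E3} {R : ℝ}

instance hardySpace_hasOrthogonalProjection : (hardySpace c R).HasOrthogonalProjection := by
  unfold hardySpace
  infer_instance

theorem opMul_opW_opSigmaNu (hΩ : IsBoundedC1Domain (Metric.ball c R)) (hR : 0 < R)
    (u : BoundaryL2 (Metric.ball c R)) :
    ∃ h : u ∈ (opMul (opW (Metric.ball c R)) (opSigmaNu (Metric.ball c R))).domain,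
      opMul (opW (Metric.ball c R)) (opSigmaNu (Metric.ball c R)) ⟨u, h⟩ =
        -Complex.I • ((hardySpace c R).starProjection u - (1 / 2 : ℂ) • u) := by
  have hpv : ∀ᵐ x ∂surfaceMeasure (Metric.ball c R), HasPrincipalValue (Metric.ball c R)
      (hΩ.sigmaNu u) x ((-Complex.I • ((hardySpace c R).starProjection u - (1 / 2 : ℂ) • u) :
        BoundaryL2 (Metric.ball c R)) x) := by
    filter_upwards [hasPrincipalValue_sigmaNu hΩ hR u,
      Lp.coeFn_smul (-Complex.I) ((hardySpace c R).starProjection u - (1 / 2 : ℂ) • u),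
      Lp.coeFn_sub ((hardySpace c R).starProjection u) ((1 / 2 : ℂ) • u),
      Lp.coeFn_smul (1 / 2 : ℂ) u] with x h1 h2 h3 h4
    rwa [h2, Pi.smul_apply, h3, Pi.sub_apply, h4, Pi.smul_apply]
  have hd : hΩ.sigmaNu u ∈ (opW (Metric.ball c R)).domain := mem_domain_opW_iff.2 ⟨_, hpv⟩
  have h1 := hΩ.mem_domain_opSigmaNu u
  have e : opSigmaNu (Metric.ball c R) ⟨u, h1⟩ = hΩ.sigmaNu u := hΩ.opSigmaNu_apply _
  have h2 : opSigmaNu (Metric.ball c R) ⟨u, h1⟩ ∈ (opW (Metric.ball c R)).domain := by rwa [e]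
  refine ⟨mem_domain_opMul_iff.2 ⟨h1, h2⟩, ?_⟩
  rw [opMul_apply _ h1 h2]
  exact opW_apply_eq _ (by simpa only [e] using hpv)

theorem opPPlus_ball (hΩ : IsBoundedC1Domain (Metric.ball c R)) (hR : 0 < R) :
    opPPlus (Metric.ball c R) = ((hardySpace c R).starProjection :
      BoundaryL2 (Metric.ball c R) →ₗ[ℂ] BoundaryL2 (Metric.ball c R)).toPMap ⊤ := by
  refine LinearPMap.ext ?_ fun u hf hg => ?_
  · exact eq_top_iff.2 fun u _ => ⟨trivial, (opMul_opW_opSigmaNu hΩ hR u).1⟩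
  · obtain ⟨h, e⟩ := opMul_opW_opSigmaNu hΩ hR u
    change (1 / 2 : ℂ) • u + Complex.I • opMul (opW (Metric.ball c R))
      (opSigmaNu (Metric.ball c R)) ⟨u, h⟩ = (hardySpace c R).starProjection u
    rw [e, smul_smul, mul_neg, Complex.I_mul_I, neg_neg, one_smul, add_sub_cancel]

theorem opPMinus_ball (hΩ : IsBoundedC1Domain (Metric.ball c R)) (hR : 0 < R) :
    opPMinus (Metric.ball c R) = ((hardySpace c R)ᗮ.starProjection :
      BoundaryL2 (Metric.ball c R) →ₗ[ℂ] BoundaryL2 (Metric.ball c R)).toPMap ⊤ := by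
  refine LinearPMap.ext ?_ fun u hf hg => ?_
  · exact eq_top_iff.2 fun u _ => ⟨trivial, (opMul_opW_opSigmaNu hΩ hR u).1⟩
  · obtain ⟨h, e⟩ := opMul_opW_opSigmaNu hΩ hR u
    change (1 / 2 : ℂ) • u - Complex.I • opMul (opW (Metric.ball c R))
      (opSigmaNu (Metric.ball c R)) ⟨u, h⟩ = (hardySpace c R)ᗮ.starProjection u
    rw [e, smul_smul, mul_neg, Complex.I_mul_I, neg_neg, one_smul,
      Submodule.starProjection_orthogonal_val]
    module

/-- The anticommutation already holds for the kernels: σ_{X-Y} σ_Y = σ_X σ_Y - 1 = -σ_X σ_{X-Y} for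
unit vectors. It therefore passes through truncations and limits. -/
theorem HasPrincipalValue.sigmaNu_ball (hΩ : IsBoundedC1Domain (Metric.ball c R)) (hR : 0 < R)
    {u : BoundaryL2 (Metric.ball c R)} {x : E3} {v : Spinor} (hx : x ∈ Metric.sphere c R)
    (h : HasPrincipalValue (Metric.ball c R) u x v) :
    HasPrincipalValue (Metric.ball c R) (hΩ.sigmaNu u) x (-sigmaAct (sphereMap c R x) v) := by
  refine ⟨fun ε hε => integrableOn_kernelW (Lp_integrable hΩ _) x hε, ?_⟩
  have h1 := ((sigmaAct (sphereMap c R x)).continuous.tendsto v).comp h.2 |>.neg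
  refine h1.congr' ?_
  filter_upwards [self_mem_nhdsWithin] with ε hε
  simp only [Function.comp_apply]
  rw [← Complex.coe_smul (4 * Real.pi)⁻¹, map_smul, ← smul_neg, Complex.coe_smul,
    ← ContinuousLinearMap.integral_comp_comm _ (h.1 ε hε), ← integral_neg]
  congr 1
  refine integral_congr_ae (ae_restrict_of_ae ?_)
  filter_upwards [ae_mem_sphere hR, sigmaNu_ball_ae hΩ hR u] with y hy hN
  have e1 : x - y = R • (sphereMap c R x - sphereMap c R y) := by
    rw [sphereMap_sub, smul_smul, mul_inv_cancel₀ hR.ne', one_smul]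
  rw [hN, kernelW_apply, kernelW_apply, map_smul, ← smul_neg]
  congr 1
  rw [e1, sigmaAct_smul, smul_apply, smul_apply, ← Complex.coe_smul, ← Complex.coe_smul, map_smul,
    ← smul_neg, sigmaAct_sub, sub_apply, sub_apply, map_sub, sigmaAct_sigmaAct, sigmaAct_sigmaAct,
    norm_sphereMap hR hx, norm_sphereMap hR hy, neg_sub]

theorem anticommutator_ball (hΩ : IsBoundedC1Domain (Metric.ball c R)) (hR : 0 < R) :
    anticommutator (opW (Metric.ball c R)) (opSigmaNu (Metric.ball c R)) = 0 := by
  -- W_m(σ·ν) is everywhere defined and σ·ν is onto, being an involution; hence W_m is everywhere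
  -- defined.
  have hdom : ∀ u, u ∈ (opW (Metric.ball c R)).domain := fun u => by
    obtain ⟨h1, h2⟩ := mem_domain_opMul_iff.1 (opMul_opW_opSigmaNu hΩ hR (hΩ.sigmaNu u)).1
    rwa [hΩ.opSigmaNu_apply, hΩ.sigmaNu_sigmaNu] at h2
  have hd1 : ∀ u, u ∈ (opMul (opW (Metric.ball c R)) (opSigmaNu (Metric.ball c R))).domain :=
    fun u => mem_domain_opMul_iff.2 ⟨hΩ.mem_domain_opSigmaNu u, hdom _⟩
  have hd2 : ∀ u, u ∈ (opMul (opSigmaNu (Metric.ball c R)) (opW (Metric.ball c R))).domain :=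
    fun u => mem_domain_opMul_iff.2 ⟨hdom u, hΩ.mem_domain_opSigmaNu _⟩
  refine LinearPMap.ext (eq_top_iff.2 fun u _ => ⟨hd1 u, hd2 u⟩) fun u hf hg => ?_
  change opMul (opW (Metric.ball c R)) (opSigmaNu (Metric.ball c R)) ⟨u, hd1 u⟩ +
    opMul (opSigmaNu (Metric.ball c R)) (opW (Metric.ball c R)) ⟨u, hd2 u⟩ = 0
  rw [opMul_apply _ (hΩ.mem_domain_opSigmaNu u) (hdom _),
    opMul_apply _ (hdom u) (hΩ.mem_domain_opSigmaNu _), hΩ.opSigmaNu_apply]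
  rw [add_eq_zero_iff_eq_neg]
  refine opW_apply_eq _ ?_
  filter_upwards [opW_apply_hasPrincipalValue ⟨u, hdom u⟩, ae_mem_sphere hR,
    Lp.coeFn_neg (hΩ.sigmaNu (opW (Metric.ball c R) ⟨u, hdom u⟩)),
    sigmaNu_ball_ae hΩ hR (opW (Metric.ball c R) ⟨u, hdom u⟩)] with x h1 hx h2 h3
  rw [hΩ.opSigmaNu_apply, h2, Pi.neg_apply, h3]
  exact h1.sigmaNu_ball hΩ hR hx

end Ball

/-- Self-adjointness of `P_±`, the projection property, the anticommutation of `W_m` with `σ · ν` and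
`Ω` being a ball are equivalent. -/
theorem lemma4p6 (Ω : Set E3) (hΩ : IsBoundedC1Domain Ω) :
    List.TFAE [
      IsSelfAdjoint (opPPlus Ω) ∧ IsSelfAdjoint (opPMinus Ω),
      IsOrthogonalProjection (opPPlus Ω) ∧ IsOrthogonalProjection (opPMinus Ω),
      anticommutator (opW Ω) (opSigmaNu Ω) = 0,
      ∃ (c : E3) (r : ℝ), 0 < r ∧ Ω = Metric.ball c r] := by
  tfae_have 2 → 1 := fun h => ⟨isSelfAdjoint_of_isOrthogonalProjection h.1,
    isSelfAdjoint_of_isOrthogonalProjection h.2⟩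
  tfae_have 1 → 4 := fun h => hΩ.exists_eq_ball_of_kernel_identity fun _ hp _ hq hne ξ =>
    hΩ.kernel_identity_of_isSelfAdjoint h.1 hp hq hne ξ
  tfae_have 3 → 4 := fun h => hΩ.exists_eq_ball_of_kernel_identity fun _ hp _ hq hne ξ =>
    hΩ.kernel_identity_of_anticommutator h hp hq hne ξ
  tfae_have 4 → 2 := by
    rintro ⟨c, r, hr, rfl⟩
    exact ⟨⟨_, inferInstance, opPPlus_ball hΩ hr⟩, ⟨_, inferInstance, opPMinus_ball hΩ hr⟩⟩
  tfae_have 4 → 3 := by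
    rintro ⟨c, r, hr, rfl⟩
    exact anticommutator_ball hΩ hr
  tfae_finish
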